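/- Let $\Omega\subset\mathbb R^2$ be a simply connected polygonal domain, i.e. a simply connected open set with $\operatorname{int}\overline\Omega=\Omega$ whose closure is a finite union of triangles, and let $\tau^M=\{T_k^M\}$ be a finite conforming triangulation of $\overline\Omega$. Vertices and edges of $\tau^M$ are called exterior if they lie on $\partial\Omega$ and interior otherwise; let $E^M_{int}$ be the set of interior edges and $V^M_{int}$ the set of interior vertices. The Powell--Sabin split $\tau$ of $\tau^M$ has as additional vertices the incenter $z_c^{(k)}$ of each $T_k^M$ and one singular point on each edge: the midpoint if the edge is exterior, and the intersection with the segment joining the incenters of the two adjacent triangles if it is interior. Each $T^M_k$ is divided into the six triangles spanned by its incenter, one of its vertices, and the singular point on one of the two edges at that vertex. Let $X^0$ be the space of continuous functions $v:\overline\Omega\to\mathbb R^2$ that are affine on each $T\in\tau$ and vanish on $\partial\Omega$, and let $V^0=\{v\in X^0:\nabla\cdot v=0\}$. Let $P$ be the space of $q\in L^2(\Omega)$ with $\int_\Omega q\,dx=0$ that are constant on each $T\in\tau$ and satisfy, at every singular point $z$, $q|_{T_1}-q|_{T_2}+q|_{T_3}-q|_{T_4}=0$ if $z$ lies on an interior edge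 and $q|_{T_1}-q|_{T_2}=0$ if $z$ lies on an exterior edge, where $T_1,T_2,\dots$ are the triangles of $\tau$ with vertex $z$, in cyclic order around $z$. For a vertex $z$ of $\tau$ let $\lambda_z:\overline\Omega\to\mathbb R$ be the continuous function, affine on each $T\in\tau$, with $\lambda_z(z)=1$ and $\lambda_z(w)=0$ at all other vertices $w$ of $\tau$. For each $e\in E^M_{int}$ let $z_s^{(e)}$ be its singular point, $n_e$ a unit normal and $t_e$ a unit tangent. Fix a vertex $z_0\in\partial\Omega$ of $\tau^M$, and let $\mathcal T$ be the edge set of a spanning tree of the graph whose vertices are $V^M_{int}\cup\{z_0\}$ and whose edges are all edges of $\tau^M$ with both endpoints in this set (so $\mathcal T\subset E^M_{int}$). Set $$\mathcal S=\{\lambda_{z_s^{(e)}}n_e\}_{e\in E^M_{int}\setminus\mathcal T}\cup\{\lambda_{z_s^{(e)}}t_e\}_{e\in E^M_{int}}\cup\{\lambda_{z_c^{(k)}}(1,0)\}_{k}\cup\{\lambda_{z_c^{(k)}}(0,1)\}_{k}.$$ Then $\mathcal S$ is a basis of a complement of $V^0$ in $X^0$: its members lie in $X^0\setminus V^0$,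 are linearly independent, and $X^0=V^0\oplus\operatorname{span}\mathcal S$. Moreover the divergences of the members of $\mathcal S$ are linearly independent and form a basis of $P$. These bases are local: each $\lambda_z a\in\mathcal S$ vanishes, and its divergence vanishes almost everywhere, outside the union of the triangles $T\in\tau$ that have $z$ as a vertex. -/

import Mathlib

open Set MeasureTheory

noncomputable section

namespace PowellSabin

/-- The Euclidean plane. -/
abbrev E2 : Type := EuclideanSpace ℝ (Fin 2)

/-! ### Macro-meshes -/

/-- The closed triangle spanned by the vertices of `T`. -/
def hull (T : Affine.Triangle ℝ E2) : Set E2 := convexHull ℝ (range T.points)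

/-- `T` is a conforming triangulation of `Ω`: the closed triangles `T k` are pairwise distinct, cover
the closure of `Ω`, and two of them meet exactly in the (possibly empty) face spanned by their common
vertices. -/
structure IsConformingTriangulation (Ω : Set E2) {ι : Type*} (T : ι → Affine.Triangle ℝ E2) :
    Prop where
  closure_eq : closure Ω = ⋃ k, hull (T k)
  range_ne : ∀ k l, k ≠ l → range (T k).points ≠ range (T l).points
  inter_eq : ∀ k l, k ≠ l →
    hull (T k) ∩ hull (T l) = convexHull ℝ (range (T k).points ∩ range (T l).points)

section Mesh

variable (Ω : Set E2) {ι : Type*} (T : ι → Affine.Triangle ℝ E2)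

/-- The vertices of the macro-mesh. -/
def vertices : Set E2 := {z | ∃ k, z ∈ range (T k).points}

/-- The exterior macro-vertices: those on `∂Ω`. -/
def extVertices : Set E2 := {z | z ∈ vertices T ∧ z ∈ frontier Ω}

/-- The interior macro-vertices: those not on `∂Ω`. -/
def intVertices : Set E2 := {z | z ∈ vertices T ∧ z ∉ frontier Ω}

/-- The graph of the macro-mesh: two points are adjacent if they are distinct vertices of a common
triangle. Its edge set is the set of edges of the macro-mesh. -/
def meshGraph : SimpleGraph E2 where
  Adj a b := a ≠ b ∧ ∃ k, a ∈ range (T k).points ∧ b ∈ range (T k).points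
  symm := ⟨fun _ _ h => ⟨h.1.symm, h.2.imp fun _ hk => ⟨hk.2, hk.1⟩⟩⟩
  loopless := ⟨fun _ h => h.1 rfl⟩

/-- The closed segment joining the two endpoints of an edge. -/
def edgeHull (e : Sym2 E2) : Set E2 := convexHull ℝ {x | x ∈ e}

/-- The exterior edges: those lying on `∂Ω`. -/
def extEdges : Set (Sym2 E2) := {e | e ∈ (meshGraph T).edgeSet ∧ edgeHull e ⊆ frontier Ω}

/-- The interior edges: those not lying on `∂Ω`. -/
def intEdges : Set (Sym2 E2) := {e | e ∈ (meshGraph T).edgeSet ∧ ¬ edgeHull e ⊆ frontier Ω}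

/-- The vertices of the graph that carries the spanning tree: all interior macro-vertices, and the
point `z₀`. -/
def treeVertices (z₀ : E2) : Set E2 := insert z₀ (intVertices Ω T)

/-- The macro-mesh graph restricted to `treeVertices`: its edges are all the edges of the macro-mesh
with both endpoints in that set. -/
def treeGraph (z₀ : E2) : SimpleGraph (treeVertices Ω T z₀) :=
  (meshGraph T).induce (treeVertices Ω T z₀)

/-! ### The Powell-Sabin split -/

/-- `z` is the point at which the edge `e` is split: the midpoint of `e` if `e` is exterior, and the
point of `e` on the segment joining the incenters of the two triangles that share `e` otherwise. -/
def IsSingularPoint (e : Sym2 E2) (z : E2) : Prop :=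
  (e ∈ extEdges Ω T → ∀ a b, e = s(a, b) → z = midpoint ℝ a b) ∧
  (e ∈ intEdges Ω T → z ∈ edgeHull e ∧
    ∀ k l, k ≠ l → (∀ a ∈ e, a ∈ range (T k).points ∧ a ∈ range (T l).points) →
      z ∈ segment ℝ (T k).incenter (T l).incenter)

/-- The singular point of the split on the edge `e`. -/
def singularPoint (e : Sym2 E2) : E2 := Classical.epsilon (IsSingularPoint Ω T e)

/-- The ordered pairs of distinct vertices of a triangle. They label its six subtriangles. -/
abbrev Flag : Type := {p : Fin 3 × Fin 3 // p.1 ≠ p.2}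

/-- The three vertices of the subtriangle of `T k` labelled by `(i, j)`: the vertex `i` of `T k`, the
singular point on the edge joining the vertices `i` and `j`, and the incenter. -/
def cellVertices (k : ι) (p : Flag) : Set E2 :=
  {(T k).points p.1.1, singularPoint Ω T s((T k).points p.1.1, (T k).points p.1.2),
    (T k).incenter}

/-- The closed triangles of the Powell-Sabin mesh. -/
def cell (k : ι) (p : Flag) : Set E2 := convexHull ℝ (cellVertices Ω T k p)

/-- The vertices of the Powell-Sabin mesh. -/
def splitVertices : Set E2 := {z | ∃ k p, z ∈ cellVertices Ω T k p}

/-- The union of the triangles of the Powell-Sabin mesh that have `z` as a vertex. -/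
def star (z : E2) : Set E2 := {x | ∃ k p, z ∈ cellVertices Ω T k p ∧ x ∈ cell Ω T k p}

/-! ### Finite element spaces -/

/-- The continuous functions on the closure of `Ω` with values in `F` that are affine on each triangle
of the Powell-Sabin mesh. -/
def pwAffine (F : Type*) [NormedAddCommGroup F] [NormedSpace ℝ F] :
    Submodule ℝ C(closure Ω, F) where
  carrier := {v | ∀ k p, ∃ A : E2 →ᵃ[ℝ] F, ∀ x : closure Ω, (x : E2) ∈ cell Ω T k p → v x = A x}
  zero_mem' := fun _ _ => ⟨0, fun _ _ => rfl⟩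
  add_mem' := by
    intro v w hv hw k p
    obtain ⟨A, hA⟩ := hv k p
    obtain ⟨B, hB⟩ := hw k p
    exact ⟨A + B, fun x hx => by simp [hA x hx, hB x hx]⟩
  smul_mem' := by
    intro c v hv k p
    obtain ⟨A, hA⟩ := hv k p
    exact ⟨c • A, fun x hx => by simp [hA x hx]⟩

/-- The scalar space `S_h`. -/
abbrev Sh : Submodule ℝ C(closure Ω, ℝ) := pwAffine Ω T ℝ

/-- The velocity space `X_h`. -/
abbrev Xh : Submodule ℝ C(closure Ω, E2) := pwAffine Ω T E2

/-- The velocity space `X_h^0`: the elements of `X_h` that vanish on `∂Ω`. -/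
def Xh0 : Submodule ℝ C(closure Ω, E2) where
  carrier := {v | v ∈ Xh Ω T ∧ ∀ x : closure Ω, (x : E2) ∈ frontier Ω → v x = 0}
  zero_mem' := ⟨zero_mem _, fun _ _ => rfl⟩
  add_mem' := by
    rintro v w ⟨hv, hv'⟩ ⟨hw, hw'⟩
    exact ⟨add_mem hv hw, fun x hx => by simp [hv' x hx, hw' x hx]⟩
  smul_mem' := by
    rintro c v ⟨hv, hv'⟩
    exact ⟨Submodule.smul_mem _ c hv, fun x hx => by simp [hv' x hx]⟩

variable {Ω} in
/-- A function on the closure of `Ω`, extended by zero to the plane. At points of the open set `Ω` the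
derivative does not depend on the extension. -/
def ext0 (v : C(closure Ω, E2)) : E2 → E2 := Function.extend Subtype.val v 0

variable {Ω} in
/-- The divergence `∂₁ v₁ + ∂₂ v₂`. A continuous piecewise affine `v` is differentiable in `Ω` off the
edges of the mesh, so that for such `v` this is the weak divergence almost everywhere in `Ω`. -/
def divergence (v : C(closure Ω, E2)) (x : E2) : ℝ :=
  ∑ i : Fin 2, fderiv ℝ (ext0 v) x (EuclideanSpace.single i 1) i

variable {T} in
lemma Xh_differentiableAt {v : C(closure Ω, E2)} (hv : v ∈ Xh Ω T) {k : ι} {p : Flag} {x : E2}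
    (hx : x ∈ interior Ω) (hxc : x ∈ interior (cell Ω T k p)) :
    DifferentiableAt ℝ (ext0 v) x := by
  obtain ⟨A, hA⟩ := hv k p
  have hAd : DifferentiableAt ℝ A x := by
    rw [AffineMap.decomp A]
    exact (LinearMap.toContinuousLinearMap A.linear).differentiableAt.add
      (differentiableAt_const (A 0))
  refine hAd.congr_of_eventuallyEq ?_
  filter_upwards [isOpen_interior.mem_nhds hx, isOpen_interior.mem_nhds hxc] with y hy hyc
  have hy' : y ∈ closure Ω := subset_closure (interior_subset hy)
  have h := Subtype.val_injective.extend_apply v 0 (⟨y, hy'⟩ : closure Ω)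
  exact h.trans (hA ⟨y, hy'⟩ (interior_subset hyc))

lemma ext0_add (v w : C(closure Ω, E2)) : ext0 (v + w) = ext0 v + ext0 w := by
  have h := Function.extend_add (Subtype.val : closure Ω → E2) (⇑v) (⇑w) 0 0
  simpa [ext0] using h

lemma ext0_smul (c : ℝ) (v : C(closure Ω, E2)) : ext0 (c • v) = c • ext0 v := by
  have h := Function.extend_smul c (Subtype.val : closure Ω → E2) (⇑v) 0
  simpa [ext0] using h

/-- The solenoidal space `V_h^0`: the elements of `X_h^0` whose divergence vanishes (in `Ω`, in the
interior of each triangle of the Powell-Sabin mesh). -/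
def Vh0 : Submodule ℝ C(closure Ω, E2) where
  carrier := {v | v ∈ Xh0 Ω T ∧
    ∀ k p, ∀ x ∈ interior Ω, x ∈ interior (cell Ω T k p) → divergence v x = 0}
  zero_mem' := by
    refine ⟨zero_mem _, fun k p x _ _ => ?_⟩
    have h : ext0 (0 : C(closure Ω, E2)) = 0 := by
      exact Function.extend_zero _
    simp [divergence, h]
  add_mem' := by
    rintro v w ⟨hv, hv'⟩ ⟨hw, hw'⟩
    refine ⟨add_mem hv hw, fun k p x hx hxc => ?_⟩
    have h1 := hv' k p x hx hxc
    have h2 := hw' k p x hx hxc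
    have d1 := Xh_differentiableAt Ω hv.1 hx hxc
    have d2 := Xh_differentiableAt Ω hw.1 hx hxc
    simp only [divergence] at h1 h2
    simp only [divergence, ext0_add, fderiv_add d1 d2, add_apply,
      PiLp.add_apply, Finset.sum_add_distrib, h1, h2, add_zero]
  smul_mem' := by
    rintro c v ⟨hv, hv'⟩
    refine ⟨Submodule.smul_mem _ c hv, fun k p x hx hxc => ?_⟩
    have h1 := hv' k p x hx hxc
    have d1 := Xh_differentiableAt Ω hv.1 hx hxc
    simp only [divergence] at h1
    simp only [divergence, ext0_smul, fderiv_const_smul d1, smul_apply,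
      PiLp.smul_apply, smul_eq_mul, ← Finset.mul_sum, h1, mul_zero]

/-- Lebesgue measure on `Ω`. -/
abbrev μ : Measure E2 := volume.restrict Ω

lemma measurable_divergence (v : C(closure Ω, E2)) : Measurable (divergence v) := by
  refine Finset.measurable_sum _ fun i _ => ?_
  exact (EuclideanSpace.proj (𝕜 := ℝ) i).measurable.comp
    (measurable_fderiv_apply_const ℝ (ext0 v) (EuclideanSpace.single i 1))

variable {Ω} in
/-- The divergence as a class of functions on `Ω` up to equality almost everywhere. -/
def divClass (v : C(closure Ω, E2)) : E2 →ₘ[μ Ω] ℝ :=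
  AEEqFun.mk (divergence v) (measurable_divergence Ω v).aestronglyMeasurable

/-- The functional `θ` vanishes at every singular point, for the function with the constant value
`c k p` on the subtriangle `p` of `T k`. The first clause treats the edge joining the vertices
`i, j` of `T k`, which are the vertices `i', j'` of a second triangle `T l`: in their cyclic order the
four subtriangles at the singular point are `(k, ij)`, `(k, ji)`, `(l, j'i')`, `(l, i'j')`. -/
def ThetaVanishes (c : ι → Flag → ℝ) : Prop :=
  (∀ k l, k ≠ l → ∀ p q : Flag,
    (T k).points p.1.1 = (T l).points q.1.1 → (T k).points p.1.2 = (T l).points q.1.2 →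
    s((T k).points p.1.1, (T k).points p.1.2) ∈ intEdges Ω T →
      c k p - c k ⟨p.1.swap, p.2.symm⟩ + c l ⟨q.1.swap, q.2.symm⟩ - c l q = 0) ∧
  (∀ k, ∀ p : Flag, s((T k).points p.1.1, (T k).points p.1.2) ∈ extEdges Ω T →
      c k p - c k ⟨p.1.swap, p.2.symm⟩ = 0)

/-- The pressure space `P_h`: square-integrable functions with mean zero (integrability, which follows
from square-integrability on a bounded set, is recorded so that the mean value makes sense), constant
on each triangle of the Powell-Sabin mesh, and annihilated by `θ` at each singular point. -/
def Ph : Submodule ℝ (E2 →ₘ[μ Ω] ℝ) where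
  carrier := {q | MemLp q 2 (μ Ω) ∧ Integrable q (μ Ω) ∧ ∫ x, q x ∂(μ Ω) = 0 ∧
    ∃ c : ι → Flag → ℝ, (∀ k p, ∀ᵐ x ∂(μ Ω), x ∈ cell Ω T k p → q x = c k p) ∧
      ThetaVanishes Ω T c}
  zero_mem' := by
    have h0 := AEEqFun.coeFn_zero (α := E2) (β := ℝ) (μ := μ Ω)
    refine ⟨(memLp_congr_ae h0).2 MemLp.zero, (integrable_congr h0).2 (integrable_zero _ _ _), ?_,
      0, fun k p => ?_, ?_⟩
    · rw [integral_congr_ae h0]; simp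
    · filter_upwards [h0] with x hx _
      simpa using hx
    · exact ⟨by intros; simp, by intros; simp⟩
  add_mem' := by
    rintro q r ⟨hq, hq1, hq0, c, hc, hcθ⟩ ⟨hr, hr1, hr0, d, hd, hdθ⟩
    have h0 := AEEqFun.coeFn_add q r
    refine ⟨(memLp_congr_ae h0).2 (hq.add hr), (integrable_congr h0).2 (hq1.add hr1), ?_,
      c + d, fun k p => ?_, ?_, ?_⟩
    · rw [integral_congr_ae h0]
      simp only [Pi.add_apply]
      rw [integral_add hq1 hr1, hq0, hr0, add_zero]
    · filter_upwards [h0, hc k p, hd k p] with x hx h1 h2 hxc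
      rw [hx, Pi.add_apply, h1 hxc, h2 hxc]; rfl
    · intro k l hkl p q h1 h2 h3
      have a1 := hcθ.1 k l hkl p q h1 h2 h3
      have a2 := hdθ.1 k l hkl p q h1 h2 h3
      simp only [Pi.add_apply]; linarith
    · intro k p h
      have a1 := hcθ.2 k p h
      have a2 := hdθ.2 k p h
      simp only [Pi.add_apply]; linarith
  smul_mem' := by
    rintro a q ⟨hq, hq1, hq0, c, hc, hcθ⟩
    have h0 := AEEqFun.coeFn_smul a q
    refine ⟨(memLp_congr_ae h0).2 (hq.const_smul a), (integrable_congr h0).2 (hq1.smul a), ?_,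
      a • c, fun k p => ?_, ?_, ?_⟩
    · rw [integral_congr_ae h0]
      simp only [Pi.smul_apply]
      rw [integral_smul, hq0, smul_zero]
    · filter_upwards [h0, hc k p] with x hx h1 hxc
      rw [hx, Pi.smul_apply, h1 hxc]; rfl
    · intro k l hkl p q h1 h2 h3
      have a1 := hcθ.1 k l hkl p q h1 h2 h3
      simp only [Pi.smul_apply, smul_eq_mul]; linear_combination a * a1
    · intro k p h
      have a1 := hcθ.2 k p h
      simp only [Pi.smul_apply, smul_eq_mul]; linear_combination a * a1

/-! ### The candidate basis -/

/-- `lam` is the nodal basis function of `S_h` at `z`. -/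
def IsNodal (z : E2) (lam : C(closure Ω, ℝ)) : Prop :=
  lam ∈ Sh Ω T ∧
    ∀ x : closure Ω, (x : E2) ∈ splitVertices Ω T →
      ((x : E2) = z → lam x = 1) ∧ ((x : E2) ≠ z → lam x = 0)

/-- The nodal basis function `λ_z` of `S_h`. -/
def hat (z : E2) : C(closure Ω, ℝ) := Classical.epsilon (IsNodal Ω T z)

/-- The vector-valued function `λ_z a`. -/
def vecHat (z a : E2) : C(closure Ω, E2) where
  toFun x := hat Ω T z x • a
  continuous_toFun := by fun_prop

/-- The labels of the functions in `𝒮`: the interior edges not in `tree` (for `ψ_s`), all interior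
edges (for `φ_s`), all triangles (for `ψ_c`) and all triangles (for `φ_c`). -/
abbrev BasisIndex (tree : Set (Sym2 E2)) : Type _ :=
  ↥(intEdges Ω T \ tree) ⊕ ↥(intEdges Ω T) ⊕ ι ⊕ ι

variable {tree : Set (Sym2 E2)}

/-- The vertex of the Powell-Sabin mesh at which a function in `𝒮` is centred. -/
def basisNode : BasisIndex Ω T tree → E2
  | .inl e => singularPoint Ω T e.1
  | .inr (.inl e) => singularPoint Ω T e.1
  | .inr (.inr (.inl k)) => (T k).incenter
  | .inr (.inr (.inr k)) => (T k).incenter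

/-- The direction of a function in `𝒮`, where `n e` and `t e` are a normal and a tangent of the edge
`e`. -/
def basisDir (n t : Sym2 E2 → E2) : BasisIndex Ω T tree → E2
  | .inl e => n e.1
  | .inr (.inl e) => t e.1
  | .inr (.inr (.inl _)) => !₂[(1 : ℝ), 0]
  | .inr (.inr (.inr _)) => !₂[(0 : ℝ), 1]

/-- The functions in `𝒮`. -/
def basisFun (n t : Sym2 E2 → E2) (s : BasisIndex Ω T tree) : C(closure Ω, E2) :=
  vecHat Ω T (basisNode Ω T s) (basisDir Ω T n t s)

end Mesh

end PowellSabin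

end

/-! A continuous piecewise affine field is determined by its values at the macro-vertices, the
singular points and the incenters; `nodalDiv` computes its piecewise constant divergence from them.
Two facts carry the theorem: the divergence maps $X^0$ into $P$ (`divClass_mem_Ph`), and it maps the
combinations of $\mathcal S$ one-to-one onto $P$ (`eq_zero_of_fieldDiv_sum_eq_zero`,
`exists_fieldDiv_sum_eq`). Subtracting from $v\in X^0$ the combination with the same divergence
leaves an element of $V^0$, and the remaining claims are linear algebra and locality of the nodal
functions.

Into $P$: the mean is zero because the fluxes through each interior edge cancel
(`sum_nodalDiv_eq_zero`). The four cells at an interior singular point are cut out by two straight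
lines, the edge and the segment of incenters. Expressed in these two directions, the divergence on a
cell is a term depending only on the half of the edge plus a term depending only on the
macro-triangle, and the alternating sum kills both (`thetaVanishes_nodalDiv`).

Onto $P$, injectively: a combination of $\mathcal S$ is a field that vanishes at the macro-vertices
and at the exterior singular points and has no flux through the edges of the tree. For values $y_e$
at the singular points and $z_k$ at the incenters, twice the integral of the divergence over the two
cells at an edge is the determinant of $y_e-z_k$ and the edge vector. Summed over the three edges,
$z_k$ drops out, so the fluxes of the $y_e$ have a prescribed net value in each triangle. Once the
fluxes are known the problem is local: they give $z_k$; the flux and the divergence on one cell give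
$y_e$; the integrals and the relations at the singular points take care of the other cells
(`eq_zero_of_nodalDiv_eq_zero`, `exists_nodalDiv_eq`).

The fluxes come from tree-cotree duality. Existence (`exists_flux`): by duality, an obstruction is a
function on the triangles that jumps only across tree edges. Its jumps sum to zero around each
interior vertex, so they are a flow on a tree without sources outside the root, hence zero, and the
function is constant. Uniqueness (`flux_eq_zero`): to a flow $f$ off the tree without net fluxes add
a tree flow so that the sums around the interior vertices vanish. Since $\Omega$ is simply
connected, the total is the jump of a function on the triangles (`exists_primitive`). Now $f$ is
orthogonal to all jumps and equals this one off the tree, so $\sum f^2=0$. For `exists_primitive`,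
local primitives differ by a locally constant Čech cocycle, and the associated covering of $\Omega$
has a section (`exists_sections_of_cocycle`).

The incenters enter through two properties: they are interior points, and their feet on the sides
lie strictly between the vertices (`inner_incenter_pos`). The second makes the segment between two
adjacent incenters cross the common edge in its relative interior (`exists_crossing`). -/

noncomputable section

namespace PowellSabin

/-! ### Planar geometry -/

/-- The determinant of two plane vectors. -/
def det2 (u v : E2) : ℝ := u 0 * v 1 - u 1 * v 0

lemma det2_add_left (u v w : E2) : det2 (u + v) w = det2 u w + det2 v w := by
  simp [det2]; ring

lemma det2_add_right (u v w : E2) : det2 u (v + w) = det2 u v + det2 u w := by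
  simp [det2]; ring

lemma det2_sub_left (u v w : E2) : det2 (u - v) w = det2 u w - det2 v w := by
  simp [det2]; ring

lemma det2_sub_right (u v w : E2) : det2 u (v - w) = det2 u v - det2 u w := by
  simp [det2]; ring

lemma det2_smul_left (r : ℝ) (u v : E2) : det2 (r • u) v = r * det2 u v := by
  simp [det2]; ring

lemma det2_smul_right (r : ℝ) (u v : E2) : det2 u (r • v) = r * det2 u v := by
  simp [det2]; ring

lemma det2_neg_left (u v : E2) : det2 (-u) v = - det2 u v := by
  simp [det2]; ring

lemma det2_neg_right (u v : E2) : det2 u (-v) = - det2 u v := by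
  simp [det2]; ring

lemma det2_swap (u v : E2) : det2 u v = - det2 v u := by
  simp [det2]; ring

@[simp] lemma det2_self (u : E2) : det2 u u = 0 := by
  simp [det2]; ring

@[simp] lemma det2_zero_left (u : E2) : det2 0 u = 0 := by simp [det2]

@[simp] lemma det2_zero_right (u : E2) : det2 u 0 = 0 := by simp [det2]

lemma E2_ext {u v : E2} (h0 : u 0 = v 0) (h1 : u 1 = v 1) : u = v := by
  ext i; fin_cases i
  · exact h0
  · exact h1

/-- A vector with zero determinant against two independent vectors vanishes. -/
lemma eq_zero_of_det2 {u v w : E2} (h : det2 u v ≠ 0) (h1 : det2 w u = 0) (h2 : det2 w v = 0) :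
    w = 0 := by
  simp only [det2] at h h1 h2
  apply E2_ext
  · have : w 0 * (u 0 * v 1 - u 1 * v 0) = 0 := by linear_combination u 0 * h2 - v 0 * h1
    simpa [h] using this
  · have : w 1 * (u 0 * v 1 - u 1 * v 0) = 0 := by linear_combination u 1 * h2 - v 1 * h1
    simpa [h] using this

/-- Cramer's rule. It produces nodal values from two prescribed determinants, such as a flux and a
divergence. -/
lemma exists_det2_eq {u v : E2} (h : det2 u v ≠ 0) (r s : ℝ) :
    ∃ w, det2 w u = r ∧ det2 w v = s := by
  refine ⟨(s / det2 u v) • u - (r / det2 u v) • v, ?_, ?_⟩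
  · rw [det2_sub_left, det2_smul_left, det2_smul_left, det2_self, det2_swap v u]; field_simp; ring
  · rw [det2_sub_left, det2_smul_left, det2_smul_left, det2_self]; field_simp; ring

lemma inner_E2 (u v : E2) : inner ℝ u v = u 0 * v 0 + u 1 * v 1 := by
  simp [PiLp.inner_apply, Fin.sum_univ_two]; ring

/-- A nonzero vector orthogonal to a nonzero vector is independent of it. -/
lemma det2_ne_zero_of_inner {n u : E2} (hn : n ≠ 0) (hu : u ≠ 0) (h : inner ℝ n u = 0) :
    det2 n u ≠ 0 := by
  intro h0
  rw [inner_E2] at h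
  simp only [det2] at h0
  have hu' : 0 < u 0 ^ 2 + u 1 ^ 2 := by
    by_contra hc
    apply hu
    apply E2_ext <;> simp <;> nlinarith [sq_nonneg (u 0), sq_nonneg (u 1)]
  apply hn
  apply E2_ext
  · have : n 0 * (u 0 ^ 2 + u 1 ^ 2) = 0 := by linear_combination u 0 * h + u 1 * h0
    simpa [hu'.ne'] using this
  · have : n 1 * (u 0 ^ 2 + u 1 ^ 2) = 0 := by linear_combination u 1 * h - u 0 * h0
    simpa [hu'.ne'] using this

/-- Twice the signed area of a triangle. -/
def area (p : Fin 3 → E2) : ℝ := det2 (p 1 - p 0) (p 2 - p 0)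

/-- The barycentric coordinates with respect to a triangle. -/
def bary (p : Fin 3 → E2) (m : Fin 3) : E2 →ᵃ[ℝ] ℝ where
  toFun x := det2 (p (m + 1) - x) (p (m + 2) - x) / area p
  linear :=
    { toFun := fun x => det2 x (p (m + 1) - p (m + 2)) / area p
      map_add' := fun x y => by rw [det2_add_left]; ring
      map_smul' := fun r x => by rw [det2_smul_left]; simp; ring }
  map_vadd' x v := by
    simp [det2]
    ring

lemma bary_apply (p : Fin 3 → E2) (m : Fin 3) (x : E2) :
    bary p m x = det2 (p (m + 1) - x) (p (m + 2) - x) / area p := rfl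

lemma bary_linear_apply (p : Fin 3 → E2) (m : Fin 3) (x : E2) :
    (bary p m).linear x = det2 x (p (m + 1) - p (m + 2)) / area p := rfl

lemma bary_ne {p : Fin 3 → E2} {m i : Fin 3} (h : i ≠ m) : bary p m (p i) = 0 := by
  rw [bary_apply, div_eq_zero_iff]
  left
  fin_cases m <;> fin_cases i <;> first | exact absurd rfl h | (simp [det2])

section bary
variable {p : Fin 3 → E2} (hp : area p ≠ 0)
include hp

lemma bary_self (m : Fin 3) : bary p m (p m) = 1 := by
  rw [bary_apply, div_eq_one_iff_eq hp]
  fin_cases m <;> simp [area, det2] <;> ring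

lemma bary_vertex (m i : Fin 3) : bary p m (p i) = if i = m then 1 else 0 := by
  split_ifs with h
  · rw [h, bary_self hp]
  · exact bary_ne h

lemma sum_bary (x : E2) : ∑ m, bary p m x = 1 := by
  simp only [bary_apply, ← Finset.sum_div]
  rw [div_eq_one_iff_eq hp]
  simp [Fin.sum_univ_three, area, det2]; ring

lemma sum_bary_smul (x : E2) : ∑ m, bary p m x • p m = x := by
  have : (area p) • ∑ m, bary p m x • p m = (area p) • x := by
    rw [Finset.smul_sum]
    simp only [bary_apply, smul_smul, mul_div_cancel₀ _ hp]
    apply E2_ext <;> simp [Fin.sum_univ_three, area, det2] <;> ring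
  exact smul_right_injective _ hp this

end bary

lemma affineMap_comb {F : Type*} [AddCommGroup F] [Module ℝ F] (A : E2 →ᵃ[ℝ] F) (p : Fin 3 → E2)
    (w : Fin 3 → ℝ) (hw : ∑ i, w i = 1) : A (∑ i, w i • p i) = ∑ i, w i • A (p i) := by
  rw [AffineMap.decomp A]
  simp only [Pi.add_apply, map_sum, map_smul, smul_add, Finset.sum_add_distrib, ← Finset.sum_smul,
    hw, one_smul]

lemma affineMap_eq_bary {F : Type*} [AddCommGroup F] [Module ℝ F] (A : E2 →ᵃ[ℝ] F)
    {p : Fin 3 → E2} (hp : area p ≠ 0) (x : E2) : A x = ∑ i, bary p i x • A (p i) := by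
  conv_lhs => rw [← sum_bary_smul hp x]
  exact affineMap_comb A p _ (sum_bary hp x)

lemma bary_comb {p : Fin 3 → E2} (hp : area p ≠ 0) (w : Fin 3 → ℝ) (hw : ∑ i, w i = 1)
    (m : Fin 3) : bary p m (∑ i, w i • p i) = w m := by
  rw [affineMap_comb _ _ _ hw]
  simp [bary_vertex hp]

lemma bary_continuous (p : Fin 3 → E2) (m : Fin 3) : Continuous (bary p m) :=
  AffineMap.continuous_of_finiteDimensional _

/-- The closed triangle as a set of convex combinations. -/
lemma mem_hull_iff {p : Fin 3 → E2} (hp : area p ≠ 0) {x : E2} :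
    x ∈ convexHull ℝ (range p) ↔ ∀ m, 0 ≤ bary p m x := by
  constructor
  · intro hx m
    have hc : Convex ℝ ((bary p m) ⁻¹' Ici 0) := (convex_Ici 0).affine_preimage _
    refine convexHull_min ?_ hc hx
    rintro _ ⟨i, rfl⟩
    simp only [mem_preimage, mem_Ici, bary_vertex hp]
    split_ifs <;> norm_num
  · intro h
    rw [← sum_bary_smul hp x]
    exact (convex_convexHull ℝ _).sum_mem (fun i _ => h i) (sum_bary hp x)
      (fun i _ => subset_convexHull ℝ _ ⟨i, rfl⟩)

lemma mem_hull_of_comb {p : Fin 3 → E2} {w : Fin 3 → ℝ} (hw : ∑ i, w i = 1) (h0 : ∀ i, 0 ≤ w i) :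
    ∑ i, w i • p i ∈ convexHull ℝ (range p) :=
  (convex_convexHull ℝ _).sum_mem (fun i _ => h0 i) hw (fun i _ => subset_convexHull ℝ _ ⟨i, rfl⟩)

lemma mem_interior_hull_iff {p : Fin 3 → E2} (hp : area p ≠ 0) {x : E2} :
    x ∈ interior (convexHull ℝ (range p)) ↔ ∀ m, 0 < bary p m x := by
  constructor
  · intro hx m
    refine lt_of_le_of_ne ((mem_hull_iff hp).1 (interior_subset hx) m) fun h0 => ?_
    -- If coordinate `m` were zero at the interior point `x`, a small step away from the vertex `p
    -- m` would stay in the triangle and make that coordinate negative.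
    have hc : Filter.Tendsto (fun r : ℝ => x + r • (x - p m)) (nhdsWithin 0 (Ioi 0)) (nhds x) := by
      have : Continuous fun r : ℝ => x + r • (x - p m) := by fun_prop
      have h2 := this.tendsto 0
      simp only [zero_smul, add_zero] at h2
      exact h2.mono_left nhdsWithin_le_nhds
    have h1 := (hc.eventually (isOpen_interior.mem_nhds hx)).and self_mem_nhdsWithin
    obtain ⟨r, hr, hr0⟩ := h1.exists
    have h2 := (mem_hull_iff hp).1 (interior_subset hr) m
    have h3 : bary p m (x + r • (x - p m)) = bary p m x + r * (bary p m x - bary p m (p m)) := by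
      have := (bary p m).map_vadd x (r • (x - p m))
      simp only [vadd_eq_add, map_smul, smul_eq_mul] at this
      rw [add_comm x, this, ← vsub_eq_sub x (p m), AffineMap.linearMap_vsub, vsub_eq_sub]; ring
    rw [h3, ← h0, bary_self hp] at h2
    have : (0:ℝ) < r := hr0
    linarith
  · intro h
    have ho : IsOpen {y | ∀ m, 0 < bary p m y} := by
      simp only [ofPred_forall]
      exact isOpen_iInter_of_finite fun m => isOpen_lt continuous_const (bary_continuous p m)
    exact interior_maximal (fun y hy => (mem_hull_iff hp).2 fun m => (hy m).le) ho h

lemma area_ne_zero_of_affineIndependent {p : Fin 3 → E2} (h : AffineIndependent ℝ p) :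
    area p ≠ 0 := by
  intro h0
  rw [affineIndependent_iff_linearIndependent_vsub ℝ p 0] at h
  have h' : LinearIndependent ℝ ![p 1 - p 0, p 2 - p 0] := by
    have := h.comp (fun i : Fin 2 => (⟨i.succ, Fin.succ_ne_zero i⟩ : {x : Fin 3 // x ≠ 0}))
      (fun i j hij => by simpa using hij)
    convert! this using 1
    ext i : 1
    fin_cases i <;> rfl
  rw [LinearIndependent.pair_iff] at h'
  simp only [area, det2] at h0
  set u := p 1 - p 0
  set v := p 2 - p 0
  -- When the determinant vanishes these are two linear relations between `u` and `v`; their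
  -- coefficients include both coordinates of `u`, so `u = 0`.
  have a1 := h' (v 0) (-(u 0)) (by apply E2_ext <;> simp <;> linarith)
  have a2 := h' (v 1) (-(u 1)) (by apply E2_ext <;> simp <;> linarith)
  have hu : u = 0 := E2_ext (by simpa using a1.2) (by simpa using a2.2)
  have := h' 1 0 (by simp [hu])
  norm_num at this

lemma eq_of_bary_eq {p : Fin 3 → E2} (hp : area p ≠ 0) {x y : E2}
    (h : ∀ m, bary p m x = bary p m y) : x = y := by
  rw [← sum_bary_smul hp x, ← sum_bary_smul hp y]
  simp [h]

/-- The closed triangle has the closure of its interior. -/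
lemma interior_hull_nonempty {p : Fin 3 → E2} (hp : area p ≠ 0) :
    (interior (convexHull ℝ (range p))).Nonempty := by
  refine ⟨∑ i, (1/3 : ℝ) • p i, (mem_interior_hull_iff hp).2 fun m => ?_⟩
  rw [bary_comb hp (fun _ => 1/3) (by norm_num [Fin.sum_univ_three])]
  norm_num

lemma hull_subset_closure_interior {p : Fin 3 → E2} (hp : area p ≠ 0) :
    convexHull ℝ (range p) ⊆ closure (interior (convexHull ℝ (range p))) := by
  have h : Convex ℝ (convexHull ℝ (range p)) := convex_convexHull ℝ _
  have h2 := h.closure_interior_eq_closure_of_nonempty_interior (interior_hull_nonempty hp)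
  exact subset_closure.trans h2.ge

lemma isCompact_hull (p : Fin 3 → E2) : IsCompact (convexHull ℝ (range p)) :=
  (finite_range p).isCompact_convexHull ℝ

lemma isClosed_hull (p : Fin 3 → E2) : IsClosed (convexHull ℝ (range p)) :=
  (isCompact_hull p).isClosed

/-! ### The incenter -/

section incenter
variable (t : Affine.Triangle ℝ E2)

lemma area_triangle : area t.points ≠ 0 := area_ne_zero_of_affineIndependent t.independent

lemma triangle_injective : Function.Injective t.points := t.independent.injective

lemma bary_incenter_pos (m : Fin 3) : 0 < bary t.points m t.incenter := by
  rw [Affine.Simplex.incenter_eq_affineCombination,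
    Finset.affineCombination_eq_linear_combination _ _ _
      (t.sum_excenterWeights_eq_one_iff.2 t.excenterExists_empty),
    bary_comb (area_triangle t) _ (t.sum_excenterWeights_eq_one_iff.2 t.excenterExists_empty)]
  exact t.excenterWeights_empty_pos m

/-- The foot of the incenter on the side is the touchpoint of the incircle, and that point is
strictly between the two vertices. This is what distinguishes the incenter from an arbitrary
interior point in the construction of the split. -/
lemma inner_incenter_pos {i j : Fin 3} (h : i ≠ j) :
    0 < inner ℝ (t.incenter - t.points i) (t.points j - t.points i) := by
  obtain ⟨m, hmi, hmj⟩ : ∃ m : Fin 3, m ≠ i ∧ m ≠ j := by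
    revert i j; decide
  have hu : (Finset.univ : Finset (Fin 3)) = {m, i, j} := by
    revert i j m; decide
  set q := t.touchpoint ∅ m with hq
  have hspan : ∀ l, l ≠ m → t.points l ∈ affineSpan ℝ (range (t.faceOpposite m).points) := by
    intro l hl
    refine subset_affineSpan ℝ _ ?_
    rw [Affine.Simplex.range_faceOpposite_points]
    exact ⟨l, hl, rfl⟩
  have horth : inner ℝ (t.incenter - q) (t.points j - t.points i) = 0 := by
    have h1 : t.incenter -ᵥ q ∈
        (affineSpan ℝ (range (t.faceOpposite m).points)).directionᗮ :=
      EuclideanGeometry.vsub_orthogonalProjection_mem_direction_orthogonal _ _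
    have h2 : t.points j -ᵥ t.points i ∈
        (affineSpan ℝ (range (t.faceOpposite m).points)).direction :=
      AffineSubspace.vsub_mem_direction (hspan j hmj.symm) (hspan i hmi.symm)
    rw [real_inner_comm]
    exact h1 _ h2
  -- The touchpoint has weight zero at the opposite vertex `m`, so it is a combination of the two
  -- ends of the side.
  have hqe : q - t.points i = (t.touchpointWeights ∅ m j) • (t.points j - t.points i) := by
    have h1 : Finset.univ.affineCombination ℝ t.points (t.touchpointWeights ∅ m) = q :=
      t.affineCombination_touchpointWeights _ _
    have h2 := t.sum_touchpointWeights ∅ m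
    rw [Finset.affineCombination_eq_linear_combination _ _ _ h2] at h1
    have h3 : t.touchpointWeights ∅ m m = 0 := Affine.Simplex.touchpointWeights_eq_zero m
    rw [hu, Finset.sum_insert (by simp [hmi, hmj]), Finset.sum_insert (by simp [h]),
      Finset.sum_singleton, h3] at h1 h2
    have h4 : t.touchpointWeights ∅ m i = 1 - t.touchpointWeights ∅ m j := by linarith
    rw [← h1, h4]
    module
  have hw : 0 < t.touchpointWeights ∅ m j := t.touchpointWeights_empty_pos hmj
  have : t.incenter - t.points i = (t.incenter - q) + (q - t.points i) := by abel
  rw [this, inner_add_left, horth, hqe, inner_smul_left, zero_add, real_inner_self_eq_norm_sq]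
  have hne : t.points j - t.points i ≠ 0 := sub_ne_zero.2 ((triangle_injective t).ne h.symm)
  have := norm_pos_iff.2 hne
  simp only [conj_trivial]
  positivity

end incenter

/-! ### Coverings, connectedness and linear duality -/

open Filter Topology in
/-- On a simply connected space every locally constant Čech cocycle is a coboundary. -/
theorem exists_sections_of_cocycle {X A I : Type*} [TopologicalSpace X] [SimplyConnectedSpace X]
    [LocallyPathConnectedSpace X] [AddCommGroup A] (U : I → Set X) (hU : ∀ i, IsOpen (U i))
    (at' : X → I) (hat : ∀ x, x ∈ U (at' x)) (c : I → I → X → A)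
    (hloc : ∀ i j x, x ∈ U i → x ∈ U j → ∀ᶠ y in 𝓝 x, c i j y = c i j x)
    (hcoc : ∀ i j k x, x ∈ U i → x ∈ U j → x ∈ U k → c i j x + c j k x = c i k x) :
    ∃ s : I → X → A, (∀ i x, x ∈ U i → ∀ᶠ y in 𝓝 x, s i y = s i x) ∧
      ∀ i j x, x ∈ U i → x ∈ U j → s j x = s i x + c i j x := by
  let _ : TopologicalSpace A := ⊥
  have _ : DiscreteTopology A := ⟨rfl⟩
  -- The bundle with discrete fibre `A` whose transition maps are translations by the cocycle. The
  -- local constancy of `c` makes them continuous, and discreteness of the fibre makes the bundle a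
  -- covering.
  let Z : FiberBundleCore I X A :=
    { baseSet := U
      isOpen_baseSet := hU
      indexAt := at'
      mem_baseSet_at := hat
      coordChange := fun i j x v => v + c i j x
      coordChange_self := fun i x hx v => by
        have := hcoc i i i x hx hx hx
        simpa using this
      continuousOn_coordChange := by
        rintro i j ⟨x, v⟩ ⟨⟨hi, hj⟩, -⟩
        refine ContinuousAt.continuousWithinAt ?_
        have h1 : ContinuousAt (fun p : X × A => p.2 + c i j x) (x, v) :=
          ((continuous_of_discreteTopology (f := fun a : A => a + c i j x)).comp
            continuous_snd).continuousAt
        refine h1.congr ?_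
        filter_upwards [continuous_fst.continuousAt.eventually (hloc i j x hi hj)] with p hp
        rw [hp]
      coordChange_comp := fun i j k x hx v => by
        rw [add_assoc, hcoc i j k x hx.1.1 hx.1.2 hx.2] }
  obtain ⟨x₀⟩ : Nonempty X := inferInstance
  have cov : IsCoveringMap (Bundle.TotalSpace.proj : Bundle.TotalSpace A Z.Fiber → X) :=
    FiberBundle.isCoveringMap
  -- A simply connected, locally path connected base lets the identity lift to a global section; its
  -- expressions in the local trivialisations are the functions `s i`.
  obtain ⟨F, ⟨-, hF⟩, -⟩ := cov.existsUnique_continuousMap_lifts (ContinuousMap.id X) x₀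
    (⟨x₀, (0 : A)⟩ : Bundle.TotalSpace A Z.Fiber) rfl
  have hF' : ∀ x, (F x).1 = x := fun x => congrFun hF x
  let s : I → X → A := fun i x => ((Z.localTriv i) (F x)).2
  have hs : ∀ i x, s i x = (show A from (F x).2) + c (at' (F x).1) i (F x).1 := fun i x => rfl
  refine ⟨s, fun i x hx => ?_, fun i j x hi hj => ?_⟩
  · have hc : ContinuousAt (fun y => (Z.localTriv i) (F y)) x := by
      have h1 : F x ∈ (Z.localTriv i).source := by
        rw [Z.mem_localTriv_source]
        change (F x).1 ∈ U i
        rwa [hF' x]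
      exact ((Z.localTriv i).continuousAt h1).comp F.continuous.continuousAt
    have h2 : ContinuousAt (s i) x := continuous_snd.continuousAt.comp hc
    exact h2.eventually (IsOpen.mem_nhds (isOpen_discrete {s i x}) rfl)
  · have h := hcoc (at' (F x).1) i j (F x).1 (hat _) (by rwa [hF' x]) (by rwa [hF' x])
    rw [hs, hs, ← h, add_assoc]
    congr 3
    exact hF' x

/-- A function on the index set of a finite closed cover of a preconnected set is constant if it takes
equal values at the indices of members of the cover that meet inside the set. -/
theorem eq_of_preconnected_cover {X I A : Type*} [TopologicalSpace X] [Finite I] {S : Set X}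
    (hS : IsPreconnected S) (K : Set I) (C : I → Set X) (hC : ∀ k, IsClosed (C k))
    (hcov : S ⊆ ⋃ k ∈ K, C k) (hne : ∀ k ∈ K, (S ∩ C k).Nonempty) (h : I → A)
    (heq : ∀ x ∈ S, ∀ k ∈ K, ∀ l ∈ K, x ∈ C k → x ∈ C l → h k = h l) :
    ∀ k ∈ K, ∀ l ∈ K, h k = h l := by
  intro k hk l hl
  by_contra hkl
  rw [isPreconnected_closed_iff] at hS
  -- Group the closed sets by whether `h` takes the value `h k`. Both unions are closed and meet
  -- `S`, so they meet each other in `S`.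
  obtain ⟨x, hxS, hx1, hx2⟩ := hS (⋃ i ∈ {i | i ∈ K ∧ h i = h k}, C i)
    (⋃ i ∈ {i | i ∈ K ∧ h i ≠ h k}, C i)
    ((toFinite _).isClosed_biUnion fun i _ => hC i)
    ((toFinite _).isClosed_biUnion fun i _ => hC i)
    (by
      intro x hx
      obtain ⟨i, hi, hxi⟩ := mem_iUnion₂.1 (hcov hx)
      by_cases hik : h i = h k
      · exact Or.inl (mem_iUnion₂.2 ⟨i, ⟨hi, hik⟩, hxi⟩)
      · exact Or.inr (mem_iUnion₂.2 ⟨i, ⟨hi, hik⟩, hxi⟩))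
    (by
      obtain ⟨x, hx, hxk⟩ := hne k hk
      exact ⟨x, hx, mem_iUnion₂.2 ⟨k, ⟨hk, rfl⟩, hxk⟩⟩)
    (by
      obtain ⟨x, hx, hxk⟩ := hne l hl
      exact ⟨x, hx, mem_iUnion₂.2 ⟨l, ⟨hl, fun h => hkl h.symm⟩, hxk⟩⟩)
  obtain ⟨i, ⟨hi, hik⟩, hxi⟩ := mem_iUnion₂.1 hx1
  obtain ⟨j, ⟨hj, hjk⟩, hxj⟩ := mem_iUnion₂.1 hx2
  exact hjk ((heq x hxS j hj i hi hxj hxi).trans hik)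

/-- The punctured plane is connected and `univBall` carries it onto the punctured ball. The centre
has to be removed because triangles that meet only in a vertex do not count as neighbours. -/
lemma isPreconnected_ball_diff_center (w : E2) {r : ℝ} (hr : 0 < r) :
    IsPreconnected (Metric.ball w r \ {w}) := by
  have h1 : IsPreconnected ({0}ᶜ : Set E2) := by
    refine (isConnected_compl_singleton_of_one_lt_rank ?_ 0).isPreconnected
    rw [rank_eq_card_basis (EuclideanSpace.basisFun (Fin 2) ℝ).toBasis]
    simp
  have h2 := h1.image (OpenPartialHomeomorph.univBall w r)
    (OpenPartialHomeomorph.continuous_univBall w r).continuousOn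
  convert! h2 using 1
  have hinj := (OpenPartialHomeomorph.univBall w r).injOn
  have hsrc := OpenPartialHomeomorph.univBall_source w r
  rw [hsrc] at hinj
  rw [compl_eq_univ_sdiff, image_sdiff (fun x y h => hinj (mem_univ _) (mem_univ _) h),
    image_singleton, OpenPartialHomeomorph.univBall_apply_zero]
  congr 1
  have := (OpenPartialHomeomorph.univBall w r).image_source_eq_target
  rw [hsrc, OpenPartialHomeomorph.univBall_target w hr] at this
  exact this.symm

/-- A vector lies in the range of a linear map as soon as every vector orthogonal to the range is
orthogonal to it. -/
lemma exists_eq_of_orthogonal {V I : Type*} [AddCommGroup V] [Module ℝ V] [Fintype I]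
    (B : V →ₗ[ℝ] I → ℝ) (m : I → ℝ)
    (h : ∀ φ : I → ℝ, (∀ v, ∑ i, φ i * B v i = 0) → ∑ i, φ i * m i = 0) : ∃ v, B v = m := by
  classical
  by_contra hm
  have hm' : m ∉ LinearMap.range B := fun ⟨v, hv⟩ => hm ⟨v, hv⟩
  obtain ⟨f, hf, hle⟩ := Submodule.exists_le_ker_of_notMem hm'
  have hrep : ∀ x : I → ℝ, f x = ∑ i, f (Pi.single i 1) * x i := by
    intro x
    conv_lhs => rw [← Finset.univ_sum_single x]
    rw [map_sum]
    refine Finset.sum_congr rfl fun i _ => ?_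
    rw [mul_comm, ← smul_eq_mul, ← map_smul, ← Pi.single_smul]
    simp
  apply hf
  rw [hrep]
  refine h _ fun v => ?_
  rw [← hrep]
  exact hle ⟨v, rfl⟩

/-! ### Flows on the half-edges of a mesh -/

section flow

-- Exchange of summation: terms with source outside `W` are killed by `ψ`. With `W` the vertices or
-- the faces it turns conditions on net sums into one pairing over half-edges.
open Classical in
lemma sum_fiber_mul {H V : Type*} [Fintype H] (src : H → V) (W : Finset V) (ψ : V → ℝ)
    (hψ : ∀ z ∉ W, ψ z = 0) (Y : H → ℝ) :
    ∑ z ∈ W, ψ z * ∑ η with src η = z, Y η = ∑ η, ψ (src η) * Y η := by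
  simp only [Finset.sum_filter, Finset.mul_sum]
  rw [Finset.sum_comm]
  refine Finset.sum_congr rfl fun η _ => ?_
  by_cases h : src η ∈ W
  · rw [Finset.sum_eq_single_of_mem _ h]
    · simp
    · intro z _ hz
      simp [hz.symm]
  · rw [hψ _ h, zero_mul]
    refine Finset.sum_eq_zero fun z hz => ?_
    have : src η ≠ z := fun e => h (e ▸ hz)
    simp [this]

variable {H : Type*} [Fintype H] {twin : H → H} (htw : ∀ η, twin (twin η) = η)
include htw

lemma sum_twin (g : H → ℝ) : ∑ η, g (twin η) = ∑ η, g η :=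
  Equiv.sum_comp (Function.Involutive.toPerm twin htw) g

/-- Summation by parts: reindexing by `twin` shows that the two halves of the jump contribute
equally, because `y` changes sign. -/
lemma sum_sub_twin_mul (a y : H → ℝ) (hy : ∀ η, y (twin η) = - y η) :
    ∑ η, (a η - a (twin η)) * y η = 2 * ∑ η, a η * y η := by
  have h := sum_twin htw (fun η => a η * y η)
  simp only [hy] at h
  simp only [sub_mul, Finset.sum_sub_distrib]
  simp only [mul_neg, Finset.sum_neg_distrib] at h
  linarith

-- Test with `u = a`: by antisymmetry, twice the resulting sum is the sum of the squared jumps of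
-- `a` over `P`.
open Classical in
lemma eq_twin_of_sum_eq_zero {P : H → Prop} (hP : ∀ η, P (twin η) ↔ P η) (a : H → ℝ)
    (h : ∀ u : H → ℝ, ∑ η, a η * (if P η then u η - u (twin η) else 0) = 0) :
    ∀ η, P η → a η = a (twin η) := by
  have h1 := sum_sub_twin_mul htw a (fun η => if P η then a η - a (twin η) else 0) (by
    intro η
    simp only [hP, htw]
    split_ifs <;> ring)
  rw [h a, mul_zero] at h1
  intro η hη
  have h2 := (Finset.sum_eq_zero_iff_of_nonneg (fun η _ => by
    split_ifs
    · nlinarith [sq_nonneg (a η - a (twin η))]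
    · simp)).1 h1 η (Finset.mem_univ _)
  rw [if_pos hη] at h2
  have := mul_self_eq_zero.1 h2
  linarith

variable {ι V : Type*} [Fintype ι] {face : H → ι} {src : H → V} {W : Finset V} {z₀ : V}
  (hz₀ : z₀ ∉ W) {t : H → Prop} (ht : ∀ η, t (twin η) ↔ t η)

include hz₀ ht in
open Classical in
/-- A spanning tree carries a flow with prescribed sources at all the vertices but the root. -/
lemma exists_tree_flow
    (hT : ∀ ψ : V → ℝ, ψ z₀ = 0 → (∀ η, t η → ψ (src η) = ψ (src (twin η))) → ∀ z ∈ W, ψ z = 0)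
    (r : V → ℝ) : ∃ y : H → ℝ, (∀ η, y (twin η) = - y η) ∧ (∀ η, ¬ t η → y η = 0) ∧
      ∀ z ∈ W, ∑ η with src η = z, y η = r z := by
  -- Antisymmetrise `u`, cut it off to the tree and take the net outflow at the vertices of `W`. It
  -- suffices that `B` is onto.
  let B : (H → ℝ) →ₗ[ℝ] (W → ℝ) :=
    { toFun := fun u z => ∑ η with src η = z, if t η then u η - u (twin η) else 0
      map_add' := fun u v => by
        ext z
        simp only [Pi.add_apply, ← Finset.sum_add_distrib]
        refine Finset.sum_congr rfl fun η _ => ?_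
        split_ifs <;> ring
      map_smul' := fun c u => by
        ext z
        simp only [Pi.smul_apply, smul_eq_mul, Finset.mul_sum, RingHom.id_apply]
        refine Finset.sum_congr rfl fun η _ => ?_
        split_ifs <;> ring }
  obtain ⟨u, hu⟩ := exists_eq_of_orthogonal B (fun z => r z) (by
    intro φ hφ
    -- A vector orthogonal to the range, extended by zero, is a potential that is constant along
    -- tree edges and zero at the root, hence zero.
    let ψ : V → ℝ := fun z => if h : z ∈ W then φ ⟨z, h⟩ else 0
    have hψW : ∀ z ∉ W, ψ z = 0 := fun z hz => by simp [ψ, hz]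
    have hψ : ∀ z : W, φ z = ψ z := fun z => by simp [ψ]
    have h1 := eq_twin_of_sum_eq_zero htw ht (fun η => ψ (src η)) (by
      intro u
      rw [← sum_fiber_mul src W ψ hψW, ← Finset.sum_coe_sort]
      refine Eq.trans ?_ (hφ u)
      refine Finset.sum_congr rfl fun z _ => ?_
      rw [hψ]; rfl)
    have h2 := hT ψ (hψW _ hz₀) h1
    refine Finset.sum_eq_zero fun z _ => ?_
    rw [hψ, h2 z z.2, zero_mul])
  refine ⟨fun η => if t η then u η - u (twin η) else 0, fun η => ?_, fun η hη => by simp [hη],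
    fun z hz => congrFun hu ⟨z, hz⟩⟩
  simp only [ht, htw]
  split_ifs <;> ring

open Classical in
/-- A flow on a spanning tree without sources outside the root vanishes. -/
lemma tree_flow_eq_zero
    (hT : ∀ y : H → ℝ, (∀ η, y (twin η) = - y η) →
      ∃ ψ : V → ℝ, (∀ z ∉ W, ψ z = 0) ∧ ∀ η, t η → y η = ψ (src η) - ψ (src (twin η)))
    (y : H → ℝ) (hy : ∀ η, y (twin η) = - y η) (hyt : ∀ η, ¬ t η → y η = 0)
    (h0 : ∀ z ∈ W, ∑ η with src η = z, y η = 0) (η : H) : y η = 0 := by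
  obtain ⟨ψ, hψW, hψ⟩ := hT y hy
  -- On the tree `y` is the gradient of `ψ`, so `∑ y ^ 2` is the pairing of `ψ` with the sources of
  -- `y`, which vanish on `W`.
  have h1 := sum_sub_twin_mul htw (fun η => ψ (src η)) y hy
  have h0' : ∑ z ∈ W, ψ z * ∑ η with src η = z, y η = 0 :=
    Finset.sum_eq_zero fun z hz => by rw [h0 z hz, mul_zero]
  rw [← sum_fiber_mul src W ψ hψW, h0', mul_zero] at h1
  have h2 : ∑ η, y η * y η = 0 := by
    rw [← h1]
    refine Finset.sum_congr rfl fun η _ => ?_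
    by_cases h : t η
    · rw [hψ η h]
    · rw [hyt η h]; simp
  have h3 := (Finset.sum_eq_zero_iff_of_nonneg (fun η _ => mul_self_nonneg (y η))).1 h2 η
    (Finset.mem_univ _)
  exact mul_self_eq_zero.1 h3

include hz₀ ht in
open Classical in
/-- A flow that avoids the tree and has no net flux through any face vanishes. -/
lemma cotree_flow_eq_zero
    (htop : ∀ y : H → ℝ, (∀ η, y (twin η) = - y η) →
      (∀ z ∈ W, ∑ η with src η = z, y η = 0) →
        ∃ h : ι → ℝ, ∀ η, y η = h (face η) - h (face (twin η)))
    (hT : ∀ ψ : V → ℝ, ψ z₀ = 0 → (∀ η, t η → ψ (src η) = ψ (src (twin η))) → ∀ z ∈ W, ψ z = 0)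
    (f : H → ℝ) (hf : ∀ η, f (twin η) = - f η) (hft : ∀ η, t η → f η = 0)
    (h0 : ∀ k, ∑ η with face η = k, f η = 0) (η : H) : f η = 0 := by
  -- The tree flow whose sources cancel those of `f`, so that `f + y` is the jump of some `h`.
  obtain ⟨y, hy, hyt, hyz⟩ := exists_tree_flow htw hz₀ ht hT
    (fun z => - ∑ η with src η = z, f η)
  obtain ⟨h, hh⟩ := htop (fun η => f η + y η) (fun η => by rw [hf, hy]; ring) (fun z hz => by
    rw [Finset.sum_add_distrib, hyz z hz]; ring)
  have h1 := sum_sub_twin_mul htw (fun η => h (face η)) f hf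
  have h0' : ∑ k, h k * ∑ η with face η = k, f η = 0 :=
    Finset.sum_eq_zero fun z hz => by rw [h0 z, mul_zero]
  rw [← sum_fiber_mul face Finset.univ h (by simp), h0', mul_zero] at h1
  -- Off the tree `y = 0`, so `f` is the jump of `h`; on the tree `f = 0`. In both cases `f ^ 2` is
  -- `f` times the jump, and `f` is orthogonal to jumps since it has no net flux.
  have h2 : ∑ η, f η * f η = 0 := by
    rw [← h1]
    refine Finset.sum_congr rfl fun η _ => ?_
    by_cases h : t η
    · rw [hft η h]; simp
    · rw [← hh, hyt η h, add_zero]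
  have h3 := (Finset.sum_eq_zero_iff_of_nonneg (fun η _ => mul_self_nonneg (f η))).1 h2 η
    (Finset.mem_univ _)
  exact mul_self_eq_zero.1 h3

include ht in
open Classical in
/-- Outside the tree there is a flow with prescribed net fluxes through the faces, if their sum
vanishes. -/
lemma exists_cotree_flow
    (hcob : ∀ h : ι → ℝ, ∀ z ∈ W, ∑ η with src η = z, (h (face η) - h (face (twin η))) = 0)
    (hconn : ∀ h : ι → ℝ, (∀ η, h (face η) = h (face (twin η))) → ∀ k l, h k = h l)
    (hT : ∀ y : H → ℝ, (∀ η, y (twin η) = - y η) →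
      ∃ ψ : V → ℝ, (∀ z ∉ W, ψ z = 0) ∧ ∀ η, t η → y η = ψ (src η) - ψ (src (twin η)))
    (m : ι → ℝ) (hm : ∑ k, m k = 0) :
    ∃ f : H → ℝ, (∀ η, f (twin η) = - f η) ∧ (∀ η, t η → f η = 0) ∧
      ∀ k, ∑ η with face η = k, f η = m k := by
  let B : (H → ℝ) →ₗ[ℝ] (ι → ℝ) :=
    { toFun := fun u k => ∑ η with face η = k, if ¬ t η then u η - u (twin η) else 0
      map_add' := fun u v => by
        ext z
        simp only [Pi.add_apply, ← Finset.sum_add_distrib]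
        refine Finset.sum_congr rfl fun η _ => ?_
        split_ifs <;> ring
      map_smul' := fun c u => by
        ext z
        simp only [Pi.smul_apply, smul_eq_mul, Finset.mul_sum, RingHom.id_apply]
        refine Finset.sum_congr rfl fun η _ => ?_
        split_ifs <;> ring }
  obtain ⟨u, hu⟩ := exists_eq_of_orthogonal B m (by
    intro φ hφ
    -- A `φ` orthogonal to the range does not jump across edges off the tree. Its jumps are
    -- therefore a tree flow, source-free on `W` by `hcob`; so they vanish, `φ` is constant, and it
    -- is orthogonal to `m` because `m` sums to zero.
    have h1 := eq_twin_of_sum_eq_zero htw (P := fun η => ¬ t η) (fun η => not_congr (ht η))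
      (fun η => φ (face η)) (by
        intro u
        rw [← sum_fiber_mul face Finset.univ φ (by simp)]
        have := hφ u
        simp only [B, LinearMap.coe_mk, AddHom.coe_mk] at this
        convert! this)
    have h2 := tree_flow_eq_zero htw hT (fun η => φ (face η) - φ (face (twin η)))
      (fun η => by rw [htw]; ring) (fun η hη => sub_eq_zero.2 (h1 η hη)) (hcob φ)
    have h3 := hconn φ fun η => sub_eq_zero.1 (h2 η)
    rcases isEmpty_or_nonempty ι with hι | ⟨⟨k⟩⟩
    · simp
    · rw [Finset.sum_congr rfl fun l _ => by rw [h3 l k], ← Finset.mul_sum, hm, mul_zero])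
  refine ⟨fun η => if ¬ t η then u η - u (twin η) else 0, fun η => ?_, fun η hη => by simp [hη],
    fun z => congrFun hu z⟩
  simp only [ht, htw]
  split_ifs <;> ring

end flow

/-! ### Edges of a conforming triangulation -/

section Mesh

variable {Ω : Set E2} {ι : Type*} {T : ι → Affine.Triangle ℝ E2}

/-- The edge of the `k`-th triangle opposite to its vertex `m`. -/
def edge (T : ι → Affine.Triangle ℝ E2) (k : ι) (m : Fin 3) : Sym2 E2 :=
  s((T k).points (m + 1), (T k).points (m + 2))

/-- The barycentric coordinates of the `k`-th triangle. -/
abbrev bc (T : ι → Affine.Triangle ℝ E2) (k : ι) (m : Fin 3) : E2 →ᵃ[ℝ] ℝ := bary (T k).points m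

/-- The relative interior of an edge. -/
def openEdge (e : Sym2 E2) : Set E2 := edgeHull e \ {x | x ∈ e}

lemma mem_hull {k : ι} {x : E2} : x ∈ hull (T k) ↔ ∀ m, 0 ≤ bc T k m x :=
  mem_hull_iff (area_triangle _)

lemma mem_interior_hull {k : ι} {x : E2} : x ∈ interior (hull (T k)) ↔ ∀ m, 0 < bc T k m x :=
  mem_interior_hull_iff (area_triangle _)

lemma points_mem_hull (k : ι) (m : Fin 3) : (T k).points m ∈ hull (T k) :=
  subset_convexHull ℝ _ ⟨m, rfl⟩

lemma points_ne (k : ι) {i j : Fin 3} (h : i ≠ j) : (T k).points i ≠ (T k).points j :=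
  (triangle_injective _).ne h

lemma fin3_add_ne (m : Fin 3) : m + 1 ≠ m ∧ m + 2 ≠ m ∧ m + 1 ≠ m + 2 := by
  revert m; decide

lemma fin3_sum (m : Fin 3) (w : Fin 3 → ℝ) : ∑ i, w i = w m + w (m + 1) + w (m + 2) := by
  fin_cases m <;> simp [Fin.sum_univ_three] <;> ring

lemma fin3_sum' {F : Type*} [AddCommGroup F] (m : Fin 3) (w : Fin 3 → F) :
    ∑ i, w i = w m + w (m + 1) + w (m + 2) := by
  fin_cases m <;> simp [Fin.sum_univ_three] <;> abel

lemma fin3_cases (m i : Fin 3) : i = m ∨ i = m + 1 ∨ i = m + 2 := by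
  revert m i; decide

lemma fin3_forall (m : Fin 3) {P : Fin 3 → Prop} : (∀ i, P i) ↔ P m ∧ P (m + 1) ∧ P (m + 2) := by
  constructor
  · intro h; exact ⟨h _, h _, h _⟩
  · rintro ⟨h0, h1, h2⟩ i
    rcases fin3_cases m i with rfl | rfl | rfl <;> assumption

lemma edgeHull_mk (a b : E2) : edgeHull s(a, b) = segment ℝ a b := by
  have : {x | x ∈ s(a, b)} = ({a, b} : Set E2) := by ext; simp
  rw [edgeHull, this, convexHull_pair]

lemma mem_edgeHull_edge {k : ι} {m : Fin 3} {x : E2} :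
    x ∈ edgeHull (edge T k m) ↔ x ∈ hull (T k) ∧ bc T k m x = 0 := by
  have hp := area_triangle (T k)
  obtain ⟨n1, n2, n3⟩ := fin3_add_ne m
  rw [edge, edgeHull_mk]
  constructor
  · rintro ⟨u, v, hu, hv, huv, rfl⟩
    refine ⟨(convex_convexHull ℝ _) (points_mem_hull k _) (points_mem_hull k _) hu hv huv, ?_⟩
    -- Indexing by `i - m` gives weight `0` to vertex `m`, `u` to `m + 1` and `v` to `m + 2`.
    have h : ∑ i, (![(0:ℝ), u, v] (i - m)) • (T k).points i =
        u • (T k).points (m + 1) + v • (T k).points (m + 2) := by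
      rw [fin3_sum' m]
      simp
    have h2 : ∑ i, ![(0:ℝ), u, v] (i - m) = 1 := by
      rw [fin3_sum m]; simpa using huv
    rw [← h, bary_comb hp _ h2]
    simp
  · rintro ⟨hx, h0⟩
    have h1 := sum_bary_smul hp x
    have h2 := sum_bary hp x
    rw [fin3_sum' m, h0] at h1
    rw [fin3_sum m, h0] at h2
    rw [mem_hull] at hx
    exact ⟨_, _, hx (m + 1), hx (m + 2), by linarith, by simpa using h1⟩

lemma mem_openEdge_edge {k : ι} {m : Fin 3} {x : E2} :
    x ∈ openEdge (edge T k m) ↔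
      bc T k m x = 0 ∧ 0 < bc T k (m + 1) x ∧ 0 < bc T k (m + 2) x := by
  have hp := area_triangle (T k)
  obtain ⟨n1, n2, n3⟩ := fin3_add_ne m
  have h2 := sum_bary hp x
  rw [fin3_sum m] at h2
  rw [openEdge, mem_sdiff, mem_edgeHull_edge, mem_hull, fin3_forall m]
  simp only [edge, mem_ofPred_eq, Sym2.mem_iff, not_or]
  constructor
  · rintro ⟨⟨⟨-, h1, h3⟩, h0⟩, ha, hb⟩
    refine ⟨h0, lt_of_le_of_ne h1 fun h => ?_, lt_of_le_of_ne h3 fun h => ?_⟩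
    · apply hb
      apply eq_of_bary_eq hp
      rw [fin3_forall m, bary_self hp, bary_ne n2, bary_ne n3.symm, h0, ← h]
      refine ⟨rfl, rfl, ?_⟩
      linarith
    · apply ha
      apply eq_of_bary_eq hp
      rw [fin3_forall m, bary_self hp, bary_ne n1, bary_ne n3, h0, ← h]
      refine ⟨rfl, ?_, rfl⟩
      linarith
  · rintro ⟨h0, h1, h3⟩
    refine ⟨⟨⟨h0.ge, h1.le, h3.le⟩, h0⟩, ?_, ?_⟩
    · rintro rfl
      rw [bary_ne n3] at h3
      exact lt_irrefl _ h3
    · rintro rfl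
      rw [bary_ne n3.symm] at h1
      exact lt_irrefl _ h1

lemma lineMap_mem_openEdge (k : ι) (m : Fin 3) {θ : ℝ} (h0 : 0 < θ) (h1 : θ < 1) :
    AffineMap.lineMap ((T k).points (m + 1)) ((T k).points (m + 2)) θ ∈ openEdge (edge T k m) := by
  have hp := area_triangle (T k)
  obtain ⟨n1, n2, n3⟩ := fin3_add_ne m
  rw [mem_openEdge_edge]
  rw [AffineMap.apply_lineMap, AffineMap.apply_lineMap, AffineMap.apply_lineMap, bary_self hp,
    bary_self hp, bary_ne n1, bary_ne n2, bary_ne n3, bary_ne n3.symm]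
  simp only [AffineMap.lineMap_apply]
  norm_num [h0, h1]

lemma exists_lineMap_of_mem_openEdge {k : ι} {m : Fin 3} {x : E2} (hx : x ∈ openEdge (edge T k m)) :
    ∃ θ : ℝ, 0 < θ ∧ θ < 1 ∧
      AffineMap.lineMap ((T k).points (m + 1)) ((T k).points (m + 2)) θ = x := by
  have hp := area_triangle (T k)
  obtain ⟨h0, h1, h2⟩ := mem_openEdge_edge.1 hx
  have s1 := sum_bary_smul hp x
  have s2 := sum_bary hp x
  rw [fin3_sum' m, h0] at s1
  rw [fin3_sum m, h0] at s2
  refine ⟨bc T k (m + 2) x, h2, by linarith, ?_⟩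
  rw [AffineMap.lineMap_apply_module, ← s2]
  simpa using s1

lemma edgeHull_subset_hull (k : ι) (m : Fin 3) : edgeHull (edge T k m) ⊆ hull (T k) :=
  fun _ hx => (mem_edgeHull_edge.1 hx).1

lemma edge_injective (k : ι) {m m' : Fin 3} (h : edge T k m = edge T k m') : m = m' := by
  have hi := triangle_injective (T k)
  simp only [edge, Sym2.eq_iff, hi.eq_iff] at h
  revert m m'; decide

lemma exists_edge_eq {k : ι} {a b : E2} (ha : a ∈ range (T k).points)
    (hb : b ∈ range (T k).points) (hab : a ≠ b) : ∃ m, edge T k m = s(a, b) := by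
  obtain ⟨i, rfl⟩ := ha
  obtain ⟨j, rfl⟩ := hb
  have hij : i ≠ j := fun h => hab (h ▸ rfl)
  have : ∃ m : Fin 3, (m + 1 = i ∧ m + 2 = j) ∨ (m + 1 = j ∧ m + 2 = i) := by
    clear hab; revert i j; decide
  obtain ⟨m, ⟨rfl, rfl⟩ | ⟨rfl, rfl⟩⟩ := this
  · exact ⟨m, rfl⟩
  · exact ⟨m, Sym2.eq_swap⟩

lemma edge_mem_edgeSet (k : ι) (m : Fin 3) : edge T k m ∈ (meshGraph T).edgeSet := by
  rw [edge, SimpleGraph.mem_edgeSet]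
  exact ⟨points_ne k (fin3_add_ne m).2.2, k, ⟨_, rfl⟩, ⟨_, rfl⟩⟩

lemma exists_edge_of_mem_edgeSet {e : Sym2 E2} (h : e ∈ (meshGraph T).edgeSet) :
    ∃ k m, edge T k m = e := by
  induction e with
  | h a b =>
    rw [SimpleGraph.mem_edgeSet] at h
    obtain ⟨hab, k, ha, hb⟩ := h
    exact ⟨k, exists_edge_eq ha hb hab⟩

lemma edge_intEdges_or_extEdges (k : ι) (m : Fin 3) :
    edge T k m ∈ intEdges Ω T ∨ edge T k m ∈ extEdges Ω T := by
  by_cases h : edgeHull (edge T k m) ⊆ frontier Ω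
  · exact Or.inr ⟨edge_mem_edgeSet k m, h⟩
  · exact Or.inl ⟨edge_mem_edgeSet k m, h⟩

variable (hT : IsConformingTriangulation Ω T)
include hT

/-- If a point of two triangles has a positive coordinate at a vertex of the first, that vertex
belongs to the second. -/
lemma points_mem_of_bary_ne_zero {k l : ι} {x : E2} (hk : x ∈ hull (T k)) (hl : x ∈ hull (T l))
    {m : Fin 3} (hm : bc T k m x ≠ 0) : (T k).points m ∈ range (T l).points := by
  by_cases hkl : k = l
  · rw [hkl]; exact ⟨m, rfl⟩
  by_contra hc
  apply hm
  have hx : x ∈ convexHull ℝ (range (T k).points ∩ range (T l).points) :=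
    hT.inter_eq k l hkl ▸ ⟨hk, hl⟩
  have hcv : Convex ℝ ((bc T k m) ⁻¹' {0}) := (convex_singleton 0).affine_preimage _
  refine convexHull_min ?_ hcv hx
  rintro _ ⟨⟨i, rfl⟩, hi⟩
  refine bary_ne fun h => hc (h ▸ hi)

/-- Both vertex sets have three elements, so an inclusion would be an equality. -/
lemma exists_points_notMem {k l : ι} (hkl : k ≠ l) : ∃ m, (T k).points m ∉ range (T l).points := by
  by_contra! h
  apply hT.range_ne k l hkl
  refine eq_of_subset_of_ncard_le (by rintro _ ⟨i, rfl⟩; exact h i) ?_ (finite_range _)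
  rw [← image_univ, ← image_univ, ncard_image_of_injective _ (triangle_injective _),
    ncard_image_of_injective _ (triangle_injective _)]

lemma eq_of_mem_interior {k l : ι} {x : E2} (hk : x ∈ interior (hull (T k)))
    (hl : x ∈ hull (T l)) : l = k := by
  by_contra hkl
  obtain ⟨m, hm⟩ := exists_points_notMem hT (Ne.symm hkl)
  exact hm (points_mem_of_bary_ne_zero hT (interior_subset hk) hl (mem_interior_hull.1 hk m).ne')

lemma vertex_mem_range {k l : ι} {i : Fin 3} (h : (T l).points i ∈ hull (T k)) :
    (T l).points i ∈ range (T k).points := by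
  refine points_mem_of_bary_ne_zero hT (points_mem_hull l i) h (m := i) ?_
  rw [bary_self (area_triangle _)]
  exact one_ne_zero

lemma opposite_notMem {k l : ι} {m m' : Fin 3} (hkl : k ≠ l) (he : edge T k m = edge T l m') :
    (T k).points m ∉ range (T l).points := by
  intro h
  obtain ⟨i, hi⟩ := exists_points_notMem hT hkl
  have h1 : ∀ x ∈ edge T k m, x ∈ range (T l).points := by
    rw [he]
    intro x hx
    rcases Sym2.mem_iff.1 hx with rfl | rfl <;> exact ⟨_, rfl⟩
  have : ∀ j, (T k).points j ∈ range (T l).points :=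
    (fin3_forall m).2 ⟨h, h1 _ (Sym2.mem_mk_left _ _), h1 _ (Sym2.mem_mk_right _ _)⟩
  exact hi (this i)

/-- Two triangles with a common edge meet in that edge. -/
lemma mem_edgeHull_of_shared {k l : ι} {m m' : Fin 3} (hkl : k ≠ l) (he : edge T k m = edge T l m')
    {x : E2} (hk : x ∈ hull (T k)) (hl : x ∈ hull (T l)) : x ∈ edgeHull (edge T k m) := by
  rw [mem_edgeHull_edge]
  refine ⟨hk, ?_⟩
  by_contra h
  exact opposite_notMem hT hkl he (points_mem_of_bary_ne_zero hT hk hl h)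

/-- Two triangles with two common points share an edge that contains them. -/
lemma exists_shared_edge {k l : ι} (hkl : k ≠ l) {x y : E2} (hxy : x ≠ y)
    (hxk : x ∈ hull (T k)) (hxl : x ∈ hull (T l)) (hyk : y ∈ hull (T k)) (hyl : y ∈ hull (T l)) :
    ∃ m m', edge T k m = edge T l m' := by
  have hp := area_triangle (T k)
  obtain ⟨m, hm⟩ := exists_points_notMem hT hkl
  have hx0 : bc T k m x = 0 := by
    by_contra h; exact hm (points_mem_of_bary_ne_zero hT hxk hxl h)
  have hy0 : bc T k m y = 0 := by
    by_contra h; exact hm (points_mem_of_bary_ne_zero hT hyk hyl h)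
  have sx := sum_bary hp x
  have sy := sum_bary hp y
  rw [fin3_sum m] at sx sy
  have h1 : (T k).points (m + 1) ∈ range (T l).points := by
    by_contra hc
    have hx1 : bc T k (m + 1) x = 0 := by
      by_contra h; exact hc (points_mem_of_bary_ne_zero hT hxk hxl h)
    have hy1 : bc T k (m + 1) y = 0 := by
      by_contra h; exact hc (points_mem_of_bary_ne_zero hT hyk hyl h)
    apply hxy
    apply eq_of_bary_eq hp
    rw [fin3_forall m]
    exact ⟨by rw [hx0, hy0], by rw [hx1, hy1], by linarith⟩
  have h2 : (T k).points (m + 2) ∈ range (T l).points := by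
    by_contra hc
    have hx1 : bc T k (m + 2) x = 0 := by
      by_contra h; exact hc (points_mem_of_bary_ne_zero hT hxk hxl h)
    have hy1 : bc T k (m + 2) y = 0 := by
      by_contra h; exact hc (points_mem_of_bary_ne_zero hT hyk hyl h)
    apply hxy
    apply eq_of_bary_eq hp
    rw [fin3_forall m]
    exact ⟨by rw [hx0, hy0], by linarith, by rw [hx1, hy1]⟩
  obtain ⟨m', hm'⟩ := exists_edge_eq h1 h2 (points_ne k (fin3_add_ne m).2.2)
  exact ⟨m, m', hm'.symm⟩

/-- A point in the relative interior of an edge lies on no other edge. -/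
lemma edge_eq_of_mem_openEdge {k l : ι} {m m' : Fin 3} {x : E2} (hx : x ∈ openEdge (edge T k m))
    (hx' : x ∈ edgeHull (edge T l m')) : edge T l m' = edge T k m := by
  have hxk := edgeHull_subset_hull k m hx.1
  have hxl := edgeHull_subset_hull l m' hx'
  obtain ⟨h0, h1, h2⟩ := mem_openEdge_edge.1 hx
  obtain ⟨m'', hm''⟩ := exists_edge_eq (points_mem_of_bary_ne_zero hT hxk hxl h1.ne')
    (points_mem_of_bary_ne_zero hT hxk hxl h2.ne') (points_ne k (fin3_add_ne m).2.2)
  have hm3 : edge T l m'' = edge T k m := hm''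
  rw [← hm3] at hx ⊢
  obtain ⟨g0, g1, g2⟩ := mem_openEdge_edge.1 hx
  have := (mem_edgeHull_edge.1 hx').2
  rcases fin3_cases m'' m' with rfl | rfl | rfl
  · rfl
  · exact absurd this g1.ne'
  · exact absurd this g2.ne'

lemma exists_edge_of_mem_openEdge {k l : ι} {m : Fin 3} {x : E2}
    (hx : x ∈ openEdge (edge T k m)) (hl : x ∈ hull (T l)) : ∃ m', edge T l m' = edge T k m := by
  have hxk := edgeHull_subset_hull k m hx.1
  obtain ⟨h0, h1, h2⟩ := mem_openEdge_edge.1 hx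
  exact exists_edge_eq (points_mem_of_bary_ne_zero hT hxk hl h1.ne')
    (points_mem_of_bary_ne_zero hT hxk hl h2.ne') (points_ne k (fin3_add_ne m).2.2)

end Mesh

/-! ### Half-edges -/

section Mesh

variable {Ω : Set E2} {ι : Type*} {T : ι → Affine.Triangle ℝ E2}

/-- Both coordinates are affine and vanish on the line of the common edge, hence they are
proportional; the factor is read off at the vertex opposite to the edge. -/
lemma bc_eq_mul_of_edge_eq {k l : ι} {m m' : Fin 3} (he : edge T k m = edge T l m') (x : E2) :
    bc T l m' x = bc T k m x * bc T l m' ((T k).points m) := by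
  have hp := area_triangle (T k)
  have hv : ∀ v ∈ edge T k m, bc T l m' v = 0 := by
    rw [he]
    intro v hv
    rcases Sym2.mem_iff.1 hv with rfl | rfl
    · exact bary_ne (fin3_add_ne m').1
    · exact bary_ne (fin3_add_ne m').2.1
  rw [affineMap_eq_bary (bc T l m') hp x, fin3_sum m, hv _ (Sym2.mem_mk_left _ _),
    hv _ (Sym2.mem_mk_right _ _)]
  simp

open Filter Topology in
lemma tendsto_lineMap_zero (x p : E2) :
    Tendsto (fun r : ℝ => AffineMap.lineMap x p r) (𝓝 0) (𝓝 x) := by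
  have h : Continuous (fun r : ℝ => (AffineMap.lineMap x p r : E2)) := AffineMap.lineMap_continuous
  simpa using h.tendsto 0

open Filter Topology in
lemma eventually_bc_pos {k : ι} {m : Fin 3} {x : E2} (h : 0 < bc T k m x) :
    ∀ᶠ y in 𝓝 x, 0 < bc T k m y :=
  (bary_continuous _ _).continuousAt.eventually (lt_mem_nhds h)

variable (hT : IsConformingTriangulation Ω T)
include hT

/-- Two triangles that share an edge lie on opposite sides of it. -/
lemma bc_opposite_neg {k l : ι} {m m' : Fin 3} (hkl : k ≠ l) (he : edge T k m = edge T l m') :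
    bc T l m' ((T k).points m) < 0 := by
  by_contra! hc
  have hp := area_triangle (T k)
  obtain ⟨n1, n2, n3⟩ := fin3_add_ne m
  -- Push the midpoint of the edge slightly towards the opposite vertex of `T k`. If `T l` lay on
  -- the same side, the new point would belong to both triangles without being on their common edge.
  set x := AffineMap.lineMap ((T k).points (m + 1)) ((T k).points (m + 2)) (1 / 2 : ℝ) with hx
  have hxo : x ∈ openEdge (edge T k m) := lineMap_mem_openEdge k m (by norm_num) (by norm_num)
  have hxo' := hxo
  rw [he, mem_openEdge_edge] at hxo'
  obtain ⟨h0, h1, h2⟩ := hxo'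
  have hcont := tendsto_lineMap_zero x ((T k).points m)
  have e1 := hcont.eventually (eventually_bc_pos h1)
  have e2 := hcont.eventually (eventually_bc_pos h2)
  have e3 : ∀ᶠ r : ℝ in nhdsWithin 0 (Ioi 0), r ∈ Ioo (0:ℝ) 1 :=
    Ioo_mem_nhdsGT one_pos
  obtain ⟨r, ⟨g1, g2⟩, gr0, gr1⟩ := (((e1.and e2).filter_mono nhdsWithin_le_nhds).and e3).exists
  set y := AffineMap.lineMap x ((T k).points m) r with hy
  have hyk : y ∈ hull (T k) := by
    have : y ∈ segment ℝ x ((T k).points m) := by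
      rw [segment_eq_image_lineMap]; exact ⟨r, ⟨gr0.le, gr1.le⟩, rfl⟩
    exact (convex_convexHull ℝ _).segment_subset (edgeHull_subset_hull k m hxo.1)
      (points_mem_hull k m) this
  have hyb : bc T k m y = r := by
    rw [hy, AffineMap.apply_lineMap, bary_self hp, (mem_openEdge_edge.1 hxo).1]
    simp [AffineMap.lineMap_apply]
  have hyl : y ∈ hull (T l) := by
    rw [mem_hull, fin3_forall m']
    refine ⟨?_, g1.le, g2.le⟩
    rw [bc_eq_mul_of_edge_eq he, hyb]
    exact mul_nonneg gr0.le hc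
  have := (mem_edgeHull_edge.1 (mem_edgeHull_of_shared hT hkl he hyk hyl)).2
  rw [hyb] at this
  exact gr0.ne' this

/-- The initial vertex of an edge, oriented counterclockwise around the `k`-th triangle. -/
def src (T : ι → Affine.Triangle ℝ E2) (k : ι) (m : Fin 3) : E2 :=
  if 0 < area (T k).points then (T k).points (m + 1) else (T k).points (m + 2)

/-- The final vertex of an edge, oriented counterclockwise around the `k`-th triangle. -/
def tgt (T : ι → Affine.Triangle ℝ E2) (k : ι) (m : Fin 3) : E2 :=
  if 0 < area (T k).points then (T k).points (m + 2) else (T k).points (m + 1)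

omit hT in
lemma edge_eq_src_tgt (k : ι) (m : Fin 3) : edge T k m = s(src T k m, tgt T k m) := by
  unfold src tgt edge
  split_ifs
  · rfl
  · exact Sym2.eq_swap

omit hT in
lemma src_ne_tgt (k : ι) (m : Fin 3) : src T k m ≠ tgt T k m := by
  unfold src tgt
  split_ifs
  · exact points_ne k (fin3_add_ne m).2.2
  · exact points_ne k (fin3_add_ne m).2.2.symm

omit hT in
lemma bc_eq_det_src_tgt (k : ι) (m : Fin 3) (x : E2) :
    bc T k m x = det2 (src T k m - x) (tgt T k m - x) / |area (T k).points| := by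
  have hp := area_triangle (T k)
  unfold src tgt
  rw [bary_apply]
  split_ifs with h
  · rw [abs_of_pos h]
  · rw [abs_of_neg (lt_of_le_of_ne (not_lt.1 h) hp), det2_swap, neg_div, div_neg]

/-- Each triangle lies on the left of its counterclockwise edges. Adjacent triangles lie on opposite
sides of the common edge, so they traverse it in opposite directions. -/
lemma src_eq_tgt_of_edge_eq {k l : ι} {m m' : Fin 3} (hkl : k ≠ l)
    (he : edge T k m = edge T l m') : src T l m' = tgt T k m ∧ tgt T l m' = src T k m := by
  have h1 := bc_opposite_neg hT hkl he
  have he' := he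
  rw [edge_eq_src_tgt, edge_eq_src_tgt, Sym2.eq_iff] at he'
  rcases he' with ⟨ha, hb⟩ | ⟨ha, hb⟩
  · exfalso
    have h2 : bc T k m ((T k).points m) = 1 := bary_self (area_triangle _) m
    rw [bc_eq_det_src_tgt] at h1 h2
    rw [← ha, ← hb] at h1
    have p1 : 0 < |area (T k).points| := abs_pos.2 (area_triangle _)
    have p2 : 0 < |area (T l).points| := abs_pos.2 (area_triangle _)
    rw [div_eq_one_iff_eq p1.ne'] at h2
    rw [h2] at h1
    exact absurd h1 (not_lt.2 (by positivity))
  · exact ⟨hb.symm, ha.symm⟩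

/-- At most two triangles share an edge. -/
lemma eq_of_edge_eq {k l l' : ι} {m m' m'' : Fin 3} (hkl : k ≠ l) (hkl' : k ≠ l')
    (he : edge T k m = edge T l m') (he' : edge T k m = edge T l' m'') : l = l' := by
  by_contra h
  have h1 := src_eq_tgt_of_edge_eq hT hkl he
  have h2 := src_eq_tgt_of_edge_eq hT hkl' he'
  have h3 := src_eq_tgt_of_edge_eq hT h (he.symm.trans he')
  -- Three triangles at one edge would traverse it in pairwise opposite directions, but there are
  -- only two.
  exact src_ne_tgt k m (h2.2.symm.trans (h3.2.trans h1.1))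

omit hT in
lemma src_injective (k : ι) {m m' : Fin 3} (h : src T k m = src T k m') : m = m' := by
  unfold src at h
  split_ifs at h
  · exact add_right_cancel (triangle_injective _ h)
  · exact add_right_cancel (triangle_injective _ h)

omit hT in
lemma tgt_injective (k : ι) {m m' : Fin 3} (h : tgt T k m = tgt T k m') : m = m' := by
  unfold tgt at h
  split_ifs at h
  · exact add_right_cancel (triangle_injective _ h)
  · exact add_right_cancel (triangle_injective _ h)

omit hT in
lemma exists_src_eq {k : ι} {z : E2} (hz : z ∈ range (T k).points) : ∃ m, src T k m = z := by
  obtain ⟨i, rfl⟩ := hz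
  unfold src
  split_ifs
  · exact ⟨i - 1, by simp⟩
  · exact ⟨i - 2, by simp⟩

omit hT in
lemma exists_tgt_eq {k : ι} {z : E2} (hz : z ∈ range (T k).points) : ∃ m, tgt T k m = z := by
  obtain ⟨i, rfl⟩ := hz
  unfold tgt
  split_ifs
  · exact ⟨i - 2, by simp⟩
  · exact ⟨i - 1, by simp⟩

omit hT in
lemma src_mem_range (k : ι) (m : Fin 3) : src T k m ∈ range (T k).points := by
  unfold src
  split_ifs <;> exact ⟨_, rfl⟩

omit hT in
lemma tgt_mem_range (k : ι) (m : Fin 3) : tgt T k m ∈ range (T k).points := by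
  unfold tgt
  split_ifs <;> exact ⟨_, rfl⟩

open Filter Topology in
/-- Two triangles that share an edge cover a neighbourhood of its relative interior. -/
lemma eventually_mem_hull_or {k l : ι} {m m' : Fin 3} (hkl : k ≠ l)
    (he : edge T k m = edge T l m') {x : E2} (hx : x ∈ openEdge (edge T k m)) :
    ∀ᶠ y in 𝓝 x, y ∈ hull (T k) ∨ y ∈ hull (T l) := by
  have hx' := hx
  rw [he] at hx'
  rw [mem_openEdge_edge] at hx hx'
  filter_upwards [eventually_bc_pos hx.2.1, eventually_bc_pos hx.2.2, eventually_bc_pos hx'.2.1,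
    eventually_bc_pos hx'.2.2] with y h1 h2 h3 h4
  rw [mem_hull, mem_hull, fin3_forall m, fin3_forall m']
  by_cases h : 0 ≤ bc T k m y
  · exact Or.inl ⟨h, h1.le, h2.le⟩
  · refine Or.inr ⟨?_, h3.le, h4.le⟩
    rw [bc_eq_mul_of_edge_eq he]
    exact mul_nonneg_of_nonpos_of_nonpos (not_le.1 h).le (bc_opposite_neg hT hkl he).le

lemma hull_subset_closure (k : ι) : hull (T k) ⊆ closure Ω := by
  rw [hT.closure_eq]
  exact subset_iUnion (fun k => hull (T k)) k

variable (hΩ : interior (closure Ω) = Ω)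
include hΩ

omit hT in
lemma isOpen_domain : IsOpen Ω := hΩ ▸ isOpen_interior

omit hT in
lemma mem_domain_iff {x : E2} (hx : x ∈ closure Ω) : x ∈ Ω ↔ x ∉ frontier Ω := by
  rw [frontier, (isOpen_domain hΩ).interior_eq, mem_sdiff]
  tauto

lemma interior_hull_subset (k : ι) : interior (hull (T k)) ⊆ Ω := by
  rw [← hΩ]
  exact interior_mono (hull_subset_closure hT k)

/-- The two triangles make the closure of `Ω` a neighbourhood of the open edge; `hΩ`, which excludes
slits, turns this into membership in `Ω`. -/
lemma openEdge_subset_domain {k l : ι} {m m' : Fin 3} (hkl : k ≠ l)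
    (he : edge T k m = edge T l m') : openEdge (edge T k m) ⊆ Ω := by
  intro x hx
  rw [← hΩ, mem_interior_iff_mem_nhds]
  filter_upwards [eventually_mem_hull_or hT hkl he hx] with y hy
  rcases hy with hy | hy
  · exact hull_subset_closure hT k hy
  · exact hull_subset_closure hT l hy

omit hT in
lemma edge_mem_intEdges_of_mem {k : ι} {m : Fin 3} {x : E2} (hx : x ∈ Ω)
    (hxe : x ∈ edgeHull (edge T k m)) : edge T k m ∈ intEdges Ω T :=
  ⟨edge_mem_edgeSet k m, fun h => (mem_domain_iff hΩ (subset_closure hx)).1 hx (h hxe)⟩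

variable [Finite ι]

omit hΩ hT in
open Filter Topology in
/-- Near a point, only the triangles containing it matter. -/
lemma eventually_mem_hull_imp (x : E2) :
    ∀ᶠ y in 𝓝 x, ∀ k, y ∈ hull (T k) → x ∈ hull (T k) := by
  rw [Filter.eventually_all]
  intro k
  by_cases h : x ∈ hull (T k)
  · exact Eventually.of_forall fun _ _ => h
  · filter_upwards [(isClosed_hull (T k).points).isOpen_compl.mem_nhds h] with y hy hy'
    exact absurd hy' hy

-- Step across the edge from `x`, away from the opposite vertex. The new point is still in `Ω`,
-- hence in a triangle that, being close, contains `x` and therefore has the same edge; it cannot be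
-- `T k`.
open Filter Topology in
lemma exists_twin_of_mem {k : ι} {m : Fin 3} {x : E2} (hx : x ∈ Ω)
    (hxe : x ∈ openEdge (edge T k m)) : ∃ l m', k ≠ l ∧ edge T k m = edge T l m' := by
  have hp := area_triangle (T k)
  have hcont := tendsto_lineMap_zero x ((T k).points m)
  have e1 := hcont.eventually ((isOpen_domain hΩ).mem_nhds hx)
  have e2 := hcont.eventually (eventually_mem_hull_imp (T := T) x)
  have e3 : ∀ᶠ r : ℝ in 𝓝[<] 0, r < 0 := self_mem_nhdsWithin
  obtain ⟨r, ⟨g1, g2⟩, gr⟩ := (((e1.and e2).filter_mono nhdsWithin_le_nhds).and e3).exists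
  have h1 := subset_closure g1
  rw [hT.closure_eq] at h1
  obtain ⟨l, hl⟩ := mem_iUnion.1 h1
  have hxl := g2 l hl
  obtain ⟨m', hm'⟩ := exists_edge_of_mem_openEdge hT hxe hxl
  refine ⟨l, m', ?_, hm'.symm⟩
  rintro rfl
  have := mem_hull.1 hl m
  rw [AffineMap.apply_lineMap, bary_self hp, (mem_openEdge_edge.1 hxe).1] at this
  simp [AffineMap.lineMap_apply] at this
  exact absurd gr (not_lt.2 this)

open Filter Topology in
/-- An interior edge is shared by two triangles. -/
lemma exists_twin {k : ι} {m : Fin 3} (h : edge T k m ∈ intEdges Ω T) :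
    ∃ l m', k ≠ l ∧ edge T k m = edge T l m' := by
  obtain ⟨x, hxe, hxf⟩ := not_subset.1 h.2
  have hxΩ : x ∈ Ω := (mem_domain_iff hΩ (hull_subset_closure hT k
    (edgeHull_subset_hull k m hxe))).2 hxf
  have hseg : x ∈ segment ℝ ((T k).points (m + 1)) ((T k).points (m + 2)) := by
    rw [← edgeHull_mk]; exact hxe
  have hcl := segment_subset_closure_openSegment hseg
  -- The point off the boundary may be an endpoint of the edge; as `Ω` is open it can be moved into
  -- the open segment.
  obtain ⟨y, hyΩ, hy⟩ := mem_closure_iff.1 hcl Ω (isOpen_domain hΩ) hxΩ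
  rw [openSegment_eq_image_lineMap] at hy
  obtain ⟨θ, hθ, rfl⟩ := hy
  exact exists_twin_of_mem hT hΩ hyΩ (lineMap_mem_openEdge k m hθ.1 hθ.2)

lemma openEdge_subset_of_intEdges {e : Sym2 E2} (h : e ∈ intEdges Ω T) : openEdge e ⊆ Ω := by
  obtain ⟨k, m, rfl⟩ := exists_edge_of_mem_edgeSet h.1
  obtain ⟨l, m', hkl, he⟩ := exists_twin hT hΩ h
  exact openEdge_subset_domain hT hΩ hkl he

omit [Finite ι] in
lemma intEdges_of_shared {k l : ι} {m m' : Fin 3} (hkl : k ≠ l)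
    (he : edge T k m = edge T l m') : edge T k m ∈ intEdges Ω T := by
  have h := lineMap_mem_openEdge (T := T) k m (θ := 1 / 2) (by norm_num) (by norm_num)
  exact edge_mem_intEdges_of_mem hΩ (openEdge_subset_domain hT hΩ hkl he h) h.1

end Mesh

section Mesh

variable {Ω : Set E2} {ι : Type*} {T : ι → Affine.Triangle ℝ E2}

variable (Ω T) in
/-- The half-edges: pairs of a triangle and one of its interior edges. -/
abbrev HalfEdge : Type _ := {η : ι × Fin 3 // edge T η.1 η.2 ∈ intEdges Ω T}

/-- The triangle of a half-edge. -/
def HalfEdge.face (η : HalfEdge Ω T) : ι := η.1.1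

/-- The edge of a half-edge. -/
def HalfEdge.edge (η : HalfEdge Ω T) : Sym2 E2 := PowellSabin.edge T η.1.1 η.1.2

/-- The initial vertex of a half-edge. -/
def HalfEdge.src (η : HalfEdge Ω T) : E2 := PowellSabin.src T η.1.1 η.1.2

lemma HalfEdge.ext_face_edge {η η' : HalfEdge Ω T} (h : η.face = η'.face)
    (he : η.edge = η'.edge) : η = η' := by
  obtain ⟨⟨k, m⟩, hη⟩ := η
  obtain ⟨⟨l, m'⟩, hη'⟩ := η'
  simp only [HalfEdge.face, HalfEdge.edge] at h he
  subst h
  have := edge_injective k he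
  subst this
  rfl

lemma HalfEdge.ext_face_src {η η' : HalfEdge Ω T} (h : η.face = η'.face)
    (he : η.src = η'.src) : η = η' := by
  obtain ⟨⟨k, m⟩, hη⟩ := η
  obtain ⟨⟨l, m'⟩, hη'⟩ := η'
  simp only [HalfEdge.face, HalfEdge.src] at h he
  subst h
  have := src_injective k he
  subst this
  rfl

variable [Finite ι] (hT : IsConformingTriangulation Ω T) (hΩ : interior (closure Ω) = Ω)

/-- The other half-edge on the same edge. -/
def twin (η : HalfEdge Ω T) : HalfEdge Ω T :=
  ⟨((exists_twin hT hΩ η.2).choose, (exists_twin hT hΩ η.2).choose_spec.choose), by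
    rw [← (exists_twin hT hΩ η.2).choose_spec.choose_spec.2]
    exact η.2⟩

lemma twin_face_ne (η : HalfEdge Ω T) : η.face ≠ (twin hT hΩ η).face :=
  (exists_twin hT hΩ η.2).choose_spec.choose_spec.1

lemma twin_edge (η : HalfEdge Ω T) : (twin hT hΩ η).edge = η.edge :=
  (exists_twin hT hΩ η.2).choose_spec.choose_spec.2.symm

lemma eq_twin {η η' : HalfEdge Ω T} (h : η.face ≠ η'.face) (he : η.edge = η'.edge) :
    η' = twin hT hΩ η := by
  refine HalfEdge.ext_face_edge ?_ (he.symm.trans (twin_edge hT hΩ η).symm)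
  exact eq_of_edge_eq hT h (twin_face_ne hT hΩ η) he (twin_edge hT hΩ η).symm

lemma twin_twin (η : HalfEdge Ω T) : twin hT hΩ (twin hT hΩ η) = η :=
  (eq_twin hT hΩ (twin_face_ne hT hΩ η).symm (twin_edge hT hΩ η)).symm

lemma twin_src (η : HalfEdge Ω T) : (twin hT hΩ η).src = tgt T η.1.1 η.1.2 :=
  (src_eq_tgt_of_edge_eq hT (twin_face_ne hT hΩ η) (twin_edge hT hΩ η).symm).1

lemma edge_eq_src_src (η : HalfEdge Ω T) : η.edge = s(η.src, (twin hT hΩ η).src) := by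
  rw [twin_src]
  exact edge_eq_src_tgt _ _

omit [Finite ι] in
lemma mem_hull_face_of_mem {η : HalfEdge Ω T} {x : E2} (hx : x ∈ edgeHull η.edge) :
    x ∈ hull (T η.face) := edgeHull_subset_hull _ _ hx

lemma mem_hull_twin_of_mem {η : HalfEdge Ω T} {x : E2} (hx : x ∈ edgeHull η.edge) :
    x ∈ hull (T (twin hT hΩ η).face) := by
  rw [← twin_edge hT hΩ] at hx
  exact mem_hull_face_of_mem hx

lemma mem_edgeHull_of_mem_hull {η : HalfEdge Ω T} {x : E2} (h1 : x ∈ hull (T η.face))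
    (h2 : x ∈ hull (T (twin hT hΩ η).face)) : x ∈ edgeHull η.edge :=
  mem_edgeHull_of_shared hT (twin_face_ne hT hΩ η) (twin_edge hT hΩ η).symm h1 h2

lemma eq_or_eq_twin {η η' : HalfEdge Ω T} (he : η'.edge = η.edge) :
    η' = η ∨ η' = twin hT hΩ η := by
  by_cases h : η.face = η'.face
  · exact Or.inl (HalfEdge.ext_face_edge h.symm he)
  · exact Or.inr (eq_twin hT hΩ h he.symm)

/-- The triangles at a point of the domain are connected through the edges at that point. -/
lemma eq_of_eq_across_edges_at {A : Type*} {w : E2} (hw : w ∈ Ω) (h : ι → A)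
    (hh : ∀ η : HalfEdge Ω T, w ∈ edgeHull η.edge → h η.face = h (twin hT hΩ η).face) :
    ∀ k, w ∈ hull (T k) → ∀ l, w ∈ hull (T l) → h k = h l := by
  have ev := ((isOpen_domain hΩ).eventually_mem hw).and (eventually_mem_hull_imp (T := T) w)
  obtain ⟨r, hr, hball⟩ := Metric.eventually_nhds_iff_ball.1 ev
  -- Near `w` only triangles containing `w` occur, and two of them that meet in a point other than
  -- `w` share an edge through `w`. Hence the connectedness of the punctured ball links all of them.
  refine eq_of_preconnected_cover (isPreconnected_ball_diff_center w hr) {k | w ∈ hull (T k)}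
    (fun k => hull (T k)) (fun k => isClosed_hull _) ?_ ?_ h ?_
  · rintro x ⟨hx, -⟩
    have h1 := subset_closure (hball x hx).1
    rw [hT.closure_eq] at h1
    obtain ⟨k, hk⟩ := mem_iUnion.1 h1
    exact mem_iUnion₂.2 ⟨k, (hball x hx).2 k hk, hk⟩
  · intro k hk
    obtain ⟨q, hq, hqw⟩ : ∃ q ∈ hull (T k), q ≠ w := by
      by_cases h0 : (T k).points 0 = w
      · exact ⟨_, points_mem_hull k 1, fun h1 => points_ne k (by decide) (h0.trans h1.symm)⟩
      · exact ⟨_, points_mem_hull k 0, h0⟩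
    have e1 := (tendsto_lineMap_zero w q).eventually (Metric.ball_mem_nhds w hr)
    have e3 : ∀ᶠ r : ℝ in nhdsWithin 0 (Ioi 0), r ∈ Ioo (0:ℝ) 1 := Ioo_mem_nhdsGT one_pos
    obtain ⟨θ, g1, g2⟩ := ((e1.filter_mono nhdsWithin_le_nhds).and e3).exists
    refine ⟨_, ⟨g1, ?_⟩, ?_⟩
    · rw [mem_singleton_iff, AffineMap.lineMap_eq_left_iff]
      rintro (h | h)
      · exact hqw h.symm
      · exact g2.1.ne' h
    · refine (convex_convexHull ℝ _).segment_subset hk hq ?_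
      rw [segment_eq_image_lineMap]
      exact ⟨θ, ⟨g2.1.le, g2.2.le⟩, rfl⟩
  · rintro x ⟨hx, hxw⟩ k hk l hl hxk hxl
    by_cases hkl : k = l
    · rw [hkl]
    obtain ⟨m, m', he⟩ := exists_shared_edge hT hkl hxw hxk hxl hk hl
    have hwe := mem_edgeHull_of_shared hT hkl he hk hl
    have hint := edge_mem_intEdges_of_mem hΩ hw hwe
    have := eq_twin hT hΩ (η := ⟨(k, m), hint⟩) (η' := ⟨(l, m'), by rw [← he]; exact hint⟩) hkl he
    have h2 := hh ⟨(k, m), hint⟩ hwe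
    rwa [← this] at h2

omit [Finite ι] in
lemma incenter_mem_interior_hull (k : ι) : (T k).incenter ∈ interior (hull (T k)) :=
  mem_interior_hull.2 (bary_incenter_pos (T k))

/-- The triangles are connected through the interior edges. -/
lemma eq_of_eq_across_edges {A : Type*} (hc : IsPreconnected Ω) (h : ι → A)
    (hh : ∀ η : HalfEdge Ω T, h η.face = h (twin hT hΩ η).face) (k l : ι) : h k = h l := by
  refine eq_of_preconnected_cover hc univ (fun k => hull (T k)) (fun k => isClosed_hull _)
    ?_ ?_ h ?_ k (mem_univ _) l (mem_univ _)
  · intro x hx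
    have h1 := subset_closure hx
    rw [hT.closure_eq] at h1
    simpa using h1
  · intro k _
    have := incenter_mem_interior_hull (T := T) k
    exact ⟨_, interior_hull_subset hT hΩ k this, interior_subset this⟩
  · intro x hx k _ l _ hk hl
    exact eq_of_eq_across_edges_at hT hΩ hx h (fun η _ => hh η) k hk l hl

/-- The twin ends where `η` starts, and in a given triangle only one half-edge ends at a given
vertex. -/
lemma eq_of_src_eq_of_twin_face_eq {η η' : HalfEdge Ω T} (h : η.src = η'.src)
    (h3 : (twin hT hΩ η).face = (twin hT hΩ η').face) : η = η' := by
  have h4 : tgt T (twin hT hΩ η).1.1 (twin hT hΩ η).1.2 = η'.src := by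
    rw [← h, ← twin_src hT hΩ, twin_twin]
  have h5 : tgt T (twin hT hΩ η').1.1 (twin hT hΩ η').1.2 = η'.src := by
    rw [← twin_src hT hΩ, twin_twin]
  have h6 : twin hT hΩ η = twin hT hΩ η' := by
    apply Subtype.ext
    refine Prod.ext h3 ?_
    change (twin hT hΩ η).1.1 = (twin hT hΩ η').1.1 at h3
    rw [← h5, h3] at h4
    exact tgt_injective _ h4
  rw [← twin_twin hT hΩ η, h6, twin_twin]

/-- The triangle jumps around an interior vertex sum up to zero. -/
lemma sum_jump_eq_zero [Fintype (HalfEdge Ω T)] {z : E2} (hz : z ∈ intVertices Ω T) (h : ι → ℝ)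
    [DecidablePred fun η : HalfEdge Ω T => η.src = z] :
    ∑ η : HalfEdge Ω T with η.src = z, (h η.face - h (twin hT hΩ η).face) = 0 := by
  classical
  obtain ⟨k₀, hk₀⟩ := hz.1
  have hzΩ : z ∈ Ω := (mem_domain_iff hΩ (hull_subset_closure hT k₀
    (subset_convexHull ℝ _ hk₀))).2 hz.2
  rw [Finset.sum_sub_distrib, sub_eq_zero]
  -- A triangle at `z` has one half-edge that starts at `z` and one that ends there, whose twin
  -- starts at `z`. Both sums of `h` thus run once over the triangles at `z`.
  rw [← Finset.sum_image (f := h) (g := HalfEdge.face), ← Finset.sum_image (f := h)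
    (g := fun η => (twin hT hΩ η).face)]
  · congr 1
    ext k
    simp only [Finset.mem_image, Finset.mem_filter, Finset.mem_univ, true_and]
    constructor
    · rintro ⟨η, h1, rfl⟩
      obtain ⟨m, hm⟩ := exists_tgt_eq (T := T) (k := η.face) (z := z)
        (h1 ▸ src_mem_range η.1.1 η.1.2)
      have hze : z ∈ edgeHull (edge T η.face m) := by
        refine subset_convexHull ℝ _ ?_
        rw [edge_eq_src_tgt, hm]
        exact Sym2.mem_mk_right _ _
      let η' : HalfEdge Ω T := ⟨(η.face, m), edge_mem_intEdges_of_mem hΩ hzΩ hze⟩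
      refine ⟨twin hT hΩ η', ?_, ?_⟩
      · rw [twin_src]; exact hm
      · rw [twin_twin]; rfl
    · rintro ⟨η, h1, rfl⟩
      have hzm : z ∈ range (T (twin hT hΩ η).face).points := by
        rw [← h1, ← twin_twin hT hΩ η, twin_src, twin_twin hT hΩ η]
        exact tgt_mem_range _ _
      obtain ⟨m, hm⟩ := exists_src_eq hzm
      have hze : z ∈ edgeHull (edge T (twin hT hΩ η).face m) := by
        refine subset_convexHull ℝ _ ?_
        rw [edge_eq_src_tgt, hm]
        exact Sym2.mem_mk_left _ _
      exact ⟨⟨((twin hT hΩ η).face, m), edge_mem_intEdges_of_mem hΩ hzΩ hze⟩, hm, rfl⟩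
  · intro η h1 η' h2 h3
    exact eq_of_src_eq_of_twin_face_eq hT hΩ ((show η.src = z by simpa using h1).trans
      (show η'.src = z by simpa using h2).symm) h3
  · intro η h1 η' h2 h3
    have h1' : η.src = z := by simpa using h1
    have h2' : η'.src = z := by simpa using h2
    exact HalfEdge.ext_face_src h3 (h1'.trans h2'.symm)

end Mesh

/-! ### Primitives of jumps: from local to global -/

section Mesh

variable {Ω : Set E2} {ι : Type*} {T : ι → Affine.Triangle ℝ E2}

variable (hT : IsConformingTriangulation Ω T) (hΩ : interior (closure Ω) = Ω)

include hT in
lemma vertex_mem_edge {z : E2} (hz : z ∈ vertices T) {k : ι} {m : Fin 3}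
    (h : z ∈ edgeHull (edge T k m)) : z ∈ edge T k m := by
  obtain ⟨l, i, rfl⟩ := hz
  obtain ⟨j, hj⟩ := vertex_mem_range hT (edgeHull_subset_hull k m h)
  rw [← hj] at h ⊢
  have h0 := (mem_edgeHull_edge.1 h).2
  rcases fin3_cases m j with rfl | rfl | rfl
  · rw [bary_self (area_triangle _)] at h0
    exact absurd h0 one_ne_zero
  · exact Sym2.mem_mk_left _ _
  · exact Sym2.mem_mk_right _ _

variable [Fintype ι]

-- By duality it is enough that a vector `φ` orthogonal to all jumps at `x` is constant: then it
-- pairs to zero with `y`, whose sum at `x` is zero.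
open Classical in
lemma exists_local_primitive_at_vertex [Fintype (HalfEdge Ω T)] (y : HalfEdge Ω T → ℝ)
    (hy : ∀ η, y (twin hT hΩ η) = - y η) {x : E2} (hx : x ∈ intVertices Ω T)
    (h0 : ∑ η : HalfEdge Ω T with η.src = x, y η = 0) :
    ∃ h : ι → ℝ, ∀ η : HalfEdge Ω T, x ∈ edgeHull η.edge →
      y η = h η.face - h (twin hT hΩ η).face := by
  obtain ⟨k₀, hk₀⟩ := hx.1
  have hxΩ : x ∈ Ω := (mem_domain_iff hΩ (hull_subset_closure hT k₀
    (subset_convexHull ℝ _ hk₀))).2 hx.2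
  let B : (ι → ℝ) →ₗ[ℝ] ({η : HalfEdge Ω T // η.src = x} → ℝ) :=
    { toFun := fun h η => h η.1.face - h (twin hT hΩ η.1).face
      map_add' := fun u v => by ext; simp only [Pi.add_apply]; ring
      map_smul' := fun c u => by
        ext; simp only [Pi.smul_apply, smul_eq_mul, RingHom.id_apply]; ring }
  have hsrc : ∀ η : HalfEdge Ω T, x ∈ edgeHull η.edge → η.src = x ∨ (twin hT hΩ η).src = x := by
    intro η hη
    have h1 : x ∈ η.edge := vertex_mem_edge hT hx.1 hη
    rw [edge_eq_src_src hT hΩ η, Sym2.mem_iff] at h1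
    exact h1.imp Eq.symm Eq.symm
  obtain ⟨h, hh⟩ := exists_eq_of_orthogonal B (fun η => y η.1) (by
    intro φ hφ
    -- `Φ k` is the value of `φ` on the half-edge of the triangle `k` that starts at `x`.
    -- Orthogonality to the jump of the indicator of `k` says that it is also the value on the
    -- half-edge entering `k` from the other side, so `Φ` does not change across the edges at `x`.
    let Φ : ι → ℝ := fun k => ∑ η : {η : HalfEdge Ω T // η.src = x}, if η.1.face = k then φ η else 0
    have hΦ1 : ∀ η : {η : HalfEdge Ω T // η.src = x}, Φ η.1.face = φ η := by
      intro η
      simp only [Φ]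
      rw [Finset.sum_eq_single_of_mem η (Finset.mem_univ _), if_pos rfl]
      intro η' _ hne
      rw [if_neg]
      intro h
      exact hne (Subtype.ext (HalfEdge.ext_face_src h (η'.2.trans η.2.symm)))
    have hΦ : ∀ k, Φ k = ∑ η : {η : HalfEdge Ω T // η.src = x},
        if (twin hT hΩ η.1).face = k then φ η else 0 := by
      intro k
      have h1 := hφ (Pi.single k 1)
      simp only [B, LinearMap.coe_mk, AddHom.coe_mk, Pi.single_apply, mul_sub, mul_ite, mul_one,
        mul_zero, Finset.sum_sub_distrib] at h1
      exact sub_eq_zero.1 h1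
    have hΦ2 : ∀ η : {η : HalfEdge Ω T // η.src = x}, Φ (twin hT hΩ η.1).face = φ η := by
      intro η
      rw [hΦ, Finset.sum_eq_single_of_mem η (Finset.mem_univ _), if_pos rfl]
      intro η' _ hne
      rw [if_neg]
      intro h
      exact hne (Subtype.ext (eq_of_src_eq_of_twin_face_eq hT hΩ (η'.2.trans η.2.symm) h))
    have hconst := eq_of_eq_across_edges_at hT hΩ hxΩ Φ (by
      intro η hη
      rcases hsrc η hη with h | h
      · rw [hΦ1 ⟨η, h⟩, hΦ2 ⟨η, h⟩]
      · have e1 := hΦ1 ⟨_, h⟩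
        have e2 := hΦ2 ⟨_, h⟩
        simp only [twin_twin] at e1 e2
        rw [e1, e2])
    have hmem : ∀ η : {η : HalfEdge Ω T // η.src = x}, x ∈ hull (T η.1.face) := by
      rintro ⟨η, rfl⟩
      exact subset_convexHull ℝ _ (src_mem_range _ _)
    rw [Finset.sum_subtype (p := fun η : HalfEdge Ω T => η.src = x) _ (by simp)] at h0
    rcases isEmpty_or_nonempty {η : HalfEdge Ω T // η.src = x} with hE | ⟨⟨η₀⟩⟩
    · simp
    · rw [Finset.sum_congr rfl fun η _ => by
        rw [← hΦ1 η, hconst _ (hmem η) _ (hmem η₀)], ← Finset.mul_sum, h0, mul_zero])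
  refine ⟨h, fun η hη => ?_⟩
  rcases hsrc η hη with h1 | h1
  · exact (congrFun hh ⟨η, h1⟩).symm
  · have e1 : h (twin hT hΩ η).face - h (twin hT hΩ (twin hT hΩ η)).face = y (twin hT hΩ η) :=
      congrFun hh ⟨_, h1⟩
    rw [twin_twin, hy] at e1
    linarith

-- Only at an interior vertex is there a condition on `y`; a point inside an edge sees a single
-- jump, and any other point sees none.
open Classical in
lemma exists_local_primitive [Fintype (HalfEdge Ω T)] (y : HalfEdge Ω T → ℝ)
    (hy : ∀ η, y (twin hT hΩ η) = - y η)
    (h0 : ∀ z ∈ intVertices Ω T, ∑ η : HalfEdge Ω T with η.src = z, y η = 0)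
    {x : E2} (hx : x ∈ Ω) :
    ∃ h : ι → ℝ, ∀ η : HalfEdge Ω T, x ∈ edgeHull η.edge →
      y η = h η.face - h (twin hT hΩ η).face := by
  by_cases hv : x ∈ vertices T
  · have hz : x ∈ intVertices Ω T := ⟨hv, (mem_domain_iff hΩ (subset_closure hx)).1 hx⟩
    exact exists_local_primitive_at_vertex hT hΩ y hy hz (h0 x hz)
  by_cases he : ∃ η : HalfEdge Ω T, x ∈ edgeHull η.edge
  · obtain ⟨η₀, hη₀⟩ := he
    have ho : x ∈ openEdge η₀.edge := by
      refine ⟨hη₀, fun h => hv ?_⟩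
      rcases Sym2.mem_iff.1 h with rfl | rfl
      · exact ⟨_, _, rfl⟩
      · exact ⟨_, _, rfl⟩
    -- The whole jump is put on one of the two triangles at the edge.
    refine ⟨Pi.single η₀.face (y η₀), fun η hη => ?_⟩
    have hne := twin_face_ne hT hΩ η₀
    have := edge_eq_of_mem_openEdge hT ho hη
    rcases eq_or_eq_twin hT hΩ (η := η₀) (η' := η) this with rfl | rfl
    · simp [hne.symm]
    · simp [hne.symm, hy, twin_twin]
  · exact ⟨0, fun η hη => absurd ⟨η, hη⟩ he⟩

open Classical Filter Topology in
/-- In a simply connected domain, jumps that sum up to zero around each interior vertex are the jumps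
of a function on the triangles. -/
theorem exists_primitive [Fintype (HalfEdge Ω T)] (hsc : IsSimplyConnected Ω)
    (y : HalfEdge Ω T → ℝ) (hy : ∀ η, y (twin hT hΩ η) = - y η)
    (h0 : ∀ z ∈ intVertices Ω T, ∑ η : HalfEdge Ω T with η.src = z, y η = 0) :
    ∃ h : ι → ℝ, ∀ η : HalfEdge Ω T, y η = h η.face - h (twin hT hΩ η).face := by
  have := hsc.simplyConnectedSpace
  have := (isOpen_domain hΩ).locallyPathConnectedSpace
  choose L hL using fun x : Ω => exists_local_primitive hT hΩ y hy h0 x.2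
  have hcov : ∀ x : Ω, ∃ k, (x : E2) ∈ hull (T k) := fun x => by
    have := subset_closure x.2
    rw [hT.closure_eq] at this
    exact mem_iUnion.1 this
  choose κ hκ using hcov
  -- Near `x` every triangle met by `w` also contains `x`, so the local primitive `L x` is valid at
  -- `w`. Two primitives valid at `w` differ by the same constant on all triangles at `w`, since
  -- they have the same jumps there.
  let U : Ω → Set Ω := fun x => {w | ∀ k, (w : E2) ∈ hull (T k) → (x : E2) ∈ hull (T k)}
  have hdiff : ∀ x x' w : Ω, w ∈ U x → w ∈ U x' → ∀ k, (w : E2) ∈ hull (T k) →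
      ∀ l, (w : E2) ∈ hull (T l) → L x' k - L x k = L x' l - L x l := by
    intro x x' w hx hx'
    refine eq_of_eq_across_edges_at hT hΩ w.2 (fun k => L x' k - L x k) fun η hη => ?_
    have h1 := mem_hull_face_of_mem hη
    have h2 := mem_hull_twin_of_mem hT hΩ hη
    have e1 := hL x η (mem_edgeHull_of_mem_hull hT hΩ (hx _ h1) (hx _ h2))
    have e2 := hL x' η (mem_edgeHull_of_mem_hull hT hΩ (hx' _ h1) (hx' _ h2))
    linarith
  have hev : ∀ w : Ω, ∀ᶠ w' : Ω in 𝓝 w, ∀ k, (w' : E2) ∈ hull (T k) → (w : E2) ∈ hull (T k) :=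
    fun w => continuous_subtype_val.continuousAt.eventually (eventually_mem_hull_imp (T := T) w.1)
  -- The difference of local primitives, evaluated at any triangle through the point, is a locally
  -- constant cocycle; `s` corrects the primitives so that they agree.
  obtain ⟨s, hs1, hs2⟩ := exists_sections_of_cocycle U
    (fun x => isOpen_iff_mem_nhds.2 fun w hw => by
      filter_upwards [hev w] with w' hw' k hk using hw k (hw' k hk))
    id (fun x k hk => hk) (fun x x' w => L x' (κ w) - L x (κ w))
    (by
      intro x x' w hx hx'
      filter_upwards [hev w] with w' hw'
      exact hdiff x x' w hx hx' _ (hw' _ (hκ w')) _ (hκ w))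
    (by intros; ring)
  let c : ι → Ω := fun k => ⟨(T k).incenter, interior_hull_subset hT hΩ k (incenter_mem_interior_hull k)⟩
  have hc : ∀ k l, ((c k : Ω) : E2) ∈ hull (T l) → l = k := fun k l h =>
    eq_of_mem_interior hT (incenter_mem_interior_hull k) h
  -- The corrected value on triangle `k` is the same at each of its points in `Ω`: on the segment
  -- from `w` to the incenter, which stays in `U w`, the function `s w` is constant, and at the
  -- incenter the cocycle relation compares `w` with `c k`.
  have key : ∀ w : Ω, ∀ k, (w : E2) ∈ hull (T k) →
      L (c k) k - s (c k) (c k) = L w k - s w w := by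
    intro w k hk
    have hseg : ∀ θ : unitInterval, θ.1 ≠ 0 →
        AffineMap.lineMap (w : E2) (T k).incenter (θ : ℝ) ∈ interior (hull (T k)) := by
      intro θ hθ
      have hθ0 : 0 < θ.1 := lt_of_le_of_ne θ.2.1 (Ne.symm hθ)
      rw [mem_interior_hull]
      intro m
      rw [AffineMap.apply_lineMap, AffineMap.lineMap_apply_module]
      have h1 := mem_hull.1 hk m
      have h2 := bary_incenter_pos (T k) m
      have h3 : 0 ≤ 1 - θ.1 := by linarith [θ.2.2]
      simp only [smul_eq_mul]
      positivity
    let f : unitInterval → Ω := fun θ => ⟨AffineMap.lineMap (w : E2) (T k).incenter (θ : ℝ), by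
      by_cases hθ : θ.1 = 0
      · rw [hθ, AffineMap.lineMap_apply_zero]; exact w.2
      · exact interior_hull_subset hT hΩ k (hseg θ hθ)⟩
    have hf : Continuous f :=
      (AffineMap.lineMap_continuous.comp continuous_subtype_val).subtype_mk _
    have hfU : ∀ θ, f θ ∈ U w := by
      intro θ l hl
      by_cases hθ : θ.1 = 0
      · have : (f θ : E2) = w := by simp [f, hθ]
        rwa [this] at hl
      · rw [eq_of_mem_interior hT (hseg θ hθ) hl]; exact hk
    have hlc : IsLocallyConstant fun θ => s w (f θ) := by
      rw [IsLocallyConstant.iff_eventually_eq]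
      intro θ
      exact hf.continuousAt.eventually (hs1 w (f θ) (hfU θ))
    have h1 := hlc.apply_eq_of_preconnectedSpace 0 1
    have f0 : f 0 = w := Subtype.ext (by simp [f])
    have f1 : f 1 = c k := Subtype.ext (by simp [f, c])
    rw [f0, f1] at h1
    have h2 := hs2 w (c k) (c k) (f1 ▸ hfU 1) (fun _ h => h)
    rw [hc k _ (hκ (c k))] at h2
    linarith
  refine ⟨fun k => L (c k) k - s (c k) (c k), fun η => ?_⟩
  have hmo : AffineMap.lineMap ((T η.1.1).points (η.1.2 + 1)) ((T η.1.1).points (η.1.2 + 2))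
      (1 / 2 : ℝ) ∈ openEdge η.edge := lineMap_mem_openEdge η.1.1 η.1.2 (by norm_num) (by norm_num)
  let w : Ω := ⟨_, openEdge_subset_of_intEdges hT hΩ η.2 hmo⟩
  beta_reduce
  rw [key w _ (mem_hull_face_of_mem hmo.1), key w _ (mem_hull_twin_of_mem hT hΩ hmo.1),
    hL w η hmo.1]
  ring

end Mesh

/-! ### The spanning tree and the fluxes off the tree -/

section Mesh

variable {Ω : Set E2} {ι : Type*} {T : ι → Affine.Triangle ℝ E2}

lemma finite_vertices [Finite ι] : (vertices T).Finite := by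
  have : vertices T = ⋃ k, range (T k).points := by ext; simp [vertices]
  rw [this]
  exact finite_iUnion fun k => finite_range _

lemma finite_intVertices [Finite ι] : (intVertices Ω T).Finite :=
  finite_vertices.subset fun _ h => h.1

lemma finite_intEdges [Finite ι] : (intEdges Ω T).Finite := by
  refine (finite_range fun p : ι × Fin 3 => edge T p.1 p.2).subset ?_
  rintro e ⟨he, -⟩
  obtain ⟨k, m, h⟩ := exists_edge_of_mem_edgeSet he
  exact ⟨(k, m), h⟩

variable (hT : IsConformingTriangulation Ω T) (hΩ : interior (closure Ω) = Ω)

/-- The only admissible vertex on the boundary is `z₀`, so an edge has an end off the boundary and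
cannot lie on it. -/
lemma treeGraph_adj {z₀ : E2} {u v : treeVertices Ω T z₀}
    (h : (treeGraph Ω T z₀).Adj u v) : s((u : E2), (v : E2)) ∈ intEdges Ω T := by
  have h' : (meshGraph T).Adj u v := h
  refine ⟨h', fun hf => ?_⟩
  have hu : (u : E2) ∈ edgeHull s((u : E2), (v : E2)) :=
    subset_convexHull ℝ _ (Sym2.mem_mk_left _ _)
  have hv : (v : E2) ∈ edgeHull s((u : E2), (v : E2)) :=
    subset_convexHull ℝ _ (Sym2.mem_mk_right _ _)
  rcases u.2 with h1 | h1
  · rcases v.2 with h2 | h2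
    · exact h'.1 (h1.trans h2.symm)
    · exact h2.2 (hf hv)
  · exact h1.2 (hf hu)

/-- The edges of a tree of interior vertices and one boundary vertex are interior. -/
lemma tree_subset_intEdges {z₀ : E2} {G : SimpleGraph (treeVertices Ω T z₀)} (hG : G ≤ treeGraph Ω T z₀) :
    Sym2.map Subtype.val '' G.edgeSet ⊆ intEdges Ω T := by
  rintro _ ⟨e, he, rfl⟩
  induction e with
  | h u v => exact treeGraph_adj (hG he)

lemma exists_halfEdge {e : Sym2 E2} (he : e ∈ intEdges Ω T) : ∃ η : HalfEdge Ω T, η.edge = e := by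
  obtain ⟨k, m, rfl⟩ := exists_edge_of_mem_edgeSet he.1
  exact ⟨⟨(k, m), he⟩, rfl⟩

section tree

variable [Finite ι] {z₀ : E2} (hz₀ : z₀ ∈ extVertices Ω T)
    {G : SimpleGraph (treeVertices Ω T z₀)} (hG : G ≤ treeGraph Ω T z₀) (hGtree : G.IsTree)

include hz₀ hG hGtree

omit hz₀ in
/-- A function on the vertices that is constant along the tree and vanishes at the root is zero. -/
lemma eq_zero_of_tree (ψ : E2 → ℝ) (h0 : ψ z₀ = 0)
    (h : ∀ η : HalfEdge Ω T, η.edge ∈ Sym2.map Subtype.val '' G.edgeSet →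
      ψ η.src = ψ (twin hT hΩ η).src) : ∀ z ∈ intVertices Ω T, ψ z = 0 := by
  have hadj : ∀ u v, G.Adj u v → ψ u = ψ v := by
    intro u v huv
    have hmem : s((u : E2), (v : E2)) ∈ Sym2.map Subtype.val '' G.edgeSet := ⟨s(u, v), huv, rfl⟩
    obtain ⟨η, hη⟩ := exists_halfEdge (tree_subset_intEdges hG hmem)
    have h1 := h η (hη ▸ hmem)
    rw [edge_eq_src_src hT hΩ η, Sym2.eq_iff] at hη
    rcases hη with ⟨h2, h3⟩ | ⟨h2, h3⟩
    · rw [← h2, ← h3, h1]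
    · rw [← h2, ← h3, h1]
  have hreach : ∀ u v, G.Reachable u v → ψ u = ψ v := by
    rintro u v ⟨w⟩
    induction w with
    | nil => rfl
    | cons huv _ ih => rw [hadj _ _ huv, ih]
  intro z hz
  rw [← h0]
  exact hreach ⟨z, Or.inr hz⟩ ⟨z₀, Or.inl rfl⟩ (hGtree.connected.preconnected _ _)

/-- Every antisymmetric function on the tree is the difference of a potential. -/
lemma exists_tree_potential (y : HalfEdge Ω T → ℝ) (hy : ∀ η, y (twin hT hΩ η) = - y η) :
    ∃ ψ : E2 → ℝ, (∀ z ∉ intVertices Ω T, ψ z = 0) ∧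
      ∀ η : HalfEdge Ω T, η.edge ∈ Sym2.map Subtype.val '' G.edgeSet →
        y η = ψ η.src - ψ (twin hT hΩ η).src := by
  classical
  have : Fintype (intVertices Ω T) := finite_intVertices.fintype
  have hz : z₀ ∉ intVertices Ω T := fun h => h.2 hz₀.2
  have : Fintype (treeVertices Ω T z₀) := by unfold treeVertices; infer_instance
  have hcard : Fintype.card (treeVertices Ω T z₀) = Fintype.card (intVertices Ω T) + 1 := by
    rw [← Set.card_insert _ hz]
    apply Fintype.card_congr
    rfl
  have hcard' := hGtree.card_edgeFinset
  choose rep hrep using fun e : G.edgeSet =>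
    exists_halfEdge (tree_subset_intEdges hG ⟨e.1, e.2, rfl⟩)
  let ext (ψ : intVertices Ω T → ℝ) : E2 → ℝ :=
    fun z => if h : z ∈ intVertices Ω T then ψ ⟨z, h⟩ else 0
  let δ : (intVertices Ω T → ℝ) →ₗ[ℝ] (G.edgeSet → ℝ) :=
    { toFun := fun ψ e => ext ψ (rep e).src - ext ψ (twin hT hΩ (rep e)).src
      map_add' := fun u v => by
        ext e
        simp only [ext, Pi.add_apply]
        split_ifs <;> ring
      map_smul' := fun c u => by
        ext e
        simp only [ext, Pi.smul_apply, smul_eq_mul, RingHom.id_apply]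
        split_ifs <;> ring }
  have hval : ∀ ψ : intVertices Ω T → ℝ, ∀ η : HalfEdge Ω T, ∀ e : G.edgeSet,
      Sym2.map Subtype.val e.1 = η.edge →
      (η = rep e ∨ η = twin hT hΩ (rep e)) := by
    intro ψ η e he
    exact eq_or_eq_twin hT hΩ (he.symm.trans (hrep e).symm)
  have hinj : Function.Injective δ := by
    rw [injective_iff_map_eq_zero]
    intro ψ hψ
    have h1 := eq_zero_of_tree hT hΩ hG hGtree (ext ψ) (by simp [ext, hz]) (by
      rintro η ⟨e, he, hee⟩
      have h2 : ext ψ (rep ⟨e, he⟩).src - ext ψ (twin hT hΩ (rep ⟨e, he⟩)).src = 0 :=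
        congrFun hψ ⟨e, he⟩
      rcases hval ψ η ⟨e, he⟩ hee with h3 | h3
      · rw [h3]; linarith
      · rw [h3, twin_twin]; linarith)
    ext z
    have := h1 z z.2
    simpa [ext] using this
  -- A tree has one edge less than it has vertices, that is, as many edges as there are interior
  -- vertices. The injective map `δ` is therefore onto.
  have hsurj : Function.Surjective δ := by
    rw [← LinearMap.injective_iff_surjective_of_finrank_eq_finrank]
    · exact hinj
    · rw [Module.finrank_fintype_fun_eq_card, Module.finrank_fintype_fun_eq_card]
      rw [← SimpleGraph.edgeFinset_card]
      omega
  obtain ⟨ψ, hψ⟩ := hsurj fun e => y (rep e)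
  refine ⟨ext ψ, fun z hz => by simp [ext, hz], ?_⟩
  rintro η ⟨e, he, hee⟩
  have h2 : ext ψ (rep ⟨e, he⟩).src - ext ψ (twin hT hΩ (rep ⟨e, he⟩)).src = y (rep ⟨e, he⟩) :=
    congrFun hψ ⟨e, he⟩
  rcases hval ψ η ⟨e, he⟩ hee with h3 | h3
  · rw [h3, h2]
  · rw [h3, twin_twin, hy, ← h2]; ring

end tree

variable [Fintype ι] {z₀ : E2} (hz₀ : z₀ ∈ extVertices Ω T)
    {G : SimpleGraph (treeVertices Ω T z₀)} (hG : G ≤ treeGraph Ω T z₀) (hGtree : G.IsTree)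
    (hsc : IsSimplyConnected Ω)

omit [Fintype ι] in
open Classical in
lemma sum_face_eq [Fintype (HalfEdge Ω T)] (f : HalfEdge Ω T → ℝ) (F : ι → Fin 3 → ℝ)
    (h1 : ∀ η : HalfEdge Ω T, f η = F η.1.1 η.1.2)
    (h2 : ∀ k m, edge T k m ∉ intEdges Ω T → F k m = 0) (k : ι) :
    ∑ η : HalfEdge Ω T with η.face = k, f η = ∑ m, F k m := by
  symm
  rw [← Finset.sum_filter_of_ne (p := fun m => edge T k m ∈ intEdges Ω T)]
  · refine Finset.sum_bij (fun m hm => ⟨(k, m), by simpa using hm⟩) ?_ ?_ ?_ ?_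
    · intro m hm; exact Finset.mem_filter.2 ⟨Finset.mem_univ _, rfl⟩
    · intro m hm m' hm' h; simpa using h
    · intro η hη
      have : η.face = k := by simpa using hη
      subst this
      exact ⟨η.1.2, Finset.mem_filter.2 ⟨Finset.mem_univ _, η.2⟩, rfl⟩
    · intro m hm; rw [h1]
  · intro m _ hm
    by_contra h
    exact hm (h2 k m h)

include hT hΩ hz₀ hG hGtree hsc in
/-- Fluxes through the interior edges outside the tree can be chosen so that the net fluxes out of the
triangles are prescribed, if their sum vanishes. -/
theorem exists_flux (b : ι → ℝ) (hb : ∑ k, b k = 0) :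
    ∃ F : ι → Fin 3 → ℝ,
      (∀ k l m m', k ≠ l → edge T k m = edge T l m' → F l m' = - F k m) ∧
      (∀ k m, edge T k m ∉ intEdges Ω T \ Sym2.map Subtype.val '' G.edgeSet → F k m = 0) ∧
      ∀ k, ∑ m, F k m = b k := by
  classical
  have : Fintype (HalfEdge Ω T) := Fintype.ofFinite _
  have : Fintype (intVertices Ω T) := finite_intVertices.fintype
  obtain ⟨f, hf1, hf2, hf3⟩ := exists_cotree_flow (twin := twin hT hΩ) (twin_twin hT hΩ)
    (face := HalfEdge.face) (src := HalfEdge.src) (W := (intVertices Ω T).toFinset)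
    (t := fun η => η.edge ∈ Sym2.map Subtype.val '' G.edgeSet)
    (fun η => by rw [twin_edge])
    (fun h z hz => by
      convert! sum_jump_eq_zero hT hΩ (z := z) (by simpa using hz) h)
    -- For existence only the connectedness of `Ω` matters; simple connectedness is needed for
    -- uniqueness.
    (fun h hh => eq_of_eq_across_edges hT hΩ hsc.isPathConnected.isConnected.isPreconnected h hh)
    (fun y hy => by
      obtain ⟨ψ, h1, h2⟩ := exists_tree_potential hT hΩ hz₀ hG hGtree y hy
      exact ⟨ψ, fun z hz => h1 z (by simpa using hz), h2⟩) b hb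
  let F : ι → Fin 3 → ℝ := fun k m => if h : edge T k m ∈ intEdges Ω T then f ⟨(k, m), h⟩ else 0
  have hF : ∀ k m, edge T k m ∉ intEdges Ω T → F k m = 0 := fun k m h => by simp [F, h]
  have hF' : ∀ η : HalfEdge Ω T, f η = F η.1.1 η.1.2 := fun η => by
    have := η.2
    simp only [F, dif_pos this]
  refine ⟨F, fun k l m m' hkl he => ?_, fun k m h => ?_, fun k => ?_⟩
  · have hk := intEdges_of_shared hT hΩ hkl he
    have hl := hk
    rw [he] at hl
    have := eq_twin hT hΩ (η := ⟨(k, m), hk⟩) (η' := ⟨(l, m'), hl⟩) hkl he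
    have h1 := hf1 ⟨(k, m), hk⟩
    rw [← this] at h1
    simpa only [hF'] using h1
  · by_cases h1 : edge T k m ∈ intEdges Ω T
    · have h2 : edge T k m ∈ Sym2.map Subtype.val '' G.edgeSet := by
        by_contra h2
        exact h ⟨h1, h2⟩
      have := hf2 ⟨(k, m), h1⟩ h2
      rwa [hF'] at this
    · exact hF k m h1
  · rw [← sum_face_eq f F hF' hF, hf3]

include hT hΩ hz₀ hG hGtree hsc in
/-- Fluxes through the interior edges outside the tree vanish if there is no net flux out of any
triangle. -/
theorem flux_eq_zero (F : ι → Fin 3 → ℝ)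
    (h1 : ∀ k l m m', k ≠ l → edge T k m = edge T l m' → F l m' = - F k m)
    (h2 : ∀ k m, edge T k m ∉ intEdges Ω T \ Sym2.map Subtype.val '' G.edgeSet → F k m = 0)
    (h3 : ∀ k, ∑ m, F k m = 0) (k : ι) (m : Fin 3) : F k m = 0 := by
  classical
  have : Fintype (HalfEdge Ω T) := Fintype.ofFinite _
  have : Fintype (intVertices Ω T) := finite_intVertices.fintype
  by_cases h : edge T k m ∈ intEdges Ω T
  · exact cotree_flow_eq_zero (twin := twin hT hΩ) (twin_twin hT hΩ)
      (face := HalfEdge.face) (src := HalfEdge.src) (W := (intVertices Ω T).toFinset)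
      (t := fun η => η.edge ∈ Sym2.map Subtype.val '' G.edgeSet) (z₀ := z₀)
      (by simpa using fun h : z₀ ∈ intVertices Ω T => h.2 hz₀.2)
      (fun η => by rw [twin_edge])
      (fun y hy hs => exists_primitive hT hΩ hsc y hy fun z hz => by
        convert! hs z (by simpa using hz))
      (fun ψ h0 hψ z hz => eq_zero_of_tree hT hΩ hG hGtree ψ h0 hψ z (by simpa using hz))
      (fun η => F η.1.1 η.1.2)
      (fun η => h1 _ _ _ _ (twin_face_ne hT hΩ η) (twin_edge hT hΩ η).symm)
      (fun η hη => h2 _ _ fun h => h.2 hη)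
      (fun k => by
        rw [sum_face_eq (fun η : HalfEdge Ω T => F η.1.1 η.1.2) F (fun η => rfl)
          (fun k m h => h2 k m fun h' => h h'.1), h3]) ⟨(k, m), h⟩
  · exact h2 k m fun h' => h h'.1

end Mesh

/-! ### The Powell-Sabin split -/

section Mesh

variable {Ω : Set E2} {ι : Type*} {T : ι → Affine.Triangle ℝ E2}

lemma inner_incenter_pos_of_mem {k : ι} {a b : E2} (ha : a ∈ range (T k).points)
    (hb : b ∈ range (T k).points) (hab : a ≠ b) : 0 < inner ℝ ((T k).incenter - a) (b - a) := by
  obtain ⟨i, rfl⟩ := ha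
  obtain ⟨j, rfl⟩ := hb
  exact inner_incenter_pos (T k) fun h => hab (h ▸ rfl)

section
variable (hT : IsConformingTriangulation Ω T)
include hT

/-- The segment joining the incenters of two adjacent triangles crosses the common edge in its
relative interior. -/
lemma exists_crossing {k l : ι} {m m' : Fin 3} (hkl : k ≠ l) (he : edge T k m = edge T l m') :
    ∃ η : ℝ, 0 < η ∧ η < 1 ∧
      AffineMap.lineMap (T k).incenter (T l).incenter η ∈ openEdge (edge T k m) ∧
      ∀ z ∈ edgeHull (edge T k m), z ∈ segment ℝ (T k).incenter (T l).incenter →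
        z = AffineMap.lineMap (T k).incenter (T l).incenter η := by
  have hp := area_triangle (T k)
  -- The coordinate at the opposite vertex is affine along the segment of incenters, with values `u
  -- > 0` and `v < 0` at its ends; it vanishes at parameter `u / (u - v)` and nowhere else.
  set u := bc T k m (T k).incenter with hu
  set v := bc T k m (T l).incenter with hv
  have hu0 : 0 < u := bary_incenter_pos (T k) m
  have hv0 : v < 0 := by
    rw [hv, bc_eq_mul_of_edge_eq he.symm]
    exact mul_neg_of_pos_of_neg (bary_incenter_pos (T l) m') (bc_opposite_neg hT hkl.symm he.symm)
  have huv : 0 < u - v := by linarith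
  have hbc : ∀ r : ℝ, bc T k m (AffineMap.lineMap (T k).incenter (T l).incenter r) =
      u - r * (u - v) := by
    intro r
    rw [AffineMap.apply_lineMap, AffineMap.lineMap_apply_module, ← hu, ← hv]
    simp only [smul_eq_mul]; ring
  have hη0 : 0 < u / (u - v) := div_pos hu0 huv
  have hη1 : u / (u - v) < 1 := by rw [div_lt_one huv]; linarith
  refine ⟨u / (u - v), hη0, hη1, ?_, ?_⟩
  · set z := AffineMap.lineMap (T k).incenter (T l).incenter (u / (u - v)) with hz
    have hz0 : bc T k m z = 0 := by rw [hz, hbc]; field_simp; ring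
    have hs := sum_bary hp z
    have hs' := sum_bary_smul hp z
    rw [fin3_sum m, hz0] at hs
    rw [fin3_sum' m, hz0] at hs'
    have hmem : ∀ a ∈ edge T k m, a ∈ range (T k).points ∧ a ∈ range (T l).points := by
      intro a ha
      refine ⟨?_, ?_⟩
      · rcases Sym2.mem_iff.1 ha with rfl | rfl <;> exact ⟨_, rfl⟩
      · rw [he] at ha
        rcases Sym2.mem_iff.1 ha with rfl | rfl <;> exact ⟨_, rfl⟩
    -- Both incenters project onto the edge on the inner side of each endpoint, and so does any
    -- convex combination; a point on the line of the edge with this property is strictly between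
    -- the endpoints.
    have hpos : ∀ a b, a ∈ edge T k m → b ∈ edge T k m → a ≠ b → 0 < inner ℝ (z - a) (b - a) := by
      intro a b ha hb hab
      have h1 := inner_incenter_pos_of_mem (hmem a ha).1 (hmem b hb).1 hab
      have h2 := inner_incenter_pos_of_mem (hmem a ha).2 (hmem b hb).2 hab
      have h3 : z - a = (1 - u / (u - v)) • ((T k).incenter - a) +
          (u / (u - v)) • ((T l).incenter - a) := by
        rw [hz, AffineMap.lineMap_apply_module]; module
      rw [h3, inner_add_left, inner_smul_left, inner_smul_left]
      simp only [conj_trivial]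
      have : 0 < 1 - u / (u - v) := by linarith
      positivity
    have ma : (T k).points (m + 1) ∈ edge T k m := Sym2.mem_mk_left _ _
    have mb : (T k).points (m + 2) ∈ edge T k m := Sym2.mem_mk_right _ _
    have hab := points_ne (T := T) k (fin3_add_ne m).2.2
    have p1 := hpos _ _ ma mb hab
    have p2 := hpos _ _ mb ma hab.symm
    set x := bary (T k).points (m + 1) z
    set y := bary (T k).points (m + 2) z
    have e1 : z - (T k).points (m + 1) = y • ((T k).points (m + 2) - (T k).points (m + 1)) := by
      rw [← hs', show x = 1 - y by linarith]; module
    have e2 : z - (T k).points (m + 2) = x • ((T k).points (m + 1) - (T k).points (m + 2)) := by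
      rw [← hs', show y = 1 - x by linarith]; module
    rw [e1, inner_smul_left, real_inner_self_eq_norm_sq] at p1
    rw [e2, inner_smul_left, real_inner_self_eq_norm_sq] at p2
    rw [mem_openEdge_edge]
    exact ⟨hz0, pos_of_mul_pos_left p2 (sq_nonneg _), pos_of_mul_pos_left p1 (sq_nonneg _)⟩
  · intro z hz hzs
    rw [segment_eq_image_lineMap] at hzs
    obtain ⟨r, -, rfl⟩ := hzs
    have h0 := (mem_edgeHull_edge.1 hz).2
    rw [hbc] at h0
    congr 1
    rw [eq_div_iff huv.ne']
    linarith

variable (hΩ : interior (closure Ω) = Ω) [Finite ι]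
include hΩ

/-- The choice in `singularPoint` is meaningful because a point with the required property exists:
the crossing with the segment of incenters, or the midpoint. -/
lemma isSingularPoint_singularPoint (k : ι) (m : Fin 3) :
    IsSingularPoint Ω T (edge T k m) (singularPoint Ω T (edge T k m)) := by
  refine Classical.epsilon_spec (p := fun z => IsSingularPoint Ω T (edge T k m) z) ?_
  by_cases hint : edge T k m ∈ intEdges Ω T
  · obtain ⟨l, m', hkl, he⟩ := exists_twin hT hΩ hint
    obtain ⟨η, h0, h1, hη, -⟩ := exists_crossing hT hkl he
    refine ⟨_, fun h => absurd h.2 hint.2, fun _ => ⟨hη.1, fun k' l' hkl' hmem => ?_⟩⟩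
    have hne := points_ne (T := T) k (fin3_add_ne m).2.2
    obtain ⟨n, hn⟩ := exists_edge_eq (hmem _ (Sym2.mem_mk_left _ _)).1
      (hmem _ (Sym2.mem_mk_right _ _)).1 hne
    obtain ⟨n', hn'⟩ := exists_edge_eq (hmem _ (Sym2.mem_mk_left _ _)).2
      (hmem _ (Sym2.mem_mk_right _ _)).2 hne
    have hn : edge T k m = edge T k' n := hn.symm
    have hn' : edge T k m = edge T l' n' := hn'.symm
    have hseg : AffineMap.lineMap (T k).incenter (T l).incenter η ∈
        segment ℝ (T k).incenter (T l).incenter := by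
      rw [segment_eq_image_lineMap]
      exact ⟨η, ⟨h0.le, h1.le⟩, rfl⟩
    -- An edge has only two triangles, so the pair `k', l'` is `k, l` in one of the two orders.
    by_cases hk : k = k'
    · subst hk
      rwa [← eq_of_edge_eq hT hkl hkl' he hn']
    · have h2 := eq_of_edge_eq hT hkl hk he hn
      subst h2
      have h3 := eq_of_edge_eq hT hkl' hkl.symm (hn.symm.trans hn') hn.symm
      subst h3
      rwa [segment_symm]
  · refine ⟨midpoint ℝ ((T k).points (m + 1)) ((T k).points (m + 2)), fun _ a b hab => ?_,
      fun h => absurd h hint⟩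
    rcases Sym2.eq_iff.1 hab with ⟨rfl, rfl⟩ | ⟨rfl, rfl⟩
    · rfl
    · exact midpoint_comm _ _

lemma singularPoint_eq_lineMap_incenter {k l : ι} {m m' : Fin 3} (hkl : k ≠ l)
    (he : edge T k m = edge T l m') : ∃ η : ℝ, 0 < η ∧ η < 1 ∧
      singularPoint Ω T (edge T k m) = AffineMap.lineMap (T k).incenter (T l).incenter η := by
  obtain ⟨η, h0, h1, -, h2⟩ := exists_crossing hT hkl he
  obtain ⟨h3, h4⟩ := (isSingularPoint_singularPoint hT hΩ k m).2 (intEdges_of_shared hT hΩ hkl he)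
  refine ⟨η, h0, h1, h2 _ h3 (h4 k l hkl fun a ha => ⟨?_, ?_⟩)⟩
  · rcases Sym2.mem_iff.1 ha with rfl | rfl <;> exact ⟨_, rfl⟩
  · rw [he] at ha
    rcases Sym2.mem_iff.1 ha with rfl | rfl <;> exact ⟨_, rfl⟩

lemma singularPoint_mem_openEdge (k : ι) (m : Fin 3) :
    singularPoint Ω T (edge T k m) ∈ openEdge (edge T k m) := by
  by_cases hint : edge T k m ∈ intEdges Ω T
  · obtain ⟨l, m', hkl, he⟩ := exists_twin hT hΩ hint
    obtain ⟨η, h0, h1, hη, h2⟩ := exists_crossing hT hkl he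
    obtain ⟨h3, h4⟩ := (isSingularPoint_singularPoint hT hΩ k m).2 hint
    rw [h2 _ h3 (h4 k l hkl fun a ha => ⟨?_, ?_⟩)]
    · exact hη
    · rcases Sym2.mem_iff.1 ha with rfl | rfl <;> exact ⟨_, rfl⟩
    · rw [he] at ha
      rcases Sym2.mem_iff.1 ha with rfl | rfl <;> exact ⟨_, rfl⟩
  · have hext := (edge_intEdges_or_extEdges (Ω := Ω) k m).resolve_left hint
    rw [(isSingularPoint_singularPoint hT hΩ k m).1 hext _ _ rfl]
    have := lineMap_mem_openEdge (T := T) k m (θ := 1 / 2) (by norm_num) (by norm_num)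
    convert! this using 1
    rw [AffineMap.lineMap_apply_module, midpoint_eq_smul_add]
    norm_num [smul_add]

lemma bc_singularPoint_pos {k : ι} {m r : Fin 3} (hr : r ≠ m) :
    0 < bc T k r (singularPoint Ω T (edge T k m)) := by
  obtain ⟨h0, h1, h2⟩ := mem_openEdge_edge.1 (singularPoint_mem_openEdge hT hΩ k m)
  rcases fin3_cases m r with rfl | rfl | rfl
  · exact absurd rfl hr
  · exact h1
  · exact h2

lemma bc_singularPoint_eq_zero (k : ι) (m : Fin 3) :
    bc T k m (singularPoint Ω T (edge T k m)) = 0 :=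
  (mem_openEdge_edge.1 (singularPoint_mem_openEdge hT hΩ k m)).1

end

/-- The vertex opposite to the edge that carries a subtriangle. -/
def Flag.opp (p : Flag) : Fin 3 := -(p.1.1 + p.1.2)

/-- The subtriangle of the same macro-triangle on the other half of the same edge. -/
def Flag.swap (p : Flag) : Flag := ⟨p.1.swap, p.2.symm⟩

lemma Flag.opp_ne (p : Flag) : p.1.1 ≠ p.opp ∧ p.1.2 ≠ p.opp := by
  revert p; decide

lemma Flag.eq_or (p : Flag) (r : Fin 3) : r = p.opp ∨ r = p.1.1 ∨ r = p.1.2 := by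
  revert p r; decide

lemma Flag.cyclic (p : Flag) :
    (p.1.1 = p.opp + 1 ∧ p.1.2 = p.opp + 2) ∨ (p.1.1 = p.opp + 2 ∧ p.1.2 = p.opp + 1) := by
  revert p; decide

lemma Flag.opp_swap (p : Flag) : p.swap.opp = p.opp := by
  revert p; decide

lemma Flag.eq_or_eq_swap {p q : Flag} (h : p.opp = q.opp) : q = p ∨ q = p.swap := by
  revert p q; decide

lemma Flag.edge_eq (k : ι) (p : Flag) :
    s((T k).points p.1.1, (T k).points p.1.2) = edge T k p.opp := by
  rcases p.cyclic with ⟨h1, h2⟩ | ⟨h1, h2⟩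
  · rw [h1, h2]; rfl
  · rw [h1, h2]; exact Sym2.eq_swap

lemma Flag.sum_eq (p : Flag) (w : Fin 3 → ℝ) : ∑ r, w r = w p.opp + w p.1.1 + w p.1.2 := by
  rw [fin3_sum p.opp]
  rcases p.cyclic with ⟨h1, h2⟩ | ⟨h1, h2⟩
  · rw [h1, h2]
  · rw [h1, h2]; ring

variable (Ω T) in
/-- The vertices of a subtriangle, as a family. -/
def cellPts (k : ι) (p : Flag) : Fin 3 → E2 :=
  ![(T k).points p.1.1, singularPoint Ω T (edge T k p.opp), (T k).incenter]

lemma range_cellPts (k : ι) (p : Flag) : range (cellPts Ω T k p) = cellVertices Ω T k p := by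
  rw [cellVertices, Flag.edge_eq, cellPts]
  simp only [Matrix.range_cons, Matrix.range_empty, union_empty, singleton_union]

lemma cell_eq (k : ι) (p : Flag) : cell Ω T k p = convexHull ℝ (range (cellPts Ω T k p)) := by
  rw [range_cellPts]; rfl

variable (hT : IsConformingTriangulation Ω T) (hΩ : interior (closure Ω) = Ω) [Finite ι]
include hT hΩ

/-- Base times height: the base of the cell is a fraction of the edge, and its height is a fraction
of the height of the macro-triangle; both fractions are barycentric coordinates. -/
lemma area_cellPts (k : ι) (p : Flag) : |area (cellPts Ω T k p)| =
    bc T k p.1.2 (singularPoint Ω T (edge T k p.opp)) * bc T k p.opp (T k).incenter *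
      |area (T k).points| := by
  have hp := area_triangle (T k)
  set σ := bc T k p.1.2 (singularPoint Ω T (edge T k p.opp)) with hσ
  have hσ0 : 0 < σ := bc_singularPoint_pos hT hΩ p.opp_ne.2
  have h0 := bc_singularPoint_eq_zero hT hΩ k p.opp
  have hs := sum_bary_smul hp (singularPoint Ω T (edge T k p.opp))
  have hs1 := sum_bary hp (singularPoint Ω T (edge T k p.opp))
  rw [p.sum_eq, h0] at hs1
  have h1 : singularPoint Ω T (edge T k p.opp) - (T k).points p.1.1 =
      σ • ((T k).points p.1.2 - (T k).points p.1.1) := by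
    have : ∑ r, bary (T k).points r (singularPoint Ω T (edge T k p.opp)) • (T k).points r =
        (1 - σ) • (T k).points p.1.1 + σ • (T k).points p.1.2 := by
      apply E2_ext
      · simp only [WithLp.ofLp_sum, WithLp.ofLp_smul, Finset.sum_apply, Pi.smul_apply, smul_eq_mul,
          p.sum_eq, WithLp.ofLp_add, Pi.add_apply]
        rw [h0, ← hσ]; linear_combination ((T k).points p.1.1).ofLp 0 * hs1
      · simp only [WithLp.ofLp_sum, WithLp.ofLp_smul, Finset.sum_apply, Pi.smul_apply, smul_eq_mul,
          p.sum_eq, WithLp.ofLp_add, Pi.add_apply]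
        rw [h0, ← hσ]; linear_combination ((T k).points p.1.1).ofLp 1 * hs1
    rw [← hs, this]; module
  have h2 : |det2 ((T k).points p.1.2 - (T k).points p.1.1) ((T k).incenter - (T k).points p.1.1)| =
      bc T k p.opp (T k).incenter * |area (T k).points| := by
    have hpos : 0 < bc T k p.opp (T k).incenter := bary_incenter_pos _ _
    rw [← abs_of_pos hpos, ← abs_mul, bary_apply, div_mul_cancel₀ _ hp]
    rcases p.cyclic with ⟨h1, h2⟩ | ⟨h1, h2⟩
    · rw [h1, h2]
      congr 1
      simp [det2]; ring
    · rw [h1, h2, ← abs_neg]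
      congr 1
      simp [det2]; ring
  have h3 : area (cellPts Ω T k p) =
      σ * det2 ((T k).points p.1.2 - (T k).points p.1.1) ((T k).incenter - (T k).points p.1.1) := by
    simp only [area, cellPts, Matrix.cons_val]
    rw [h1, det2_smul_left]
  rw [h3, abs_mul, h2, abs_of_pos hσ0]
  ring

lemma area_cellPts_ne_zero (k : ι) (p : Flag) : area (cellPts Ω T k p) ≠ 0 := by
  rw [← abs_pos, area_cellPts hT hΩ]
  exact mul_pos (mul_pos (bc_singularPoint_pos hT hΩ p.opp_ne.2) (bary_incenter_pos _ _))
    (abs_pos.2 (area_triangle _))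

/-- The macro barycentric coordinates of a point in terms of those in a subtriangle. -/
lemma bc_eq_cell_coords (k : ι) (p : Flag) (x : E2) (r : Fin 3) : bc T k r x =
    bary (cellPts Ω T k p) 0 x * (if r = p.1.1 then 1 else 0) +
      bary (cellPts Ω T k p) 1 x * bc T k r (singularPoint Ω T (edge T k p.opp)) +
      bary (cellPts Ω T k p) 2 x * bc T k r (T k).incenter := by
  rw [affineMap_eq_bary (bc T k r) (area_cellPts_ne_zero hT hΩ k p) x, Fin.sum_univ_three]
  simp only [cellPts, Matrix.cons_val, smul_eq_mul, bary_vertex (area_triangle (T k)),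
    eq_comm (a := r)]

lemma mem_cell_iff {k : ι} {p : Flag} {x : E2} :
    x ∈ cell Ω T k p ↔ ∀ m, 0 ≤ bary (cellPts Ω T k p) m x := by
  rw [cell_eq, mem_hull_iff (area_cellPts_ne_zero hT hΩ k p)]

lemma mem_interior_cell_iff {k : ι} {p : Flag} {x : E2} :
    x ∈ interior (cell Ω T k p) ↔ ∀ m, 0 < bary (cellPts Ω T k p) m x := by
  rw [cell_eq, mem_interior_hull_iff (area_cellPts_ne_zero hT hΩ k p)]

lemma cell_subset_hull (k : ι) (p : Flag) : cell Ω T k p ⊆ hull (T k) := by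
  refine convexHull_min ?_ (convex_convexHull ℝ _)
  rintro x (rfl | rfl | rfl)
  · exact points_mem_hull k _
  · rw [Flag.edge_eq]
    exact edgeHull_subset_hull k _ (singularPoint_mem_openEdge hT hΩ k _).1
  · exact interior_subset (incenter_mem_interior_hull k)

lemma cell_subset_closure (k : ι) (p : Flag) : cell Ω T k p ⊆ closure Ω :=
  (cell_subset_hull hT hΩ k p).trans (hull_subset_closure hT k)

lemma interior_cell_subset (k : ι) (p : Flag) : interior (cell Ω T k p) ⊆ Ω := by
  conv_rhs => rw [← hΩ]
  exact interior_mono (cell_subset_closure hT hΩ k p)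

omit hT hΩ [Finite ι] in
lemma mem_cell_of_coords {k : ι} {p : Flag} {x : E2} {α β γ : ℝ} (hα : 0 ≤ α) (hβ : 0 ≤ β)
    (hγ : 0 ≤ γ) (h : ∀ r, bc T k r x = α * (if r = p.1.1 then 1 else 0) +
      β * bc T k r (singularPoint Ω T (edge T k p.opp)) + γ * bc T k r (T k).incenter) :
    x ∈ cell Ω T k p := by
  have hp := area_triangle (T k)
  have hsum : α + β + γ = 1 := by
    have h1 := sum_bary hp x
    have h2 := sum_bary hp (singularPoint Ω T (edge T k p.opp))
    have h3 := sum_bary hp (T k).incenter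
    rw [Finset.sum_congr rfl fun r _ => h r] at h1
    simp only [Finset.sum_add_distrib, ← Finset.mul_sum, h2, h3, Finset.sum_ite_eq',
      Finset.mem_univ, if_true, mul_one] at h1
    exact h1
  have hw : ∑ i, ![α, β, γ] i = 1 := by
    rw [Fin.sum_univ_three]; exact hsum
  have hx : x = ∑ i, ![α, β, γ] i • cellPts Ω T k p i := by
    refine eq_of_bary_eq hp fun r => ?_
    rw [h r, affineMap_comb _ _ _ hw, Fin.sum_univ_three]
    simp only [cellPts, Matrix.cons_val, smul_eq_mul, bary_vertex hp, eq_comm (a := r)]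
  rw [cell_eq, hx]
  refine mem_hull_of_comb hw fun i => ?_
  fin_cases i
  · exact hα
  · exact hβ
  · exact hγ

/-- The subtriangles cover their macro-triangle. -/
lemma exists_mem_cell_of_mem_hull {k : ι} {x : E2} (hx : x ∈ hull (T k)) :
    ∃ p, x ∈ cell Ω T k p := by
  have hg : ∀ r, 0 < bc T k r (T k).incenter := bary_incenter_pos (T k)
  -- Compare the coordinates of `x` with those of the incenter. The index with the smallest ratio is
  -- the edge whose two cells can contain `x`, and the ratio is the weight `γ` of the incenter in
  -- them.
  obtain ⟨m, -, hm⟩ := Finset.exists_min_image Finset.univ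
    (fun r => bc T k r x / bc T k r (T k).incenter) ⟨0, Finset.mem_univ _⟩
  have hm : ∀ r, bc T k m x / bc T k m (T k).incenter * bc T k r (T k).incenter ≤ bc T k r x :=
    fun r => (le_div_iff₀ (hg r)).1 (hm r (Finset.mem_univ _))
  set γ := bc T k m x / bc T k m (T k).incenter with hγ
  have hγm : bc T k m x = γ * bc T k m (T k).incenter := by
    rw [hγ, div_mul_cancel₀ _ (hg m).ne']
  have hγ0 : 0 ≤ γ := div_nonneg (mem_hull.1 hx m) (hg m).le
  -- After removal of the incenter part, the inequality says on which side of the singular point the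
  -- remainder lies; it holds for a flag or for its swap.
  have key : ∀ p : Flag, p.opp = m →
      (bc T k p.1.2 x - γ * bc T k p.1.2 (T k).incenter) *
        bc T k p.1.1 (singularPoint Ω T (edge T k m)) ≤
      (bc T k p.1.1 x - γ * bc T k p.1.1 (T k).incenter) *
        bc T k p.1.2 (singularPoint Ω T (edge T k m)) → x ∈ cell Ω T k p := by
    rintro p rfl hle
    have hs2 : 0 < bc T k p.1.2 (singularPoint Ω T (edge T k p.opp)) :=
      bc_singularPoint_pos hT hΩ p.opp_ne.2
    set u := bc T k p.1.2 x - γ * bc T k p.1.2 (T k).incenter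
    set v := bc T k p.1.1 x - γ * bc T k p.1.1 (T k).incenter
    set s2 := bc T k p.1.2 (singularPoint Ω T (edge T k p.opp))
    set s1 := bc T k p.1.1 (singularPoint Ω T (edge T k p.opp))
    have hu : 0 ≤ u := sub_nonneg.2 (hm _)
    refine mem_cell_of_coords (α := v - u / s2 * s1) (β := u / s2) (γ := γ) ?_
      (div_nonneg hu hs2.le) hγ0 fun r => ?_
    · rw [sub_nonneg, div_mul_eq_mul_div, div_le_iff₀ hs2]
      exact hle
    · rcases p.eq_or r with rfl | rfl | rfl
      · rw [if_neg p.opp_ne.1.symm, bc_singularPoint_eq_zero hT hΩ, hγm]; ring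
      · rw [if_pos rfl]
        simp only [v]; ring
      · rw [if_neg p.2.symm]
        change _ = _ + u / s2 * s2 + _
        rw [div_mul_cancel₀ _ hs2.ne']
        simp only [u]; ring
  have hex : ∃ p : Flag, p.opp = m := by
    clear * -; revert m; decide
  obtain ⟨p, hp⟩ := hex
  rcases le_total ((bc T k p.1.2 x - γ * bc T k p.1.2 (T k).incenter) *
        bc T k p.1.1 (singularPoint Ω T (edge T k m)))
      ((bc T k p.1.1 x - γ * bc T k p.1.1 (T k).incenter) *
        bc T k p.1.2 (singularPoint Ω T (edge T k m))) with h | h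
  · exact ⟨p, key p hp h⟩
  · exact ⟨p.swap, key p.swap (p.opp_swap.trans hp) h⟩

lemma exists_mem_cell {x : E2} (hx : x ∈ closure Ω) : ∃ k p, x ∈ cell Ω T k p := by
  rw [hT.closure_eq] at hx
  obtain ⟨k, hk⟩ := mem_iUnion.1 hx
  exact ⟨k, exists_mem_cell_of_mem_hull hT hΩ hk⟩

/-- The subtriangles have pairwise disjoint interiors. -/
lemma disjoint_interior_cell {k l : ι} {p q : Flag} (h : (k, p) ≠ (l, q)) :
    Disjoint (interior (cell Ω T k p)) (interior (cell Ω T l q)) := by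
  rw [Set.disjoint_left]
  intro x hx hx'
  have hkl : l = k := eq_of_mem_interior hT (interior_mono (cell_subset_hull hT hΩ k p) hx)
    (cell_subset_hull hT hΩ l q (interior_subset hx'))
  subst hkl
  rw [mem_interior_cell_iff hT hΩ] at hx hx'
  have hg : ∀ r, 0 < bc T l r (T l).incenter := bary_incenter_pos (T l)
  -- Inside a cell the ratio to the incenter's coordinates is smallest precisely at the edge of that
  -- cell, which separates cells at different edges.
  have key : ∀ p : Flag, (∀ m, 0 < bary (cellPts Ω T l p) m x) → ∀ r ≠ p.opp,
      bc T l p.opp x / bc T l p.opp (T l).incenter < bc T l r x / bc T l r (T l).incenter := by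
    intro p hx r hr
    have e1 := bc_eq_cell_coords hT hΩ l p x p.opp
    have e2 := bc_eq_cell_coords hT hΩ l p x r
    rw [if_neg p.opp_ne.1.symm, bc_singularPoint_eq_zero hT hΩ] at e1
    rw [e1, lt_div_iff₀ (hg r)]
    have h1 := bc_singularPoint_pos hT hΩ (k := l) hr
    have h2 : 0 ≤ bary (cellPts Ω T l p) 0 x * (if r = p.1.1 then (1:ℝ) else 0) :=
      mul_nonneg (hx 0).le (by split_ifs <;> norm_num)
    have h3 := mul_pos (hx 1) h1
    have h4 : (bary (cellPts Ω T l p) 0 x * 0 + bary (cellPts Ω T l p) 1 x * 0 +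
        bary (cellPts Ω T l p) 2 x * bc T l p.opp (T l).incenter) / bc T l p.opp (T l).incenter =
        bary (cellPts Ω T l p) 2 x := by
      have := (hg p.opp).ne'
      field_simp
      ring
    rw [h4, e2]
    linarith
  by_cases hpq : p.opp = q.opp
  · rcases Flag.eq_or_eq_swap hpq with rfl | rfl
    · exact h rfl
    · have e1 := bc_eq_cell_coords hT hΩ l p x
      have e2 := bc_eq_cell_coords hT hΩ l p.swap x
      rw [p.opp_swap] at e2
      have a0 := e1 p.opp
      have b0 := e2 p.opp
      rw [if_neg p.opp_ne.1.symm, bc_singularPoint_eq_zero hT hΩ] at a0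
      rw [if_neg (show p.opp ≠ p.swap.1.1 from p.opp_ne.2.symm),
        bc_singularPoint_eq_zero hT hΩ] at b0
      have hc : bary (cellPts Ω T l p) 2 x = bary (cellPts Ω T l p.swap) 2 x := by
        apply mul_right_cancel₀ (hg p.opp).ne'
        linarith
      have a1 := e1 p.1.1
      have b1 := e2 p.1.1
      have a2 := e1 p.1.2
      have b2 := e2 p.1.2
      rw [if_pos rfl, hc] at a1
      rw [if_neg (show p.1.1 ≠ p.swap.1.1 from p.2)] at b1
      rw [if_neg p.2.symm, hc] at a2
      rw [if_pos (show p.1.2 = p.swap.1.1 from rfl)] at b2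
      have h1 := bc_singularPoint_pos hT hΩ (k := l) p.opp_ne.1
      have h2 := bc_singularPoint_pos hT hΩ (k := l) p.opp_ne.2
      -- For the two halves of one edge, positivity of the first vertex weight in each cell makes
      -- each singular-point weight strictly larger than the other.
      have c1 : 0 < (bary (cellPts Ω T l p.swap) 1 x - bary (cellPts Ω T l p) 1 x) *
          bc T l p.1.1 (singularPoint Ω T (edge T l p.opp)) := by
        have := hx 0; linarith
      have c2 : 0 < (bary (cellPts Ω T l p) 1 x - bary (cellPts Ω T l p.swap) 1 x) *
          bc T l p.1.2 (singularPoint Ω T (edge T l p.opp)) := by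
        have := hx' 0; linarith
      have d1 := pos_of_mul_pos_left c1 h1.le
      have d2 := pos_of_mul_pos_left c2 h2.le
      linarith
  · exact lt_asymm (key p hx q.opp (Ne.symm hpq)) (key q hx' p.opp hpq)

end Mesh

/-! ### Nodal functions -/

/-- A tent over a quadrilateral with diagonals `ab` and `cd` that cross in `s`. -/
lemma exists_tent {a b c d s : E2} {θ η : ℝ} (hθ : 0 < θ) (hθ' : θ < 1) (hη : 0 < η) (hη' : η < 1)
    (h1 : s = AffineMap.lineMap a b θ) (h2 : s = AffineMap.lineMap c d η)
    (hD : det2 (b - a) (c - d) ≠ 0) :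
    ∃ F : E2 → ℝ, Continuous F ∧ (∀ x, 0 ≤ F x) ∧ F s = 1 ∧
      (∀ x, 0 < F x → ∃ v ∈ ({a, b} : Set E2), ∃ e ∈ ({c, d} : Set E2),
        x ∈ convexHull ℝ {v, s, e}) ∧
      ∀ v ∈ ({a, b} : Set E2), ∀ e ∈ ({c, d} : Set E2), F v = 0 ∧ F e = 0 ∧
        ∃ A : E2 →ᵃ[ℝ] ℝ, ∀ x ∈ convexHull ℝ {v, s, e}, F x = A x := by
  set u := b - a with hu
  set w := c - d with hw
  have hsa : a = s + (-θ) • u := by rw [h1, hu, AffineMap.lineMap_apply_module]; module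
  have hsb : b = s + (1 - θ) • u := by rw [h1, hu, AffineMap.lineMap_apply_module]; module
  have hsc : c = s + η • w := by rw [h2, hw, AffineMap.lineMap_apply_module]; module
  have hsd : d = s + (-(1 - η)) • w := by rw [h2, hw, AffineMap.lineMap_apply_module]; module
  -- affine coordinates along the diagonals
  let ξ : E2 →ᵃ[ℝ] ℝ :=
    { toFun := fun x => det2 (x - s) w / det2 u w
      linear :=
        { toFun := fun x => det2 x w / det2 u w
          map_add' := fun x y => by rw [det2_add_left]; ring
          map_smul' := fun r x => by rw [det2_smul_left]; simp; ring }
      map_vadd' := fun x v => by simp [det2]; ring }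
  let ζ : E2 →ᵃ[ℝ] ℝ :=
    { toFun := fun x => det2 u (x - s) / det2 u w
      linear :=
        { toFun := fun x => det2 u x / det2 u w
          map_add' := fun x y => by rw [det2_add_right]; ring
          map_smul' := fun r x => by rw [det2_smul_right]; simp; ring }
      map_vadd' := fun x v => by simp [det2]; ring }
  have hξ : ∀ r t : ℝ, ξ (s + r • u + t • w) = r := by
    intro r t
    change det2 (s + r • u + t • w - s) w / det2 u w = r
    rw [show s + r • u + t • w - s = r • u + t • w by abel, det2_add_left, det2_smul_left,
      det2_smul_left, det2_self]
    field_simp; ring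
  have hζ : ∀ r t : ℝ, ζ (s + r • u + t • w) = t := by
    intro r t
    change det2 u (s + r • u + t • w - s) / det2 u w = t
    rw [show s + r • u + t • w - s = r • u + t • w by abel, det2_add_right, det2_smul_right,
      det2_smul_right, det2_self]
    field_simp; ring
  have hdec : ∀ x, x = s + ξ x • u + ζ x • w := by
    intro x
    rw [← sub_eq_zero]
    refine eq_zero_of_det2 hD ?_ ?_
    · have e : det2 (x - (s + ξ x • u + ζ x • w)) u =
          - (det2 u (x - s) - ζ x * det2 u w) - ξ x * det2 u u := by
        simp [det2]; ring
      rw [e, det2_self]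
      change - (det2 u (x - s) - det2 u (x - s) / det2 u w * det2 u w) - _ * 0 = 0
      rw [div_mul_cancel₀ _ hD]; ring
    · have e : det2 (x - (s + ξ x • u + ζ x • w)) w =
          (det2 (x - s) w - ξ x * det2 u w) - ζ x * det2 w w := by
        simp [det2]; ring
      rw [e, det2_self]
      change (det2 (x - s) w - det2 (x - s) w / det2 u w * det2 u w) - _ * 0 = 0
      rw [div_mul_cancel₀ _ hD]; ring
  have hθ1 : 0 < 1 - θ := by linarith
  have hη1 : 0 < 1 - η := by linarith
  have hξc : Continuous ξ := AffineMap.continuous_of_finiteDimensional _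
  have hζc : Continuous ζ := AffineMap.continuous_of_finiteDimensional _
  -- A pyramid cut off at height zero. Along each diagonal the larger quotient is the distance from
  -- `s` in units of the half-diagonal on that side, so on each of the four triangles `F` is a
  -- barycentric coordinate.
  let F : E2 → ℝ := fun x => max 0
    (1 - max (ξ x / (1 - θ)) (ξ x / (-θ)) - max (ζ x / η) (ζ x / (-(1 - η))))
  -- the two admissible slopes in each direction
  have max1 : ∀ ρ t : ℝ, (ρ = -θ ∨ ρ = 1 - θ) → 0 ≤ t / ρ →
      max (t / (1 - θ)) (t / (-θ)) = t / ρ := by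
    rintro ρ t (rfl | rfl) h
    · refine max_eq_right ?_
      have ht : t ≤ 0 := by
        by_contra! hc
        exact absurd h (not_le.2 (div_neg_of_pos_of_neg hc (by linarith)))
      exact (div_nonpos_of_nonpos_of_nonneg ht hθ1.le).trans h
    · refine max_eq_left ?_
      have ht : 0 ≤ t := by
        by_contra! hc
        exact absurd h (not_le.2 (div_neg_of_neg_of_pos hc hθ1))
      exact (div_nonpos_of_nonneg_of_nonpos ht (by linarith)).trans h
  have max2 : ∀ ρ t : ℝ, (ρ = η ∨ ρ = -(1 - η)) → 0 ≤ t / ρ →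
      max (t / η) (t / (-(1 - η))) = t / ρ := by
    rintro ρ t (rfl | rfl) h
    · refine max_eq_left ?_
      have ht : 0 ≤ t := by
        by_contra! hc
        exact absurd h (not_le.2 (div_neg_of_neg_of_pos hc hη))
      exact (div_nonpos_of_nonneg_of_nonpos ht (by linarith)).trans h
    · refine max_eq_right ?_
      have ht : t ≤ 0 := by
        by_contra! hc
        exact absurd h (not_le.2 (div_neg_of_pos_of_neg hc (by linarith)))
      exact (div_nonpos_of_nonpos_of_nonneg ht hη.le).trans h
  have ex1 : ∀ t : ℝ, ∃ ρ, (ρ = -θ ∨ ρ = 1 - θ) ∧ 0 ≤ t / ρ := by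
    intro t
    rcases le_total 0 t with h | h
    · exact ⟨_, Or.inr rfl, div_nonneg h hθ1.le⟩
    · exact ⟨_, Or.inl rfl, div_nonneg_of_nonpos h (by linarith)⟩
  have ex2 : ∀ t : ℝ, ∃ ρ, (ρ = η ∨ ρ = -(1 - η)) ∧ 0 ≤ t / ρ := by
    intro t
    rcases le_total 0 t with h | h
    · exact ⟨_, Or.inl rfl, div_nonneg h hη.le⟩
    · exact ⟨_, Or.inr rfl, div_nonneg_of_nonpos h (by linarith)⟩
  have hv : ∀ v ∈ ({a, b} : Set E2), ∃ ρ, (ρ = -θ ∨ ρ = 1 - θ) ∧ v = s + ρ • u := by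
    rintro v (rfl | rfl)
    · exact ⟨_, Or.inl rfl, hsa⟩
    · exact ⟨_, Or.inr rfl, hsb⟩
  have he : ∀ e ∈ ({c, d} : Set E2), ∃ ρ, (ρ = η ∨ ρ = -(1 - η)) ∧ e = s + ρ • w := by
    rintro v (rfl | rfl)
    · exact ⟨_, Or.inl rfl, hsc⟩
    · exact ⟨_, Or.inr rfl, hsd⟩
  have hv' : ∀ ρ, (ρ = -θ ∨ ρ = 1 - θ) → s + ρ • u ∈ ({a, b} : Set E2) ∧ ρ ≠ 0 := by
    rintro ρ (rfl | rfl)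
    · exact ⟨Or.inl hsa.symm, by linarith⟩
    · exact ⟨Or.inr hsb.symm, by linarith⟩
  have he' : ∀ ρ, (ρ = η ∨ ρ = -(1 - η)) → s + ρ • w ∈ ({c, d} : Set E2) ∧ ρ ≠ 0 := by
    rintro ρ (rfl | rfl)
    · exact ⟨Or.inl hsc.symm, by linarith⟩
    · exact ⟨Or.inr hsd.symm, by linarith⟩
  have hFform : ∀ x ρ τ, (ρ = -θ ∨ ρ = 1 - θ) → (τ = η ∨ τ = -(1 - η)) → 0 ≤ ξ x / ρ →
      0 ≤ ζ x / τ → F x = max 0 (1 - ξ x / ρ - ζ x / τ) := by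
    intro x ρ τ hρ hτ h1 h2
    simp only [F]
    rw [max1 ρ _ hρ h1, max2 τ _ hτ h2]
  have hξs : ξ s = 0 := by simpa using hξ 0 0
  have hζs : ζ s = 0 := by simpa using hζ 0 0
  refine ⟨F, by fun_prop, fun x => le_max_left _ _, by simp [F, hξs, hζs], ?_, ?_⟩
  · intro x hx
    obtain ⟨ρ, hρ, h1⟩ := ex1 (ξ x)
    obtain ⟨τ, hτ, h2⟩ := ex2 (ζ x)
    rw [hFform x ρ τ hρ hτ h1 h2] at hx
    have h3 : 0 < 1 - ξ x / ρ - ζ x / τ := by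
      by_contra! hc
      rw [max_eq_left hc] at hx
      exact lt_irrefl _ hx
    refine ⟨_, (hv' ρ hρ).1, _, (he' τ hτ).1, ?_⟩
    have hx' : x = (ξ x / ρ) • (s + ρ • u) + ((1 - ξ x / ρ - ζ x / τ) • s +
        (ζ x / τ) • (s + τ • w)) := by
      conv_lhs => rw [hdec x]
      have e1 : (ξ x / ρ) * ρ = ξ x := div_mul_cancel₀ _ (hv' ρ hρ).2
      have e2 : (ζ x / τ) * τ = ζ x := div_mul_cancel₀ _ (he' τ hτ).2
      rw [smul_add, smul_add, smul_smul, smul_smul, e1, e2]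
      module
    have hcomb := (convex_convexHull ℝ ({s + ρ • u, s, s + τ • w} : Set E2)).sum_mem
      (t := Finset.univ) (w := ![ξ x / ρ, 1 - ξ x / ρ - ζ x / τ, ζ x / τ])
      (z := ![s + ρ • u, s, s + τ • w]) (by
        intro i _; fin_cases i
        · exact h1
        · exact h3.le
        · exact h2) (by simp [Fin.sum_univ_three]; ring) (by
        intro i _
        apply subset_convexHull
        fin_cases i <;> simp)
    rw [hx']
    simpa [Fin.sum_univ_three, add_assoc] using hcomb
  · intro v hvm e hem
    obtain ⟨ρ, hρ, rfl⟩ := hv v hvm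
    obtain ⟨τ, hτ, rfl⟩ := he e hem
    have hρ0 := (hv' ρ hρ).2
    have hτ0 := (he' τ hτ).2
    have a1 : ξ (s + ρ • u) = ρ := by simpa using hξ ρ 0
    have a2 : ζ (s + ρ • u) = 0 := by simpa using hζ ρ 0
    have a3 : ξ (s + τ • w) = 0 := by simpa using hξ 0 τ
    have a4 : ζ (s + τ • w) = τ := by simpa using hζ 0 τ
    let A : E2 →ᵃ[ℝ] ℝ := AffineMap.const ℝ E2 1 - ρ⁻¹ • ξ - τ⁻¹ • ζ
    have hA : ∀ x, A x = 1 - ξ x / ρ - ζ x / τ := by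
      intro x
      simp [A, div_eq_inv_mul]
    have hsub : convexHull ℝ {s + ρ • u, s, s + τ • w} ⊆
        {x | 0 ≤ ξ x / ρ} ∩ {x | 0 ≤ ζ x / τ} ∩ {x | 0 ≤ A x} := by
      have c1 : Convex ℝ {x | 0 ≤ ξ x / ρ} := by
        have := (convex_Ici (𝕜 := ℝ) (0 : ℝ)).affine_preimage (ρ⁻¹ • ξ)
        convert! this using 1
        ext x; simp [div_eq_inv_mul]
      have c2 : Convex ℝ {x | 0 ≤ ζ x / τ} := by
        have := (convex_Ici (𝕜 := ℝ) (0 : ℝ)).affine_preimage (τ⁻¹ • ζ)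
        convert! this using 1
        ext x; simp [div_eq_inv_mul]
      have c3 : Convex ℝ {x | 0 ≤ A x} := (convex_Ici (𝕜 := ℝ) (0 : ℝ)).affine_preimage A
      refine convexHull_min ?_ ((c1.inter c2).inter c3)
      rintro x (rfl | rfl | rfl)
      · simp [hA, a1, a2, hρ0]
      · simp [hA, hξs, hζs]
      · simp [hA, a3, a4, hτ0]
    have hFA : ∀ x ∈ convexHull ℝ {s + ρ • u, s, s + τ • w}, F x = A x := by
      intro x hx
      obtain ⟨⟨g1, g2⟩, g3⟩ := hsub hx
      rw [hFform x ρ τ hρ hτ g1 g2, ← hA, max_eq_right g3]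
    refine ⟨?_, ?_, A, hFA⟩
    · rw [hFA _ (subset_convexHull ℝ _ (by simp)), hA, a1, a2]; simp [hρ0]
    · rw [hFA _ (subset_convexHull ℝ _ (by simp)), hA, a3, a4]; simp [hτ0]

section Mesh

variable {Ω : Set E2} {ι : Type*} {T : ι → Affine.Triangle ℝ E2}

variable (hT : IsConformingTriangulation Ω T) (hΩ : interior (closure Ω) = Ω) [Finite ι]
include hT hΩ

omit hT hΩ [Finite ι] in
lemma cellPts_mem_cellVertices (k : ι) (p : Flag) (i : Fin 3) :
    cellPts Ω T k p i ∈ cellVertices Ω T k p := by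
  rw [← range_cellPts]
  exact ⟨i, rfl⟩

omit hT hΩ [Finite ι] in
lemma cellPts_mem_cell (k : ι) (p : Flag) (i : Fin 3) : cellPts Ω T k p i ∈ cell Ω T k p :=
  subset_convexHull ℝ _ (cellPts_mem_cellVertices k p i)

lemma cell_subset_closure_interior (k : ι) (p : Flag) :
    cell Ω T k p ⊆ closure (interior (cell Ω T k p)) := by
  rw [cell_eq]
  exact hull_subset_closure_interior (area_cellPts_ne_zero hT hΩ k p)

/-- A nonnegative continuous function that is positive only on the star of `z` is nodal at `z` if it is
affine with the nodal values there. -/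
lemma isNodal_of_tent {z : E2} {F : E2 → ℝ} (hF : Continuous F) (h0 : ∀ x, 0 ≤ F x)
    (hpos : ∀ x, 0 < F x → ∃ k p, z ∈ cellVertices Ω T k p ∧ x ∈ cell Ω T k p)
    (haff : ∀ k p, z ∈ cellVertices Ω T k p →
      ∃ A : E2 →ᵃ[ℝ] ℝ, ∀ x ∈ cell Ω T k p, F x = A x)
    (hz : F z = 1)
    (hv : ∀ k p, z ∈ cellVertices Ω T k p → ∀ w ∈ cellVertices Ω T k p, w ≠ z → F w = 0) :
    IsNodal Ω T z ⟨fun x => F x, hF.comp continuous_subtype_val⟩ := by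
  -- If `F` were positive somewhere on a cell without the vertex `z`, it would be positive on an
  -- open set meeting that cell's interior, and this interior would meet the interior of a cell of
  -- the star.
  have hzero : ∀ k p, z ∉ cellVertices Ω T k p → ∀ x ∈ cell Ω T k p, F x = 0 := by
    intro k p hzk x hx
    by_contra hne
    have hFx : 0 < F x := lt_of_le_of_ne (h0 x) (Ne.symm hne)
    have hW : IsOpen {x | 0 < F x} := isOpen_lt continuous_const hF
    obtain ⟨y, hyW, hy⟩ := mem_closure_iff.1 (cell_subset_closure_interior hT hΩ k p hx) _ hW hFx
    obtain ⟨l, q, hzl, hyl⟩ := hpos y hyW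
    obtain ⟨y', hy', hy''⟩ := mem_closure_iff.1 (cell_subset_closure_interior hT hΩ l q hyl) _
      isOpen_interior hy
    have hkl : (k, p) = (l, q) := by
      by_contra hc
      exact Set.disjoint_left.1 (disjoint_interior_cell hT hΩ hc) hy' hy''
    rw [Prod.mk.injEq] at hkl
    rw [← hkl.1, ← hkl.2] at hzl
    exact hzk hzl
  refine ⟨fun k p => ?_, ?_⟩
  · by_cases hzk : z ∈ cellVertices Ω T k p
    · obtain ⟨A, hA⟩ := haff k p hzk
      exact ⟨A, fun x hx => hA x hx⟩
    · exact ⟨0, fun x hx => hzero k p hzk x hx⟩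
  · rintro x ⟨k, p, hx⟩
    refine ⟨fun h => ?_, fun h => ?_⟩
    · change F x = 1
      rw [h, hz]
    · change F x = 0
      by_cases hzk : z ∈ cellVertices Ω T k p
      · exact hv k p hzk x hx h
      · exact hzero k p hzk x (subset_convexHull ℝ _ hx)

lemma incenter_mem_cellVertices_iff {k l : ι} {p : Flag} :
    (T l).incenter ∈ cellVertices Ω T k p ↔ k = l := by
  constructor
  · intro h
    exact eq_of_mem_interior hT (incenter_mem_interior_hull l)
      (cell_subset_hull hT hΩ k p (subset_convexHull ℝ _ h))
  · rintro rfl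
    exact Or.inr (Or.inr rfl)

omit [Finite ι] hΩ in
lemma vertex_ne_of_mem_openEdge {k l : ι} {m i : Fin 3} {x : E2}
    (hx : x ∈ openEdge (edge T k m)) : x ≠ (T l).points i := by
  rintro rfl
  exact hx.2 (vertex_mem_edge hT ⟨l, i, rfl⟩ hx.1)

omit [Finite ι] hΩ in
lemma incenter_ne_of_mem_openEdge {k l : ι} {m : Fin 3} {x : E2}
    (hx : x ∈ openEdge (edge T k m)) : x ≠ (T l).incenter := by
  rintro rfl
  have := eq_of_mem_interior hT (incenter_mem_interior_hull l) (edgeHull_subset_hull k m hx.1)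
  subst this
  exact (bary_incenter_pos (T k) m).ne' (mem_openEdge_edge.1 hx).1

omit [Finite ι] hΩ in
lemma incenter_ne_points {k l : ι} {i : Fin 3} : (T k).points i ≠ (T l).incenter := by
  intro h
  have h1 := points_mem_hull (T := T) k i
  rw [h] at h1
  have := eq_of_mem_interior hT (incenter_mem_interior_hull l) h1
  subst this
  have h2 := bary_incenter_pos (T k) (i + 1)
  rw [← h, bary_ne (fin3_add_ne i).1.symm] at h2
  exact lt_irrefl _ h2

lemma singularPoint_mem_cellVertices_iff {k l : ι} {m : Fin 3} {p : Flag} :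
    singularPoint Ω T (edge T l m) ∈ cellVertices Ω T k p ↔ edge T k p.opp = edge T l m := by
  have ho := singularPoint_mem_openEdge hT hΩ l m
  constructor
  · rintro (h | h | h)
    · exact absurd h (vertex_ne_of_mem_openEdge hT ho)
    · rw [Flag.edge_eq] at h
      refine edge_eq_of_mem_openEdge hT ho ?_
      rw [h]
      exact (singularPoint_mem_openEdge hT hΩ k _).1
    · exact absurd h (incenter_ne_of_mem_openEdge hT ho)
  · intro h
    refine Or.inr (Or.inl ?_)
    rw [Flag.edge_eq, h]

lemma singularPoint_injective {k l : ι} {m m' : Fin 3}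
    (h : singularPoint Ω T (edge T k m) = singularPoint Ω T (edge T l m')) :
    edge T k m = edge T l m' := by
  refine edge_eq_of_mem_openEdge hT (singularPoint_mem_openEdge hT hΩ l m') ?_
  rw [← h]
  exact (singularPoint_mem_openEdge hT hΩ k m).1

/-- The nodal function is the positive part of the smallest ratio of a macro-coordinate to its value
at the incenter. On a cell the minimum is attained at the opposite vertex, where it is the cell
coordinate of the incenter. -/
lemma exists_isNodal_incenter (k : ι) : ∃ lam, IsNodal Ω T (T k).incenter lam := by
  have hg : ∀ r, 0 < bc T k r (T k).incenter := bary_incenter_pos (T k)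
  let L : Fin 3 → E2 → ℝ := fun r x => bc T k r x / bc T k r (T k).incenter
  have hL : ∀ r, Continuous (L r) := fun r => (bary_continuous _ r).div_const _
  let F : E2 → ℝ := fun x => max 0 (Finset.univ.inf' ⟨0, Finset.mem_univ _⟩ fun r => L r x)
  have hFc : Continuous F := continuous_const.max
    (Continuous.finset_inf'_apply _ fun r _ => hL r)
  have hF0 : ∀ x r, L r x = 0 → F x = 0 := by
    intro x r h
    exact max_eq_left ((Finset.inf'_le _ (Finset.mem_univ r)).trans h.le)
  refine ⟨_, isNodal_of_tent hT hΩ (F := F) hFc (fun x => le_max_left _ _) ?_ ?_ ?_ ?_⟩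
  · intro x hx
    have hx' : ∀ r, 0 < L r x := by
      intro r
      by_contra! hc
      have : F x = 0 := max_eq_left ((Finset.inf'_le _ (Finset.mem_univ r)).trans hc)
      exact hx.ne' this
    have hxk : x ∈ hull (T k) := mem_hull.2 fun r => by
      have := hx' r
      have := (div_pos_iff_of_pos_right (hg r)).1 this
      exact this.le
    obtain ⟨p, hp⟩ := exists_mem_cell_of_mem_hull hT hΩ hxk
    exact ⟨k, p, Or.inr (Or.inr rfl), hp⟩
  · intro l p h
    obtain rfl := (incenter_mem_cellVertices_iff hT hΩ).1 h
    refine ⟨(bc T l p.opp (T l).incenter)⁻¹ • bc T l p.opp, fun x hx => ?_⟩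
    rw [mem_cell_iff hT hΩ] at hx
    have e : L p.opp x = bary (cellPts Ω T l p) 2 x := by
      simp only [L]
      rw [bc_eq_cell_coords hT hΩ l p x p.opp, if_neg p.opp_ne.1.symm,
        bc_singularPoint_eq_zero hT hΩ, mul_zero, mul_zero, zero_add, zero_add,
        mul_div_cancel_right₀ _ (hg _).ne']
    have hle : ∀ r, L p.opp x ≤ L r x := by
      intro r
      rw [e]
      simp only [L]
      rw [le_div_iff₀ (hg r), bc_eq_cell_coords hT hΩ l p x r]
      have h1 : 0 ≤ bary (cellPts Ω T l p) 0 x * (if r = p.1.1 then (1:ℝ) else 0) :=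
        mul_nonneg (hx 0) (by split_ifs <;> norm_num)
      have h2 : 0 ≤ bc T l r (singularPoint Ω T (edge T l p.opp)) :=
        mem_hull.1 (edgeHull_subset_hull l _ (singularPoint_mem_openEdge hT hΩ l _).1) r
      have h3 := mul_nonneg (hx 1) h2
      linarith
    have hinf : (Finset.univ.inf' ⟨0, Finset.mem_univ _⟩ fun r => L r x) = L p.opp x :=
      le_antisymm (Finset.inf'_le _ (Finset.mem_univ _)) (Finset.le_inf' _ _ fun r _ => hle r)
    simp only [F]
    rw [hinf, max_eq_right (e ▸ hx 2)]
    simp [L, div_eq_inv_mul]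
  · have : ∀ r, L r (T k).incenter = 1 := fun r => div_self (hg r).ne'
    have hinf : (Finset.univ.inf' ⟨0, Finset.mem_univ _⟩ fun r => L r (T k).incenter) = 1 :=
      le_antisymm ((Finset.inf'_le _ (Finset.mem_univ 0)).trans (this 0).le)
        (Finset.le_inf' _ _ fun r _ => (this r).ge)
    simp only [F]
    rw [hinf]
    norm_num
  · intro l p h w hw hne
    obtain rfl := (incenter_mem_cellVertices_iff hT hΩ).1 h
    rcases hw with rfl | rfl | rfl
    · refine hF0 _ (p.1.1 + 1) ?_
      simp only [L]
      rw [bary_ne (fin3_add_ne p.1.1).1.symm, zero_div]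
    · refine hF0 _ p.opp ?_
      simp only [L]
      rw [Flag.edge_eq, bc_singularPoint_eq_zero hT hΩ, zero_div]
    · exact absurd rfl hne

omit hT hΩ [Finite ι] in
lemma exists_flag_of_mem_edge {k : ι} {m : Fin 3} {v : E2} (hv : v ∈ edge T k m) :
    ∃ p : Flag, p.opp = m ∧ (T k).points p.1.1 = v := by
  have h1 : ∃ p : Flag, p.opp = m ∧ p.1.1 = m + 1 := by clear * -; revert m; decide
  have h2 : ∃ p : Flag, p.opp = m ∧ p.1.1 = m + 2 := by clear * -; revert m; decide
  rcases Sym2.mem_iff.1 hv with rfl | rfl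
  · obtain ⟨p, hp, hp'⟩ := h1
    exact ⟨p, hp, by rw [hp']⟩
  · obtain ⟨p, hp, hp'⟩ := h2
    exact ⟨p, hp, by rw [hp']⟩

-- The incenters lie strictly on opposite sides of the edge, so their difference is not parallel to
-- it.
omit hΩ [Finite ι] in
lemma det2_edge_incenters_ne_zero {k l : ι} {m m' : Fin 3} (hkl : k ≠ l)
    (he : edge T k m = edge T l m') : det2 ((T k).points (m + 2) - (T k).points (m + 1))
      ((T k).incenter - (T l).incenter) ≠ 0 := by
  have hp := area_triangle (T k)
  have h1 : 0 < bc T k m (T k).incenter := bary_incenter_pos _ _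
  have h2 : bc T k m (T l).incenter < 0 := by
    rw [bc_eq_mul_of_edge_eq he.symm]
    exact mul_neg_of_pos_of_neg (bary_incenter_pos (T l) m') (bc_opposite_neg hT hkl.symm he.symm)
  have h3 : det2 ((T k).points (m + 2) - (T k).points (m + 1))
      ((T k).incenter - (T l).incenter) = (bc T k m (T k).incenter - bc T k m (T l).incenter) *
        area (T k).points := by
    rw [bary_apply, bary_apply, ← sub_div, div_mul_cancel₀ _ hp]
    simp [det2]; ring
  rw [h3]
  exact mul_ne_zero (by linarith) hp

/-- The four cells at the point are the quarters of a quadrilateral whose diagonals, the edge and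
the segment of incenters, cross there; the tent over it is nodal. -/
lemma exists_isNodal_singularPoint {e : Sym2 E2} (he : e ∈ intEdges Ω T) :
    ∃ lam, IsNodal Ω T (singularPoint Ω T e) lam := by
  obtain ⟨k, m, rfl⟩ := exists_edge_of_mem_edgeSet he.1
  obtain ⟨l, m', hkl, hee⟩ := exists_twin hT hΩ he
  obtain ⟨θ, hθ0, hθ1, hθ⟩ := exists_lineMap_of_mem_openEdge (singularPoint_mem_openEdge hT hΩ k m)
  obtain ⟨η, hη0, hη1, hη⟩ := singularPoint_eq_lineMap_incenter hT hΩ hkl hee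
  obtain ⟨F, hFc, hF0, hFs, hFpos, hF⟩ := exists_tent hθ0 hθ1 hη0 hη1 hθ.symm hη
    (det2_edge_incenters_ne_zero hT hkl hee)
  have hcell : ∀ k' p, singularPoint Ω T (edge T k m) ∈ cellVertices Ω T k' p →
      (T k').points p.1.1 ∈ ({(T k).points (m + 1), (T k).points (m + 2)} : Set E2) ∧
      (T k').incenter ∈ ({(T k).incenter, (T l).incenter} : Set E2) ∧
      cellVertices Ω T k' p =
        {(T k').points p.1.1, singularPoint Ω T (edge T k m), (T k').incenter} := by
    intro k' p h
    have h1 := (singularPoint_mem_cellVertices_iff hT hΩ).1 h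
    refine ⟨?_, ?_, ?_⟩
    · have : (T k').points p.1.1 ∈ edge T k' p.opp := by
        rw [← Flag.edge_eq]; exact Sym2.mem_mk_left _ _
      rw [h1] at this
      exact Sym2.mem_iff.1 this
    · by_cases hk : k = k'
      · exact Or.inl (by rw [hk])
      · exact Or.inr (by rw [eq_of_edge_eq hT hk hkl h1.symm hee]; rfl)
    · rw [cellVertices, Flag.edge_eq, h1]
  refine ⟨_, isNodal_of_tent hT hΩ (F := F) hFc hF0 ?_ ?_ hFs ?_⟩
  · intro x hx
    obtain ⟨v, hv, e, he', hx'⟩ := hFpos x hx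
    have hv1 : v ∈ edge T k m := Sym2.mem_iff.2 hv
    rcases he' with rfl | rfl
    · obtain ⟨p, hp1, rfl⟩ := exists_flag_of_mem_edge hv1
      refine ⟨k, p, (singularPoint_mem_cellVertices_iff hT hΩ).2 (by rw [hp1]), ?_⟩
      rwa [cell, cellVertices, Flag.edge_eq, hp1]
    · rw [hee] at hv1
      obtain ⟨p, hp1, rfl⟩ := exists_flag_of_mem_edge hv1
      refine ⟨l, p, (singularPoint_mem_cellVertices_iff hT hΩ).2 (by rw [hp1, hee]), ?_⟩
      rwa [cell, cellVertices, Flag.edge_eq, hp1, ← hee]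
  · intro k' p h
    obtain ⟨h1, h2, h3⟩ := hcell k' p h
    rw [cell, h3]
    exact (hF _ h1 _ h2).2.2
  · intro k' p h w hw hne
    obtain ⟨h1, h2, h3⟩ := hcell k' p h
    rw [h3] at hw
    rcases hw with rfl | rfl | rfl
    · exact (hF _ h1 _ h2).1
    · exact absurd rfl hne
    · exact (hF _ h1 _ h2).2.1

lemma isNodal_hat_incenter (k : ι) :
    IsNodal Ω T (T k).incenter (hat Ω T (T k).incenter) :=
  Classical.epsilon_spec (exists_isNodal_incenter hT hΩ k)

lemma isNodal_hat_singularPoint {e : Sym2 E2} (he : e ∈ intEdges Ω T) :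
    IsNodal Ω T (singularPoint Ω T e) (hat Ω T (singularPoint Ω T e)) :=
  Classical.epsilon_spec (exists_isNodal_singularPoint hT hΩ he)

end Mesh

/-! ### The divergence in terms of nodal values -/

/-- The divergence of the affine field with the values `W` at the vertices `p` of a triangle. -/
def cellDiv (p W : Fin 3 → E2) : ℝ :=
  (det2 (W 1 - W 0) (p 2 - p 0) + det2 (p 1 - p 0) (W 2 - W 0)) / area p

lemma cellDiv_mul_area {p : Fin 3 → E2} (hp : area p ≠ 0) (W : Fin 3 → E2) :
    area p * cellDiv p W = det2 (W 1 - W 0) (p 2 - p 0) + det2 (p 1 - p 0) (W 2 - W 0) :=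
  mul_div_cancel₀ _ hp

/-- The divergence is written in the directions `u` of the edge and `w` from the edge to the
incenter. The first term does not see `W 2` and the second does not see `W 0`, which makes the
alternating sums at a singular point cancel. -/
lemma cellDiv_eq_split {p : Fin 3 → E2} {u w : E2} {α β : ℝ} (hα : α ≠ 0) (hβ : β ≠ 0)
    (huw : det2 u w ≠ 0) (h1 : p 1 - p 0 = α • u) (h2 : p 2 - p 1 = β • w) (W : Fin 3 → E2) :
    cellDiv p W = α⁻¹ * det2 (W 1 - W 0) w / det2 u w + β⁻¹ * det2 u (W 2 - W 1) / det2 u w := by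
  have e : p 2 - p 0 = α • u + β • w := by rw [← h1, ← h2]; abel
  have ha : area p = α * β * det2 u w := by
    rw [area, e, h1, det2_add_right, det2_smul_left, det2_smul_left, det2_smul_right,
      det2_smul_right, det2_self]
    ring
  have e2 : W 2 - W 0 = (W 1 - W 0) + (W 2 - W 1) := by abel
  rw [cellDiv, ha, e, h1, e2, det2_add_right, det2_smul_left, det2_smul_right, det2_smul_right,
    det2_add_right, det2_swap u (W 1 - W 0)]
  field_simp
  ring

lemma divergence_affine (p W : Fin 3 → E2) :
    ∑ i : Fin 2, ∑ j, ((bary p j).linear (EuclideanSpace.single i 1) • W j) i = cellDiv p W := by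
  simp only [bary_linear_apply, Fin.sum_univ_two, Fin.sum_univ_three, cellDiv, det2]
  simp
  ring

section Mesh

variable {Ω : Set E2} {ι : Type*} {T : ι → Affine.Triangle ℝ E2}

lemma ext0_apply (v : C(closure Ω, E2)) {x : E2} (hx : x ∈ closure Ω) : ext0 v x = v ⟨x, hx⟩ :=
  Subtype.val_injective.extend_apply v 0 ⟨x, hx⟩

variable (Ω T) in
/-- The divergence on the subtriangles of the continuous piecewise affine field with the values `x` at
the vertices of the macro-triangles, `y e` at the singular point of the edge `e`, and `z k` at the
incenters. -/
def nodalDiv (x : E2 → E2) (y : Sym2 E2 → E2) (z : ι → E2) (k : ι) (p : Flag) : ℝ :=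
  cellDiv (cellPts Ω T k p) ![x ((T k).points p.1.1), y (edge T k p.opp), z k]

variable (Ω T) in
/-- The divergence on the subtriangles of the continuous piecewise affine field with the nodal values
of `V`. -/
abbrev fieldDiv (V : E2 → E2) (k : ι) (p : Flag) : ℝ :=
  nodalDiv Ω T V (fun e => V (singularPoint Ω T e)) (fun k => V (T k).incenter) k p

/-- The flag of the first half of an edge oriented counterclockwise. -/
def stdFlag (T : ι → Affine.Triangle ℝ E2) (k : ι) (m : Fin 3) : Flag :=
  if 0 < area (T k).points then ⟨(m + 1, m + 2), (fin3_add_ne m).2.2⟩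
  else ⟨(m + 2, m + 1), (fin3_add_ne m).2.2.symm⟩

lemma stdFlag_opp (k : ι) (m : Fin 3) : (stdFlag T k m).opp = m := by
  have h1 : Flag.opp ⟨(m + 1, m + 2), (fin3_add_ne m).2.2⟩ = m := by
    clear * -; revert m; decide
  have h2 : Flag.opp ⟨(m + 2, m + 1), (fin3_add_ne m).2.2.symm⟩ = m := by
    clear * -; revert m; decide
  unfold stdFlag
  split_ifs
  · exact h1
  · exact h2

lemma points_stdFlag (k : ι) (m : Fin 3) : (T k).points (stdFlag T k m).1.1 = src T k m ∧
    (T k).points (stdFlag T k m).1.2 = tgt T k m := by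
  unfold stdFlag src tgt
  split_ifs <;> exact ⟨rfl, rfl⟩

lemma eq_stdFlag_or (k : ι) (p : Flag) :
    p = stdFlag T k p.opp ∨ p = (stdFlag T k p.opp).swap :=
  Flag.eq_or_eq_swap (stdFlag_opp k p.opp)

lemma sum_flag (k : ι) (f : Flag → ℝ) :
    ∑ p, f p = ∑ m, (f (stdFlag T k m) + f (stdFlag T k m).swap) := by
  have hu : (Finset.univ : Finset Flag) = {⟨(1, 2), by decide⟩, ⟨(2, 1), by decide⟩,
      ⟨(2, 0), by decide⟩, ⟨(0, 2), by decide⟩, ⟨(0, 1), by decide⟩, ⟨(1, 0), by decide⟩} := by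
    decide
  have hs : ∑ p, f p = f ⟨(1, 2), by decide⟩ + (f ⟨(2, 1), by decide⟩ +
      (f ⟨(2, 0), by decide⟩ + (f ⟨(0, 2), by decide⟩ + (f ⟨(0, 1), by decide⟩ +
        f ⟨(1, 0), by decide⟩)))) := by
    rw [hu]
    repeat rw [Finset.sum_insert (by decide)]
    rw [Finset.sum_singleton]
  rw [hs, Fin.sum_univ_three]
  unfold stdFlag
  split_ifs
  · change _ = f ⟨(1, 2), by decide⟩ + f ⟨(2, 1), by decide⟩ + (f ⟨(2, 0), by decide⟩ +
      f ⟨(0, 2), by decide⟩) + (f ⟨(0, 1), by decide⟩ + f ⟨(1, 0), by decide⟩)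
    ring
  · change _ = f ⟨(2, 1), by decide⟩ + f ⟨(1, 2), by decide⟩ + (f ⟨(0, 2), by decide⟩ +
      f ⟨(2, 0), by decide⟩) + (f ⟨(1, 0), by decide⟩ + f ⟨(0, 1), by decide⟩)
    ring

/-- The edge vector oriented counterclockwise around the `k`-th triangle. -/
def edgeVec (T : ι → Affine.Triangle ℝ E2) (k : ι) (m : Fin 3) : E2 := tgt T k m - src T k m

lemma sum_edgeVec (k : ι) : ∑ m, edgeVec T k m = 0 := by
  unfold edgeVec src tgt
  split_ifs <;> simp [Fin.sum_univ_three] <;> abel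

lemma sum_tgt_sub_src (k : ι) (x : E2 → E2) : ∑ m, (x (tgt T k m) - x (src T k m)) = 0 := by
  unfold src tgt
  split_ifs <;> simp [Fin.sum_univ_three] <;> abel

lemma det2_edgeVec_ne_zero (k : ι) : det2 (edgeVec T k 0) (edgeVec T k 1) ≠ 0 := by
  have h := area_triangle (T k)
  have e : det2 (edgeVec T k 0) (edgeVec T k 1) = area (T k).points := by
    unfold edgeVec src tgt
    split_ifs <;> simp [area, det2] <;> ring
  rwa [e]

lemma det2_edgeVec_incenter_pos (k : ι) (m : Fin 3) :
    0 < det2 (edgeVec T k m) ((T k).incenter - src T k m) := by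
  have h := bary_incenter_pos (T k) m
  change 0 < bc T k m _ at h
  rw [bc_eq_det_src_tgt] at h
  have h' := (div_pos_iff_of_pos_right (abs_pos.2 (area_triangle (T k)))).1 h
  convert! h' using 1
  simp [edgeVec, det2]; ring

variable (hT : IsConformingTriangulation Ω T) (hΩ : interior (closure Ω) = Ω) [Finite ι]
include hT

omit [Finite ι] in
lemma edgeVec_twin {k l : ι} {m m' : Fin 3} (hkl : k ≠ l) (he : edge T k m = edge T l m') :
    edgeVec T l m' = - edgeVec T k m := by
  obtain ⟨h1, h2⟩ := src_eq_tgt_of_edge_eq hT hkl he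
  rw [edgeVec, edgeVec, h1, h2, neg_sub]

include hΩ

lemma exists_singularPoint_eq (k : ι) (m : Fin 3) : ∃ θ : ℝ, 0 < θ ∧ θ < 1 ∧
    singularPoint Ω T (edge T k m) - src T k m = θ • edgeVec T k m ∧
    singularPoint Ω T (edge T k m) - tgt T k m = (-(1 - θ)) • edgeVec T k m := by
  obtain ⟨θ, h0, h1, h⟩ := exists_lineMap_of_mem_openEdge (singularPoint_mem_openEdge hT hΩ k m)
  rw [AffineMap.lineMap_apply, vsub_eq_sub, vadd_eq_add] at h
  unfold edgeVec src tgt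
  rw [← h]
  split_ifs
  · exact ⟨θ, h0, h1, by module, by module⟩
  · exact ⟨1 - θ, by linarith, by linarith, by module, by module⟩

/-- Seen from the two ends of the edge, vertex, singular point and incenter are listed in opposite
orientations. -/
lemma area_cellPts_stdFlag (k : ι) (m : Fin 3) : 0 < area (cellPts Ω T k (stdFlag T k m)) ∧
    area (cellPts Ω T k (stdFlag T k m).swap) < 0 := by
  obtain ⟨θ, h0, h1, e1, e2⟩ := exists_singularPoint_eq hT hΩ k m
  have hD := det2_edgeVec_incenter_pos (T := T) k m
  constructor
  · simp only [area, cellPts, stdFlag_opp, (points_stdFlag k m).1, Matrix.cons_val]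
    rw [e1, det2_smul_left]
    positivity
  · have hsw : (T k).points (stdFlag T k m).swap.1.1 = tgt T k m := (points_stdFlag k m).2
    simp only [area, cellPts, Flag.opp_swap, stdFlag_opp, hsw, Matrix.cons_val]
    have e3 : (T k).incenter - tgt T k m = ((T k).incenter - src T k m) - edgeVec T k m := by
      simp [edgeVec]
    rw [e2, e3, det2_smul_left, det2_sub_right, det2_self, sub_zero]
    have : 0 < (1 - θ) * det2 (edgeVec T k m) ((T k).incenter - src T k m) :=
      mul_pos (by linarith) hD
    linarith

/-- The integral of the divergence over the two subtriangles at an edge. -/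
lemma sum_edge_nodalDiv (x : E2 → E2) (y : Sym2 E2 → E2) (z : ι → E2) (k : ι) (m : Fin 3) :
    |area (cellPts Ω T k (stdFlag T k m))| * nodalDiv Ω T x y z k (stdFlag T k m) +
      |area (cellPts Ω T k (stdFlag T k m).swap)| * nodalDiv Ω T x y z k (stdFlag T k m).swap =
    det2 (y (edge T k m) - z k) (edgeVec T k m) +
      det2 (x (tgt T k m) - x (src T k m))
        ((T k).incenter - singularPoint Ω T (edge T k m)) := by
  obtain ⟨h1, h2⟩ := area_cellPts_stdFlag hT hΩ k m
  have hsw : (T k).points (stdFlag T k m).swap.1.1 = tgt T k m := (points_stdFlag k m).2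
  rw [abs_of_pos h1, abs_of_neg h2, nodalDiv, nodalDiv, neg_mul, cellDiv_mul_area h1.ne',
    cellDiv_mul_area h2.ne]
  simp only [cellPts, Flag.opp_swap, stdFlag_opp, hsw, (points_stdFlag k m).1, Matrix.cons_val,
    edgeVec]
  simp [det2]; ring

lemma abs_area_cellPts_pos (k : ι) (p : Flag) : 0 < |area (cellPts Ω T k p)| :=
  abs_pos.2 (area_cellPts_ne_zero hT hΩ k p)

/-- Divergence theorem on a macro-triangle, with both sides doubled. The incenter value drops out
because the edge vectors sum to zero. -/
lemma sum_nodalDiv_zero (y : Sym2 E2 → E2) (z : ι → E2) (k : ι) :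
    ∑ p, |area (cellPts Ω T k p)| * nodalDiv Ω T 0 y z k p =
      ∑ m, det2 (y (edge T k m)) (edgeVec T k m) := by
  rw [sum_flag (T := T) k]
  simp only [sum_edge_nodalDiv hT hΩ]
  have h := congrArg (det2 (z k)) (sum_edgeVec (T := T) k)
  rw [det2_zero_right, Fin.sum_univ_three, det2_add_right, det2_add_right] at h
  simp only [Fin.sum_univ_three, det2_sub_left, Pi.zero_apply, det2_zero_left]
  linarith

omit [Finite ι] in
/-- The divergence of a field that vanishes on the boundary has mean zero. -/
lemma sum_nodalDiv_eq_zero [Fintype ι] (x : E2 → E2) (y : Sym2 E2 → E2) (z : ι → E2)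
    (hx : ∀ k m, edge T k m ∉ intEdges Ω T → y (edge T k m) = 0 ∧ x (src T k m) = 0 ∧
      x (tgt T k m) = 0) :
    ∑ k, ∑ p, |area (cellPts Ω T k p)| * nodalDiv Ω T x y z k p = 0 := by
  -- The edge contributions without the parts involving the incenter and its value: these sum to
  -- zero over a triangle. What remains changes sign when the edge is seen from the other triangle.
  let E : ι × Fin 3 → ℝ := fun η => det2 (y (edge T η.1 η.2)) (edgeVec T η.1 η.2) -
    det2 (x (tgt T η.1 η.2) - x (src T η.1 η.2)) (singularPoint Ω T (edge T η.1 η.2))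
  have hk : ∀ k, ∑ p, |area (cellPts Ω T k p)| * nodalDiv Ω T x y z k p = ∑ m, E (k, m) := by
    intro k
    rw [sum_flag (T := T) k]
    simp only [sum_edge_nodalDiv hT hΩ, E]
    have h := congrArg (det2 (z k)) (sum_edgeVec (T := T) k)
    have h' := congrArg (fun v => det2 v (T k).incenter) (sum_tgt_sub_src (T := T) k x)
    simp only [det2_zero_left, det2_zero_right, Fin.sum_univ_three, det2_add_right,
      det2_add_left] at h h'
    simp only [Fin.sum_univ_three, det2_sub_left (y _), det2_sub_right _ (T k).incenter]
    linarith
  have hE0 : ∀ η : ι × Fin 3, edge T η.1 η.2 ∉ intEdges Ω T → E η = 0 := by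
    rintro ⟨k, m⟩ h
    obtain ⟨h1, h2, h3⟩ := hx k m h
    simp only [E, h1, h2, h3]
    simp
  have hE1 : ∀ k l m m', k ≠ l → edge T k m = edge T l m' → E (k, m) + E (l, m') = 0 := by
    intro k l m m' hkl he
    obtain ⟨h1, h2⟩ := src_eq_tgt_of_edge_eq hT hkl he
    simp only [E, edgeVec_twin hT hkl he, h1, h2, ← he, det2_neg_right, det2_sub_left]
    ring
  simp only [hk]
  rw [← Fintype.sum_prod_type']
  classical
  have hex : ∀ η : ι × Fin 3, edge T η.1 η.2 ∈ intEdges Ω T → ∃ η' : ι × Fin 3,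
      η.1 ≠ η'.1 ∧ edge T η.1 η.2 = edge T η'.1 η'.2 := by
    rintro ⟨k, m⟩ h
    obtain ⟨l, m', h1, h2⟩ := exists_twin hT hΩ h
    exact ⟨(l, m'), h1, h2⟩
  -- The involution that exchanges the two sides of an interior edge and fixes the exterior sides,
  -- where `E` is zero.
  let g : ι × Fin 3 → ι × Fin 3 := fun η =>
    if h : edge T η.1 η.2 ∈ intEdges Ω T then (hex η h).choose else η
  have hg : ∀ η, edge T η.1 η.2 ∈ intEdges Ω T →
      η.1 ≠ (g η).1 ∧ edge T η.1 η.2 = edge T (g η).1 (g η).2 := by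
    intro η h
    simp only [g, dif_pos h]
    exact (hex η h).choose_spec
  have hg' : ∀ η, edge T η.1 η.2 ∉ intEdges Ω T → g η = η := fun η h => dif_neg h
  refine Finset.sum_involution (fun η _ => g η) ?_ ?_ (fun _ _ => Finset.mem_univ _) ?_
  · intro η _
    by_cases h : edge T η.1 η.2 ∈ intEdges Ω T
    · exact hE1 _ _ _ _ (hg η h).1 (hg η h).2
    · rw [hg' η h, hE0 η h, add_zero]
  · intro η _ hne hgη
    by_cases h : edge T η.1 η.2 ∈ intEdges Ω T
    · exact (hg η h).1 (by rw [hgη])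
    · exact hne (hE0 η h)
  · intro η _
    by_cases h : edge T η.1 η.2 ∈ intEdges Ω T
    · obtain ⟨a1, a2⟩ := hg η h
      obtain ⟨b1, b2⟩ := hg (g η) (a2 ▸ h)
      have hk : η.1 = (g (g η)).1 :=
        eq_of_edge_eq hT a1.symm b1 a2.symm b2
      refine Prod.ext hk.symm ?_
      refine edge_injective (T := T) η.1 ?_
      rw [a2, b2, hk]
    · rw [hg' η h, hg' η h]

lemma exists_singularPoint_flag (k : ι) (p : Flag) : ∃ α : ℝ, 0 < α ∧ α < 1 ∧
    singularPoint Ω T (edge T k p.opp) - (T k).points p.1.1 =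
      α • ((T k).points p.1.2 - (T k).points p.1.1) ∧
    singularPoint Ω T (edge T k p.opp) - (T k).points p.1.2 =
      (-(1 - α)) • ((T k).points p.1.2 - (T k).points p.1.1) := by
  obtain ⟨θ, h0, h1, h⟩ :=
    exists_lineMap_of_mem_openEdge (singularPoint_mem_openEdge hT hΩ k p.opp)
  rw [AffineMap.lineMap_apply, vsub_eq_sub, vadd_eq_add] at h
  rcases p.cyclic with ⟨e1, e2⟩ | ⟨e1, e2⟩
  · rw [e1, e2, ← h]
    exact ⟨θ, h0, h1, by module, by module⟩
  · rw [e1, e2, ← h]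
    exact ⟨1 - θ, by linarith, by linarith, by module, by module⟩

/-- The alternating sum of the divergence vanishes at the singular points. -/
lemma thetaVanishes_nodalDiv (x : E2 → E2) (y : Sym2 E2 → E2) (z : ι → E2)
    (hx : ∀ k m, edge T k m ∉ intEdges Ω T → y (edge T k m) = 0 ∧ x (src T k m) = 0 ∧
      x (tgt T k m) = 0) : ThetaVanishes Ω T (nodalDiv Ω T x y z) := by
  constructor
  · intro k l hkl p q h1 h2 _
    have he : edge T k p.opp = edge T l q.opp := by rw [← Flag.edge_eq, ← Flag.edge_eq, h1, h2]
    obtain ⟨α, hα0, hα1, e1, e2⟩ := exists_singularPoint_flag hT hΩ k p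
    obtain ⟨η, hη0, hη1, hη⟩ := singularPoint_eq_lineMap_incenter hT hΩ hkl he
    rw [AffineMap.lineMap_apply, vsub_eq_sub, vadd_eq_add] at hη
    have hdet : det2 ((T k).points p.1.2 - (T k).points p.1.1)
        ((T k).incenter - (T l).incenter) ≠ 0 := by
      have := det2_edge_incenters_ne_zero hT hkl he
      rcases p.cyclic with ⟨a1, a2⟩ | ⟨a1, a2⟩
      · rwa [a1, a2]
      · rw [a1, a2, ← neg_sub, det2_neg_left]
        exact neg_ne_zero.2 this
    have e3 : (T k).incenter - singularPoint Ω T (edge T k p.opp) =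
        η • ((T k).incenter - (T l).incenter) := by rw [hη]; module
    have e4 : (T l).incenter - singularPoint Ω T (edge T k p.opp) =
        (-(1 - η)) • ((T k).incenter - (T l).incenter) := by rw [hη]; module
    have hα : (-(1 - α)) ≠ 0 := by linarith
    have hη' : (-(1 - η)) ≠ 0 := by linarith
    change nodalDiv Ω T x y z k p - nodalDiv Ω T x y z k p.swap +
      nodalDiv Ω T x y z l q.swap - nodalDiv Ω T x y z l q = 0
    unfold nodalDiv
    -- The four cells use the same directions, with factors `α` or `-(1 - α)` along the edge and `η`
    -- or `-(1 - η)` along the segment of incenters. Each of the four directional terms occurs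
    -- twice, with opposite signs.
    rw [cellDiv_eq_split hα0.ne' hη0.ne' hdet (p := cellPts Ω T k p) e1 e3,
      cellDiv_eq_split hα hη0.ne' hdet (p := cellPts Ω T k p.swap)
        (by simp only [cellPts, Flag.opp_swap]; exact e2)
        (by simp only [cellPts, Flag.opp_swap]; exact e3),
      cellDiv_eq_split hα hη' hdet (p := cellPts Ω T l q.swap)
        (by simp only [cellPts, Flag.opp_swap, ← he]; rw [← e2, h2]; rfl)
        (by simp only [cellPts, Flag.opp_swap, ← he]; exact e4),
      cellDiv_eq_split hα0.ne' hη' hdet (p := cellPts Ω T l q)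
        (by simp only [cellPts, ← he]; rw [← e1, h1]; rfl)
        (by simp only [cellPts, ← he]; exact e4)]
    have s1 : (T l).points q.swap.1.1 = (T k).points p.1.2 := h2.symm
    have s2 : (T k).points p.swap.1.1 = (T k).points p.1.2 := rfl
    simp only [Flag.opp_swap, ← he, ← h1, s1, s2, Matrix.cons_val]
    ring
  · intro k p h
    rw [Flag.edge_eq] at h
    obtain ⟨g1, g2, g3⟩ := hx k p.opp fun hi => hi.2 h.2
    have g : x ((T k).points p.1.1) = 0 ∧ x ((T k).points p.1.2) = 0 := by
      rcases eq_stdFlag_or (T := T) k p with hp | hp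
      · rw [hp, (points_stdFlag k _).1, (points_stdFlag k _).2]
        exact ⟨g2, g3⟩
      · rw [hp]
        change x ((T k).points (stdFlag T k p.opp).1.2) = 0 ∧
          x ((T k).points (stdFlag T k p.opp).1.1) = 0
        rw [(points_stdFlag k _).1, (points_stdFlag k _).2]
        exact ⟨g3, g2⟩
    obtain ⟨α, hα0, hα1, e1, e2⟩ := exists_singularPoint_flag hT hΩ k p
    have hα : (-(1 - α)) ≠ 0 := by linarith
    have hdet : det2 ((T k).points p.1.2 - (T k).points p.1.1)
        ((T k).incenter - singularPoint Ω T (edge T k p.opp)) ≠ 0 := by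
      intro h0
      apply area_cellPts_ne_zero hT hΩ k p
      have e3 : (T k).incenter - (T k).points p.1.1 =
          ((T k).incenter - singularPoint Ω T (edge T k p.opp)) +
            α • ((T k).points p.1.2 - (T k).points p.1.1) := by rw [← e1]; abel
      simp only [area, cellPts, Matrix.cons_val]
      rw [e3, e1, det2_smul_left, det2_add_right, h0, det2_smul_right, det2_self]
      ring
    change nodalDiv Ω T x y z k p - nodalDiv Ω T x y z k p.swap = 0
    unfold nodalDiv
    -- On an exterior edge the field vanishes, so the term along the edge is zero and both halves
    -- keep the same term towards the incenter.
    rw [cellDiv_eq_split hα0.ne' one_ne_zero hdet (p := cellPts Ω T k p) e1 (one_smul ℝ _).symm,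
      cellDiv_eq_split hα one_ne_zero hdet (p := cellPts Ω T k p.swap)
        (by simp only [cellPts, Flag.opp_swap]; exact e2)
        (by simp only [cellPts, Flag.opp_swap]; exact (one_smul ℝ _).symm)]
    have s2 : (T k).points p.swap.1.1 = (T k).points p.1.2 := rfl
    simp only [Flag.opp_swap, s2, g1, g.1, g.2, Matrix.cons_val, sub_self, det2_zero_left]
    ring

end Mesh

/-! ### Solving for the nodal values -/

section Mesh

variable {Ω : Set E2} {ι : Type*} {T : ι → Affine.Triangle ℝ E2}

section
variable (hT : IsConformingTriangulation Ω T) (hΩ : interior (closure Ω) = Ω) [Finite ι]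
include hT hΩ

/-- Piecewise constants with the same integral over the two subtriangles at each edge and the same
jumps there agree. -/
lemma eq_of_sum_eq_of_sub_eq {k : ι} {m : Fin 3} {c d : Flag → ℝ}
    (h1 : |area (cellPts Ω T k (stdFlag T k m))| * c (stdFlag T k m) +
        |area (cellPts Ω T k (stdFlag T k m).swap)| * c (stdFlag T k m).swap =
      |area (cellPts Ω T k (stdFlag T k m))| * d (stdFlag T k m) +
        |area (cellPts Ω T k (stdFlag T k m).swap)| * d (stdFlag T k m).swap)
    (h2 : c (stdFlag T k m) - c (stdFlag T k m).swap =
      d (stdFlag T k m) - d (stdFlag T k m).swap) :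
    c (stdFlag T k m) = d (stdFlag T k m) ∧ c (stdFlag T k m).swap = d (stdFlag T k m).swap := by
  have p1 := abs_area_cellPts_pos hT hΩ k (stdFlag T k m)
  have p2 := abs_area_cellPts_pos hT hΩ k (stdFlag T k m).swap
  have : (|area (cellPts Ω T k (stdFlag T k m))| + |area (cellPts Ω T k (stdFlag T k m).swap)|) *
      (c (stdFlag T k m) - d (stdFlag T k m)) = 0 := by
    linear_combination h1 + |area (cellPts Ω T k (stdFlag T k m).swap)| * h2
  have h3 := (mul_eq_zero.1 this).resolve_left (by positivity)
  exact ⟨by linarith, by linarith⟩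

omit hΩ [Finite ι] in
lemma swap_stdFlag_twin {k l : ι} {m m' : Fin 3} (hkl : k ≠ l) (he : edge T k m = edge T l m') :
    (T k).points (stdFlag T k m).1.1 = (T l).points (stdFlag T l m').swap.1.1 ∧
    (T k).points (stdFlag T k m).1.2 = (T l).points (stdFlag T l m').swap.1.2 := by
  obtain ⟨h1, h2⟩ := src_eq_tgt_of_edge_eq hT hkl he
  change _ = (T l).points (stdFlag T l m').1.2 ∧ _ = (T l).points (stdFlag T l m').1.1
  rw [(points_stdFlag k m).1, (points_stdFlag k m).2, (points_stdFlag l m').1,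
    (points_stdFlag l m').2, h1, h2]
  exact ⟨rfl, rfl⟩

omit hT hΩ [Finite ι] in
lemma det2_incenter_src_ne_zero (k : ι) (m : Fin 3) :
    det2 (edgeVec T k m) ((T k).incenter - src T k m) ≠ 0 :=
  (det2_edgeVec_incenter_pos k m).ne'

end

section solve

variable (hT : IsConformingTriangulation Ω T) (hΩ : interior (closure Ω) = Ω)
    [Fintype ι] {z₀ : E2} (hz₀ : z₀ ∈ extVertices Ω T)
    {G : SimpleGraph (treeVertices Ω T z₀)} (hG : G ≤ treeGraph Ω T z₀) (hGtree : G.IsTree)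
    (hsc : IsSimplyConnected Ω)
include hT hΩ hz₀ hG hGtree hsc

/-- A divergence-free field that vanishes at the macro-vertices and has no flux through the edges of
the tree is zero. -/
lemma eq_zero_of_nodalDiv_eq_zero {y : Sym2 E2 → E2} {z : ι → E2}
    (hy : ∀ k m, edge T k m ∉ intEdges Ω T → y (edge T k m) = 0)
    (hyt : ∀ k m, edge T k m ∈ Sym2.map Subtype.val '' G.edgeSet →
      det2 (y (edge T k m)) (edgeVec T k m) = 0)
    (h : ∀ k p, nodalDiv Ω T 0 y z k p = 0) :
    (∀ k m, y (edge T k m) = 0) ∧ ∀ k, z k = 0 := by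
  have hF := flux_eq_zero hT hΩ hz₀ hG hGtree hsc
    (fun k m => det2 (y (edge T k m)) (edgeVec T k m)) (fun k l m m' hkl he => by
      rw [edgeVec_twin hT hkl he, det2_neg_right, he]) (fun k m hm => by
      by_cases hi : edge T k m ∈ intEdges Ω T
      · exact hyt k m (by by_contra hc; exact hm ⟨hi, hc⟩)
      · simp [hy k m hi]) (fun k => by
      rw [← sum_nodalDiv_zero hT hΩ y z k]
      simp [h])
  -- Without fluxes and divergence, the integral over the two cells at each edge shows that `z k` is
  -- parallel to every side.
  have hz : ∀ k, z k = 0 := by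
    intro k
    have h1 : ∀ m, det2 (z k) (edgeVec T k m) = 0 := by
      intro m
      have := sum_edge_nodalDiv hT hΩ 0 y z k m
      rw [h, h, det2_sub_left, hF] at this
      simpa using this
    exact eq_zero_of_det2 (det2_edgeVec_ne_zero k) (h1 0) (h1 1)
  refine ⟨fun k m => ?_, hz⟩
  -- The second determinant comes from the vanishing divergence on the first half of the edge, where
  -- the field is now zero except at the singular point.
  refine eq_zero_of_det2 (det2_incenter_src_ne_zero (T := T) k m) (hF k m) ?_
  have h1 := cellDiv_mul_area (area_cellPts_ne_zero hT hΩ k (stdFlag T k m))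
    ![0, y (edge T k m), z k]
  have h2 := h k (stdFlag T k m)
  rw [nodalDiv, stdFlag_opp] at h2
  change cellDiv _ ![0, y (edge T k m), z k] = 0 at h2
  rw [h2, hz k, mul_zero] at h1
  simpa [cellPts, (points_stdFlag k m).1] using h1.symm

/-- Every piecewise constant of mean zero whose alternating sums at the singular points vanish is the
divergence of a field that vanishes at the macro-vertices and has no flux through the tree. -/
lemma exists_nodalDiv_eq {c : ι → Flag → ℝ} (hc : ThetaVanishes Ω T c)
    (hc0 : ∑ k, ∑ p, |area (cellPts Ω T k p)| * c k p = 0) :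
    ∃ (y : Sym2 E2 → E2) (z : ι → E2),
      (∀ k m, edge T k m ∉ intEdges Ω T → y (edge T k m) = 0) ∧
      (∀ k m, edge T k m ∈ Sym2.map Subtype.val '' G.edgeSet →
        det2 (y (edge T k m)) (edgeVec T k m) = 0) ∧
      nodalDiv Ω T 0 y z = c := by
  classical
  obtain ⟨F, hF1, hF2, hF3⟩ := exists_flux hT hΩ hz₀ hG hGtree hsc _ hc0
  -- Twice the integral of `c` over the two cells at the edge.
  let M : ι → Fin 3 → ℝ := fun k m =>
    |area (cellPts Ω T k (stdFlag T k m))| * c k (stdFlag T k m) +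
      |area (cellPts Ω T k (stdFlag T k m).swap)| * c k (stdFlag T k m).swap
  have hz : ∀ k, ∃ z, ∀ m, det2 z (edgeVec T k m) = F k m - M k m := by
    intro k
    obtain ⟨z, h0, h1⟩ := exists_det2_eq (det2_edgeVec_ne_zero (T := T) k)
      (F k 0 - M k 0) (F k 1 - M k 1)
    -- Two equations determine `z`; the third follows because the edge vectors and the differences
    -- `F k m - M k m` both sum to zero over `m`.
    have h2 : det2 z (edgeVec T k 2) = F k 2 - M k 2 := by
      have e1 := congrArg (det2 z) (sum_edgeVec (T := T) k)
      rw [det2_zero_right, Fin.sum_univ_three, det2_add_right, det2_add_right] at e1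
      have e2 := hF3 k
      rw [sum_flag (T := T) k, Fin.sum_univ_three, Fin.sum_univ_three] at e2
      simp only [M] at h0 h1 ⊢
      linarith
    refine ⟨z, fun m => ?_⟩
    fin_cases m
    · exact h0
    · exact h1
    · exact h2
  choose z hz using hz
  -- For each interior edge one adjacent triangle is chosen; the flux and the divergence on its
  -- first cell at the edge determine the value at the singular point.
  have hrep : ∀ e : Sym2 E2, ∃ ye : E2, (e ∉ intEdges Ω T → ye = 0) ∧ (e ∈ intEdges Ω T →
      ∃ k m, edge T k m = e ∧ det2 ye (edgeVec T k m) = F k m ∧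
        cellDiv (cellPts Ω T k (stdFlag T k m)) ![0, ye, z k] = c k (stdFlag T k m)) := by
    intro e
    by_cases he : e ∈ intEdges Ω T
    · obtain ⟨k, m, hkm⟩ := exists_edge_of_mem_edgeSet he.1
      have ha := area_cellPts_ne_zero hT hΩ k (stdFlag T k m)
      obtain ⟨ye, h1, h2⟩ := exists_det2_eq (det2_incenter_src_ne_zero (T := T) k m) (F k m)
        (area (cellPts Ω T k (stdFlag T k m)) * c k (stdFlag T k m) -
          det2 (singularPoint Ω T (edge T k m) - src T k m) (z k))
      refine ⟨ye, fun h => absurd he h, fun _ => ⟨k, m, hkm, h1, ?_⟩⟩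
      apply mul_left_cancel₀ ha
      rw [cellDiv_mul_area ha]
      simp only [cellPts, (points_stdFlag k m).1, stdFlag_opp, Matrix.cons_val, sub_zero] at h2 ⊢
      rw [h2]
      ring
    · exact ⟨0, fun _ => rfl, fun h => absurd h he⟩
  choose y hy0 hy1 using hrep
  have hdet : ∀ k m, det2 (y (edge T k m)) (edgeVec T k m) = F k m := by
    intro k m
    by_cases hi : edge T k m ∈ intEdges Ω T
    · obtain ⟨l, m', he, h1, -⟩ := hy1 _ hi
      by_cases hkl : k = l
      · subst hkl
        obtain rfl := edge_injective k he
        exact h1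
      · rw [edgeVec_twin hT (Ne.symm hkl) he, det2_neg_right, h1, hF1 l k m' m (Ne.symm hkl) he]
    · rw [hy0 _ hi, hF2 k m fun h => hi h.1, det2_zero_left]
  have hsum : ∀ k m, |area (cellPts Ω T k (stdFlag T k m))| *
        nodalDiv Ω T 0 y z k (stdFlag T k m) + |area (cellPts Ω T k (stdFlag T k m).swap)| *
          nodalDiv Ω T 0 y z k (stdFlag T k m).swap = M k m := by
    intro k m
    rw [sum_edge_nodalDiv hT hΩ, det2_sub_left, hdet, hz]
    simp
  have hθ : ThetaVanishes Ω T (nodalDiv Ω T 0 y z) :=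
    thetaVanishes_nodalDiv hT hΩ 0 y z fun k m h => ⟨hy0 _ h, rfl, rfl⟩
  have hkey : ∀ k m, nodalDiv Ω T 0 y z k (stdFlag T k m) = c k (stdFlag T k m) ∧
      nodalDiv Ω T 0 y z k (stdFlag T k m).swap = c k (stdFlag T k m).swap := by
    -- In the chosen triangle the integral over the two cells fixes the divergence on the second
    -- one.
    have hrepr : ∀ k m, cellDiv (cellPts Ω T k (stdFlag T k m)) ![0, y (edge T k m), z k] =
        c k (stdFlag T k m) → nodalDiv Ω T 0 y z k (stdFlag T k m) = c k (stdFlag T k m) ∧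
      nodalDiv Ω T 0 y z k (stdFlag T k m).swap = c k (stdFlag T k m).swap := by
      intro k m h
      have h1 : nodalDiv Ω T 0 y z k (stdFlag T k m) = c k (stdFlag T k m) := by
        rw [nodalDiv, stdFlag_opp]
        exact h
      refine ⟨h1, ?_⟩
      have h2 := hsum k m
      simp only [M, h1] at h2
      exact mul_left_cancel₀ (abs_area_cellPts_pos hT hΩ k _).ne' (add_left_cancel h2)
    intro k m
    by_cases hi : edge T k m ∈ intEdges Ω T
    · obtain ⟨l, m', he, -, h1⟩ := hy1 _ hi
      rw [← he] at h1
      by_cases hkl : k = l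
      · subst hkl
        obtain rfl := edge_injective k he
        exact hrepr _ _ h1
      -- Across the edge, `c` and the divergence satisfy the same relation at the singular point and
      -- agree on the chosen side. So they have the same jump between the two cells here, besides
      -- the same integral.
      · obtain ⟨g1, g2⟩ := hrepr _ _ h1
        obtain ⟨t1, t2⟩ := swap_stdFlag_twin hT hkl he.symm
        have hi' : s((T k).points (stdFlag T k m).1.1, (T k).points (stdFlag T k m).1.2) ∈
            intEdges Ω T := by rwa [Flag.edge_eq, stdFlag_opp]
        have a1 := hc.1 k l hkl (stdFlag T k m) (stdFlag T l m').swap t1 t2 hi'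
        have a2 := hθ.1 k l hkl (stdFlag T k m) (stdFlag T l m').swap t1 t2 hi'
        change c k (stdFlag T k m) - c k (stdFlag T k m).swap + c l (stdFlag T l m') -
          c l (stdFlag T l m').swap = 0 at a1
        change nodalDiv Ω T 0 y z k (stdFlag T k m) - nodalDiv Ω T 0 y z k (stdFlag T k m).swap +
          nodalDiv Ω T 0 y z l (stdFlag T l m') -
          nodalDiv Ω T 0 y z l (stdFlag T l m').swap = 0 at a2
        exact eq_of_sum_eq_of_sub_eq hT hΩ (hsum k m) (by linarith)
    · have he : s((T k).points (stdFlag T k m).1.1, (T k).points (stdFlag T k m).1.2) ∈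
          extEdges Ω T := by
        rw [Flag.edge_eq, stdFlag_opp]
        exact (edge_intEdges_or_extEdges k m).resolve_left hi
      have a1 := hc.2 k (stdFlag T k m) he
      have a2 := hθ.2 k (stdFlag T k m) he
      change c k (stdFlag T k m) - c k (stdFlag T k m).swap = 0 at a1
      change nodalDiv Ω T 0 y z k (stdFlag T k m) -
        nodalDiv Ω T 0 y z k (stdFlag T k m).swap = 0 at a2
      exact eq_of_sum_eq_of_sub_eq hT hΩ (hsum k m) (by linarith)
  refine ⟨y, z, fun k m => hy0 _, fun k m h => ?_, ?_⟩
  · rw [hdet]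
    exact hF2 k m fun h' => h'.2 h
  · funext k p
    rcases eq_stdFlag_or (T := T) k p with hp | hp
    · rw [hp]; exact (hkey _ _).1
    · rw [hp]; exact (hkey _ _).2

end solve
end Mesh

lemma sum_subtype_ite {α M : Type*} [AddCommMonoid M] [DecidableEq α] {s : Set α} [Fintype s]
    [∀ a, Decidable (a ∈ s)] (f : s → M) (a : α) :
    ∑ e : s, (if a = e then f e else 0) = if h : a ∈ s then f ⟨a, h⟩ else 0 := by
  by_cases h : a ∈ s
  · rw [dif_pos h, Finset.sum_eq_single ⟨a, h⟩]
    · simp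
    · intro e _ he
      exact if_neg fun h' => he (Subtype.ext h'.symm)
    · simp
  · rw [dif_neg h]
    refine Finset.sum_eq_zero fun e _ => if_neg fun h' : a = e => h (h' ▸ e.2)

/-! ### The basis functions and their nodal values -/

section Mesh

variable {Ω : Set E2} {ι : Type*} {T : ι → Affine.Triangle ℝ E2} {tree : Set (Sym2 E2)}
    {n t : Sym2 E2 → E2}

section
variable (hT : IsConformingTriangulation Ω T) (hΩ : interior (closure Ω) = Ω) [Finite ι]
include hT hΩ

lemma ext0_eq_sum_bary {v : C(closure Ω, E2)} (hv : v ∈ Xh Ω T) {k : ι} {p : Flag} {x : E2}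
    (hx : x ∈ cell Ω T k p) :
    ext0 v x = ∑ i, bary (cellPts Ω T k p) i x • ext0 v (cellPts Ω T k p i) := by
  obtain ⟨A, hA⟩ := hv k p
  have h : ∀ y ∈ cell Ω T k p, ext0 v y = A y := fun y hy => by
    rw [ext0_apply v (cell_subset_closure hT hΩ k p hy)]
    exact hA _ hy
  rw [h x hx, affineMap_eq_bary A (area_cellPts_ne_zero hT hΩ k p) x]
  exact Finset.sum_congr rfl fun i _ => by rw [h _ (cellPts_mem_cell k p i)]

lemma divergence_eq_fieldDiv {v : C(closure Ω, E2)} (hv : v ∈ Xh Ω T) {k : ι} {p : Flag} {x : E2}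
    (hx : x ∈ interior (cell Ω T k p)) : divergence v x = fieldDiv Ω T (ext0 v) k p := by
  set P := cellPts Ω T k p with hP
  have hb : ∀ j, HasFDerivAt (bary P j)
      (LinearMap.toContinuousLinearMap (bary P j).linear) x := by
    intro j
    have h := (LinearMap.toContinuousLinearMap (bary P j).linear).hasFDerivAt (x := x)
    have h' := h.add_const (bary P j 0)
    refine h'.congr_of_eventuallyEq (Filter.Eventually.of_forall fun y => ?_)
    exact congrFun (AffineMap.decomp (bary P j)) y
  have hd : HasFDerivAt (ext0 v) (∑ j, (LinearMap.toContinuousLinearMap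
      (bary P j).linear).smulRight (ext0 v (P j))) x := by
    have h := HasFDerivAt.fun_sum (u := Finset.univ) fun j _ =>
      (hb j).smul_const (ext0 v (P j))
    refine h.congr_of_eventuallyEq ?_
    filter_upwards [isOpen_interior.mem_nhds hx] with y hy
    exact ext0_eq_sum_bary hT hΩ hv (interior_subset hy)
  have h := divergence_affine P fun j => ext0 v (P j)
  rw [divergence, hd.fderiv]
  have e : (fun j => ext0 v (P j)) = ![ext0 v ((T k).points p.1.1),
      ext0 v (singularPoint Ω T (edge T k p.opp)), ext0 v (T k).incenter] := by
    funext j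
    fin_cases j <;> rfl
  rw [e] at h
  rw [fieldDiv, nodalDiv, ← hP, ← h]
  refine Finset.sum_congr rfl fun i _ => ?_
  simp

omit hT hΩ [Finite ι] in
lemma ext0_eq_zero_of_mem_Xh0 {v : C(closure Ω, E2)} (hv : v ∈ Xh0 Ω T) {x : E2}
    (hx : x ∈ frontier Ω) : ext0 v x = 0 := by
  rw [ext0_apply v (frontier_subset_closure hx)]
  exact hv.2 _ hx

lemma nodal_eq_zero_of_mem_Xh0 {v : C(closure Ω, E2)} (hv : v ∈ Xh0 Ω T) (k : ι) (m : Fin 3)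
    (h : edge T k m ∉ intEdges Ω T) : ext0 v (singularPoint Ω T (edge T k m)) = 0 ∧
      ext0 v (src T k m) = 0 ∧ ext0 v (tgt T k m) = 0 := by
  have he := ((edge_intEdges_or_extEdges (Ω := Ω) (T := T) k m).resolve_left h).2
  refine ⟨ext0_eq_zero_of_mem_Xh0 hv (he (singularPoint_mem_openEdge hT hΩ k m).1),
    ext0_eq_zero_of_mem_Xh0 hv (he ?_), ext0_eq_zero_of_mem_Xh0 hv (he ?_)⟩
  · rw [edge_eq_src_tgt, edgeHull_mk]
    exact left_mem_segment _ _ _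
  · rw [edge_eq_src_tgt, edgeHull_mk]
    exact right_mem_segment _ _ _

lemma isNodal_hat_basisNode (i : BasisIndex Ω T tree) :
    IsNodal Ω T (basisNode Ω T i) (hat Ω T (basisNode Ω T i)) := by
  rcases i with e | e | k | k
  · exact isNodal_hat_singularPoint hT hΩ e.2.1
  · exact isNodal_hat_singularPoint hT hΩ e.2
  · exact isNodal_hat_incenter hT hΩ k
  · exact isNodal_hat_incenter hT hΩ k

lemma basisFun_mem_Xh (i : BasisIndex Ω T tree) : basisFun Ω T n t i ∈ Xh Ω T := by
  intro k p
  obtain ⟨A, hA⟩ := (isNodal_hat_basisNode hT hΩ i).1 k p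
  refine ⟨(LinearMap.toSpanSingleton ℝ E2 (basisDir Ω T n t i)).toAffineMap.comp A, fun x hx => ?_⟩
  have := hA x hx
  change hat Ω T (basisNode Ω T i) x • basisDir Ω T n t i = _
  rw [this]
  simp

lemma ext0_basisFun_apply (i : BasisIndex Ω T tree) {z : E2} (hz : z ∈ splitVertices Ω T) :
    (z = basisNode Ω T i → ext0 (basisFun Ω T n t i) z = basisDir Ω T n t i) ∧
      (z ≠ basisNode Ω T i → ext0 (basisFun Ω T n t i) z = 0) := by
  have hzc : z ∈ closure Ω := by
    obtain ⟨k, p, h⟩ := hz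
    exact cell_subset_closure hT hΩ k p (subset_convexHull ℝ _ h)
  rw [ext0_apply _ hzc]
  change (_ → hat Ω T (basisNode Ω T i) ⟨z, hzc⟩ • basisDir Ω T n t i = _) ∧
    (_ → hat Ω T (basisNode Ω T i) ⟨z, hzc⟩ • basisDir Ω T n t i = _)
  obtain ⟨h1, h2⟩ := (isNodal_hat_basisNode hT hΩ i).2 ⟨z, hzc⟩ hz
  exact ⟨fun h => by rw [h1 h, one_smul], fun h => by rw [h2 h, zero_smul]⟩

omit hT hΩ [Finite ι] in
lemma cellPts_mem_splitVertices (k : ι) (p : Flag) (i : Fin 3) :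
    cellPts Ω T k p i ∈ splitVertices Ω T := ⟨k, p, cellPts_mem_cellVertices k p i⟩

lemma ext0_basisFun_cellPts_eq_zero {i : BasisIndex Ω T tree} {k : ι} {p : Flag}
    (h : basisNode Ω T i ∉ cellVertices Ω T k p) (j : Fin 3) :
    ext0 (basisFun Ω T n t i) (cellPts Ω T k p j) = 0 := by
  refine (ext0_basisFun_apply hT hΩ i (cellPts_mem_splitVertices k p j)).2 fun h' => ?_
  exact h (h' ▸ cellPts_mem_cellVertices k p j)

lemma basisFun_apply_eq_zero (i : BasisIndex Ω T tree) (x : closure Ω)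
    (hx : (x : E2) ∉ star Ω T (basisNode Ω T i)) : basisFun Ω T n t i x = 0 := by
  obtain ⟨k, p, hxc⟩ := exists_mem_cell hT hΩ x.2
  have h : basisNode Ω T i ∉ cellVertices Ω T k p := fun h => hx ⟨k, p, h, hxc⟩
  rw [← ext0_apply _ x.2, ext0_eq_sum_bary hT hΩ (basisFun_mem_Xh hT hΩ i) hxc]
  simp [ext0_basisFun_cellPts_eq_zero hT hΩ h]

lemma fieldDiv_basisFun_eq_zero {i : BasisIndex Ω T tree} {k : ι} {p : Flag}
    (h : basisNode Ω T i ∉ cellVertices Ω T k p) :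
    fieldDiv Ω T (ext0 (basisFun Ω T n t i)) k p = 0 := by
  have h' := ext0_basisFun_cellPts_eq_zero (n := n) (t := t) hT hΩ h
  have h0 : ext0 (basisFun Ω T n t i) ((T k).points p.1.1) = 0 := h' 0
  have h1 : ext0 (basisFun Ω T n t i) (singularPoint Ω T (edge T k p.opp)) = 0 := h' 1
  have h2 : ext0 (basisFun Ω T n t i) (T k).incenter = 0 := h' 2
  rw [fieldDiv, nodalDiv, h0, h1, h2]
  simp [cellDiv]

omit hT hΩ [Finite ι] in
lemma exists_flag_fst (i : Fin 3) : ∃ p : Flag, p.1.1 = i :=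
  ⟨⟨(i, i + 1), (fin3_add_ne i).1.symm⟩, rfl⟩

omit [Finite ι] in
lemma points_ne_basisNode [Finite ι] (i : BasisIndex Ω T tree) (k : ι) (r : Fin 3) :
    (T k).points r ≠ basisNode Ω T i := by
  have hs : ∀ e ∈ intEdges Ω T, (T k).points r ≠ singularPoint Ω T e := by
    intro e he
    obtain ⟨l, m, rfl⟩ := exists_edge_of_mem_edgeSet he.1
    exact (vertex_ne_of_mem_openEdge hT (singularPoint_mem_openEdge hT hΩ l m)).symm
  rcases i with e | e | l | l
  · exact hs _ e.2.1
  · exact hs _ e.2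
  · exact incenter_ne_points hT
  · exact incenter_ne_points hT

lemma ext0_basisFun_points (i : BasisIndex Ω T tree) (k : ι) (r : Fin 3) :
    ext0 (basisFun Ω T n t i) ((T k).points r) = 0 := by
  obtain ⟨p, rfl⟩ := exists_flag_fst r
  refine (ext0_basisFun_apply hT hΩ i (cellPts_mem_splitVertices k p 0)).2 ?_
  exact points_ne_basisNode hT hΩ i k _

lemma ext0_basisFun_singularPoint_ext (i : BasisIndex Ω T tree) {k : ι} {p : Flag}
    (h : edge T k p.opp ∉ intEdges Ω T) :
    ext0 (basisFun Ω T n t i) (singularPoint Ω T (edge T k p.opp)) = 0 := by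
  have hs : ∀ e ∈ intEdges Ω T, singularPoint Ω T (edge T k p.opp) ≠ singularPoint Ω T e := by
    intro e he heq
    obtain ⟨l, m, rfl⟩ := exists_edge_of_mem_edgeSet he.1
    exact h (singularPoint_injective hT hΩ heq ▸ he)
  have hi : ∀ l, singularPoint Ω T (edge T k p.opp) ≠ (T l).incenter := fun l =>
    incenter_ne_of_mem_openEdge hT (singularPoint_mem_openEdge hT hΩ k _)
  have := ext0_basisFun_apply (n := n) (t := t) hT hΩ i (cellPts_mem_splitVertices k p 1)
  refine this.2 ?_
  rcases i with e | e | l | l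
  · exact hs _ e.2.1
  · exact hs _ e.2
  · exact hi l
  · exact hi l

/-- A boundary point lies on a side of its macro-triangle. It is a vertex or lies inside an exterior
edge; in the latter case only macro-vertices and the singular point of that edge can carry weight in
its cell, and the function vanishes there. -/
lemma basisFun_mem_Xh0 (i : BasisIndex Ω T tree) : basisFun Ω T n t i ∈ Xh0 Ω T := by
  refine ⟨basisFun_mem_Xh hT hΩ i, fun x hx => ?_⟩
  obtain ⟨k, p, hxc⟩ := exists_mem_cell hT hΩ x.2
  have hxΩ : (x : E2) ∉ Ω := fun h => (mem_domain_iff hΩ x.2).1 h hx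
  have hxk := cell_subset_hull hT hΩ k p hxc
  obtain ⟨m, hm⟩ : ∃ m, bc T k m x = 0 := by
    by_contra! hc
    refine hxΩ (interior_hull_subset hT hΩ k (mem_interior_hull.2 fun m => ?_))
    exact lt_of_le_of_ne (mem_hull.1 hxk m) (hc m).symm
  have hxe : (x : E2) ∈ edgeHull (edge T k m) := mem_edgeHull_edge.2 ⟨hxk, hm⟩
  rw [← ext0_apply _ x.2]
  by_cases hv : (x : E2) ∈ edge T k m
  · rcases Sym2.mem_iff.1 hv with h | h
    · rw [h]; exact ext0_basisFun_points hT hΩ i k _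
    · rw [h]; exact ext0_basisFun_points hT hΩ i k _
  have hext : edge T k m ∉ intEdges Ω T := fun h =>
    hxΩ (openEdge_subset_of_intEdges hT hΩ h ⟨hxe, hv⟩)
  have hcoord := bc_eq_cell_coords hT hΩ k p x m
  rw [hm] at hcoord
  have hnn := mem_cell_iff hT hΩ |>.1 hxc
  have h1 := mem_hull.1 (edgeHull_subset_hull k _ (singularPoint_mem_openEdge hT hΩ k p.opp).1) m
  have h2 : 0 < bc T k m (T k).incenter := bary_incenter_pos _ m
  have a0 : 0 ≤ bary (cellPts Ω T k p) 0 x * (if m = p.1.1 then (1 : ℝ) else 0) :=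
    mul_nonneg (hnn 0) (by split_ifs <;> norm_num)
  have a1 := mul_nonneg (hnn 1) h1
  have a2 := mul_nonneg (hnn 2) h2.le
  -- Coordinate `m` is a sum of nonnegative terms equal to zero, so each term vanishes; the
  -- incenter's coordinate is positive, hence its weight is zero.
  have b2 : bary (cellPts Ω T k p) 2 x = 0 :=
    (mul_eq_zero.1 (by linarith : bary (cellPts Ω T k p) 2 x * bc T k m (T k).incenter = 0)).resolve_right
      h2.ne'
  have b1 : bary (cellPts Ω T k p) 1 x •
      ext0 (basisFun Ω T n t i) (singularPoint Ω T (edge T k p.opp)) = 0 := by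
    rcases mul_eq_zero.1 (by linarith : bary (cellPts Ω T k p) 1 x *
      bc T k m (singularPoint Ω T (edge T k p.opp)) = 0) with h | h
    · rw [h, zero_smul]
    · have : m = p.opp := by
        by_contra hne
        exact (bc_singularPoint_pos hT hΩ hne).ne' h
      rw [ext0_basisFun_singularPoint_ext hT hΩ i (this ▸ hext), smul_zero]
  rw [ext0_eq_sum_bary hT hΩ (basisFun_mem_Xh hT hΩ i) hxc, Fin.sum_univ_three]
  have e0 : ext0 (basisFun Ω T n t i) (cellPts Ω T k p 0) = 0 := ext0_basisFun_points hT hΩ i k _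
  rw [e0, b2, smul_zero, zero_smul, zero_add, add_zero]
  exact b1

end

section coeff

open Classical in
/-- The value at the singular point of an edge of a combination of the basis functions. -/
def edgeValue (n t : Sym2 E2 → E2) (x : BasisIndex Ω T tree → ℝ) (e : Sym2 E2) : E2 :=
  (if h : e ∈ intEdges Ω T \ tree then x (.inl ⟨e, h⟩) • n e else 0) +
    (if h : e ∈ intEdges Ω T then x (.inr (.inl ⟨e, h⟩)) • t e else 0)

/-- The value at an incenter of a combination of the basis functions. -/
def centerValue (x : BasisIndex Ω T tree → ℝ) (k : ι) : E2 :=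
  !₂[x (.inr (.inr (.inl k))), x (.inr (.inr (.inr k)))]

variable (hT : IsConformingTriangulation Ω T) (hΩ : interior (closure Ω) = Ω) [Fintype ι]
    [Fintype (intEdges Ω T)] [Fintype ↥(intEdges Ω T \ tree)]
include hT hΩ

omit hT hΩ in
lemma ext0_sum (S : BasisIndex Ω T tree → C(closure Ω, E2)) (x : BasisIndex Ω T tree → ℝ) {z : E2}
    (hz : z ∈ closure Ω) : ext0 (∑ i, x i • S i) z = ∑ i, x i • ext0 (S i) z := by
  rw [ext0_apply _ hz, ContinuousMap.coe_sum, Finset.sum_apply]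
  exact Finset.sum_congr rfl fun i _ => by rw [ext0_apply _ hz]; rfl

lemma ext0_sum_points (x : BasisIndex Ω T tree → ℝ) (k : ι) (r : Fin 3) :
    ext0 (∑ i, x i • basisFun Ω T n t i) ((T k).points r) = 0 := by
  rw [ext0_sum _ _ (hull_subset_closure hT k (points_mem_hull k r))]
  simp [ext0_basisFun_points hT hΩ]

open Classical in
lemma ext0_sum_singularPoint (x : BasisIndex Ω T tree → ℝ) (k : ι) (p : Flag) :
    ext0 (∑ i, x i • basisFun Ω T n t i) (singularPoint Ω T (edge T k p.opp)) =
      edgeValue n t x (edge T k p.opp) := by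
  have hv := cellPts_mem_splitVertices (Ω := Ω) (T := T) k p 1
  change singularPoint Ω T (edge T k p.opp) ∈ _ at hv
  have hs : ∀ e ∈ intEdges Ω T, (singularPoint Ω T (edge T k p.opp) = singularPoint Ω T e ↔
      edge T k p.opp = e) := by
    intro e he
    obtain ⟨l, m, rfl⟩ := exists_edge_of_mem_edgeSet he.1
    exact ⟨fun h => singularPoint_injective hT hΩ h, fun h => by rw [h]⟩
  have hi : ∀ l, singularPoint Ω T (edge T k p.opp) ≠ (T l).incenter := fun l =>
    incenter_ne_of_mem_openEdge hT (singularPoint_mem_openEdge hT hΩ k _)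
  have hc : singularPoint Ω T (edge T k p.opp) ∈ closure Ω :=
    cell_subset_closure hT hΩ k p (cellPts_mem_cell k p 1)
  rw [ext0_sum _ _ hc]
  have e1 : ∀ e : ↥(intEdges Ω T \ tree), x (.inl e) • ext0 (basisFun Ω T n t
      (.inl e : BasisIndex Ω T tree)) (singularPoint Ω T (edge T k p.opp)) =
      if edge T k p.opp = e then x (.inl e) • n e else 0 := by
    intro e
    obtain ⟨g1, g2⟩ := ext0_basisFun_apply (n := n) (t := t) hT hΩ
      (.inl e : BasisIndex Ω T tree) hv
    split_ifs with h
    · rw [g1 ((hs _ e.2.1).2 h)]; rfl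
    · rw [g2 fun h' => h ((hs _ e.2.1).1 h'), smul_zero]
  have e2 : ∀ e : intEdges Ω T, x (.inr (.inl e)) • ext0 (basisFun Ω T n t
      (.inr (.inl e) : BasisIndex Ω T tree)) (singularPoint Ω T (edge T k p.opp)) =
      if edge T k p.opp = e then x (.inr (.inl e)) • t e else 0 := by
    intro e
    obtain ⟨g1, g2⟩ := ext0_basisFun_apply (n := n) (t := t) hT hΩ
      (.inr (.inl e) : BasisIndex Ω T tree) hv
    split_ifs with h
    · rw [g1 ((hs _ e.2).2 h)]; rfl
    · rw [g2 fun h' => h ((hs _ e.2).1 h'), smul_zero]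
  have e3 : ∀ l, ext0 (basisFun Ω T n t (.inr (.inr (.inl l)) : BasisIndex Ω T tree))
      (singularPoint Ω T (edge T k p.opp)) = 0 := fun l =>
    (ext0_basisFun_apply hT hΩ _ hv).2 (hi l)
  have e4 : ∀ l, ext0 (basisFun Ω T n t (.inr (.inr (.inr l)) : BasisIndex Ω T tree))
      (singularPoint Ω T (edge T k p.opp)) = 0 := fun l =>
    (ext0_basisFun_apply hT hΩ _ hv).2 (hi l)
  simp only [Fintype.sum_sum_type, e1, e2, e3, e4, smul_zero, Finset.sum_const_zero, add_zero]
  rw [sum_subtype_ite (fun e : ↥(intEdges Ω T \ tree) => x (.inl e) • n e),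
    sum_subtype_ite (fun e : intEdges Ω T => x (.inr (.inl e)) • t e)]
  rfl

open Classical in
lemma ext0_sum_incenter (x : BasisIndex Ω T tree → ℝ) (k : ι) :
    ext0 (∑ i, x i • basisFun Ω T n t i) (T k).incenter = centerValue x k := by
  obtain ⟨p, -⟩ := exists_flag_fst 0
  have hv := cellPts_mem_splitVertices (Ω := Ω) (T := T) k p 2
  change (T k).incenter ∈ _ at hv
  have hs : ∀ e ∈ intEdges Ω T, (T k).incenter ≠ singularPoint Ω T e := by
    intro e he
    obtain ⟨l, m, rfl⟩ := exists_edge_of_mem_edgeSet he.1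
    exact (incenter_ne_of_mem_openEdge hT (singularPoint_mem_openEdge hT hΩ l m)).symm
  have hi : ∀ l, ((T k).incenter = (T l).incenter ↔ k = l) := by
    refine fun l => ⟨fun h => ?_, fun h => by rw [h]⟩
    have := interior_subset (incenter_mem_interior_hull (T := T) k)
    rw [h] at this
    exact eq_of_mem_interior hT (incenter_mem_interior_hull l) this
  have hc : (T k).incenter ∈ closure Ω :=
    cell_subset_closure hT hΩ k p (cellPts_mem_cell k p 2)
  rw [ext0_sum _ _ hc]
  have e1 : ∀ e : ↥(intEdges Ω T \ tree), ext0 (basisFun Ω T n t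
      (.inl e : BasisIndex Ω T tree)) (T k).incenter = 0 := fun e =>
    (ext0_basisFun_apply hT hΩ _ hv).2 (hs _ e.2.1)
  have e2 : ∀ e : intEdges Ω T, ext0 (basisFun Ω T n t
      (.inr (.inl e) : BasisIndex Ω T tree)) (T k).incenter = 0 := fun e =>
    (ext0_basisFun_apply hT hΩ _ hv).2 (hs _ e.2)
  have e3 : ∀ l, x (.inr (.inr (.inl l))) • ext0 (basisFun Ω T n t
      (.inr (.inr (.inl l)) : BasisIndex Ω T tree)) (T k).incenter =
      if k = l then x (.inr (.inr (.inl l))) • !₂[(1 : ℝ), 0] else 0 := by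
    intro l
    obtain ⟨g1, g2⟩ := ext0_basisFun_apply (n := n) (t := t) hT hΩ
      (.inr (.inr (.inl l)) : BasisIndex Ω T tree) hv
    split_ifs with h
    · rw [g1 ((hi l).2 h)]; rfl
    · rw [g2 fun h' => h ((hi l).1 h'), smul_zero]
  have e4 : ∀ l, x (.inr (.inr (.inr l))) • ext0 (basisFun Ω T n t
      (.inr (.inr (.inr l)) : BasisIndex Ω T tree)) (T k).incenter =
      if k = l then x (.inr (.inr (.inr l))) • !₂[(0 : ℝ), 1] else 0 := by
    intro l
    obtain ⟨g1, g2⟩ := ext0_basisFun_apply (n := n) (t := t) hT hΩ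
      (.inr (.inr (.inr l)) : BasisIndex Ω T tree) hv
    split_ifs with h
    · rw [g1 ((hi l).2 h)]; rfl
    · rw [g2 fun h' => h ((hi l).1 h'), smul_zero]
  simp only [Fintype.sum_sum_type, e1, e2, e3, e4, smul_zero, Finset.sum_const_zero, zero_add,
    Finset.sum_ite_eq, Finset.mem_univ, if_true, centerValue]
  apply E2_ext <;> simp

/-- This reduces statements about combinations of basis functions to the nodal problem with zero
values at the macro-vertices. -/
lemma fieldDiv_sum (x : BasisIndex Ω T tree → ℝ) :
    fieldDiv Ω T (ext0 (∑ i, x i • basisFun Ω T n t i)) =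
      nodalDiv Ω T 0 (edgeValue n t x) (centerValue x) := by
  funext k p
  rw [fieldDiv, nodalDiv, nodalDiv, ext0_sum_points hT hΩ, ext0_sum_singularPoint hT hΩ,
    ext0_sum_incenter hT hΩ]
  rfl

end coeff

section frame

variable (hn : ∀ a b, s(a, b) ∈ intEdges Ω T → ‖n s(a, b)‖ = 1 ∧ inner ℝ (n s(a, b)) (b - a) = 0)
    (ht : ∀ a b, s(a, b) ∈ intEdges Ω T → ‖t s(a, b)‖ = 1 ∧ ∃ r : ℝ, b - a = r • t s(a, b))
include hn ht

lemma det2_normal_tangent {k : ι} {m : Fin 3} (h : edge T k m ∈ intEdges Ω T) :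
    det2 (n (edge T k m)) (edgeVec T k m) ≠ 0 ∧
      ∃ r : ℝ, r ≠ 0 ∧ edgeVec T k m = r • t (edge T k m) := by
  have h' := h
  rw [edge_eq_src_tgt] at h' ⊢
  obtain ⟨n1, n2⟩ := hn _ _ h'
  obtain ⟨t1, r, hr⟩ := ht _ _ h'
  have hne : edgeVec T k m ≠ 0 := sub_ne_zero.2 (src_ne_tgt k m).symm
  refine ⟨det2_ne_zero_of_inner (fun h0 => ?_) hne n2, r, fun h0 => hne ?_, hr⟩
  · rw [h0, norm_zero] at n1; exact zero_ne_one n1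
  · rw [edgeVec, hr, h0, zero_smul]

lemma det2_normal_tangent_ne_zero {k : ι} {m : Fin 3} (h : edge T k m ∈ intEdges Ω T) :
    det2 (n (edge T k m)) (t (edge T k m)) ≠ 0 := by
  obtain ⟨h1, r, -, hr⟩ := det2_normal_tangent hn ht h
  rw [hr, det2_smul_right] at h1
  exact right_ne_zero_of_mul h1

-- On a tree edge only the tangential function is available, and it carries no flux.
omit hn in
lemma det2_edgeValue_tree {x : BasisIndex Ω T tree → ℝ} {k : ι} {m : Fin 3}
    (h : edge T k m ∈ tree) : det2 (edgeValue n t x (edge T k m)) (edgeVec T k m) = 0 := by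
  rw [edgeValue, dif_neg fun h' => h'.2 h, zero_add]
  split_ifs with hi
  · obtain ⟨-, r, hr⟩ := ht (src T k m) (tgt T k m) (edge_eq_src_tgt (T := T) k m ▸ hi)
    rw [← edge_eq_src_tgt] at hr
    rw [edgeVec, hr, det2_smul_left, det2_smul_right, det2_self]
    ring
  · exact det2_zero_left _

omit hn ht in
lemma edgeValue_ext {x : BasisIndex Ω T tree → ℝ} {e : Sym2 E2} (h : e ∉ intEdges Ω T) :
    edgeValue n t x e = 0 := by
  rw [edgeValue, dif_neg fun h' => h h'.1, dif_neg h, zero_add]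

lemma eq_zero_of_values {x : BasisIndex Ω T tree → ℝ}
    (h : ∀ k m, edgeValue n t x (edge T k m) = 0) (h' : ∀ k, centerValue x k = 0) : x = 0 := by
  have key : ∀ k m (hi : edge T k m ∈ intEdges Ω T),
      (∀ ht : edge T k m ∈ intEdges Ω T \ tree, x (.inl ⟨_, ht⟩) = 0) ∧
        x (.inr (.inl ⟨_, hi⟩)) = 0 := by
    intro k m hi
    have hD := det2_normal_tangent_ne_zero hn ht hi
    have hv := h k m
    rw [edgeValue, dif_pos hi] at hv
    have a2 : x (.inr (.inl ⟨_, hi⟩)) = 0 := by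
      have := congrArg (det2 (n (edge T k m))) hv
      rw [det2_add_right, det2_smul_right, det2_zero_right] at this
      split_ifs at this
      · rw [det2_smul_right, det2_self, mul_zero, zero_add] at this
        exact (mul_eq_zero.1 this).resolve_right hD
      · rw [det2_zero_right, zero_add] at this
        exact (mul_eq_zero.1 this).resolve_right hD
    refine ⟨fun hit => ?_, a2⟩
    rw [dif_pos hit, a2, zero_smul, add_zero] at hv
    have := congrArg (fun w => det2 w (t (edge T k m))) hv
    simp only [det2_smul_left, det2_zero_left] at this
    exact (mul_eq_zero.1 this).resolve_right hD
  funext i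
  rcases i with ⟨e, he⟩ | ⟨e, he⟩ | k | k
  · obtain ⟨k, m, rfl⟩ := exists_edge_of_mem_edgeSet he.1.1
    exact (key k m he.1).1 he
  · obtain ⟨k, m, rfl⟩ := exists_edge_of_mem_edgeSet he.1
    exact (key k m he).2
  · simpa [centerValue] using congrArg (fun w : E2 => w 0) (h' k)
  · simpa [centerValue] using congrArg (fun w : E2 => w 1) (h' k)

/-- Normal and tangent form a frame at each interior edge. On a tree edge the absence of flux forces
a tangential value, so the missing normal function is not needed. -/
lemma exists_values {y : Sym2 E2 → E2} {z : ι → E2}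
    (hy : ∀ k m, edge T k m ∉ intEdges Ω T → y (edge T k m) = 0)
    (hyt : ∀ k m, edge T k m ∈ tree → det2 (y (edge T k m)) (edgeVec T k m) = 0) :
    ∃ x : BasisIndex Ω T tree → ℝ, (∀ k m, edgeValue n t x (edge T k m) = y (edge T k m)) ∧
      centerValue x = z := by
  let x : BasisIndex Ω T tree → ℝ
    | .inl e => det2 (y e) (t e) / det2 (n e) (t e)
    | .inr (.inl e) => det2 (n e) (y e) / det2 (n e) (t e)
    | .inr (.inr (.inl k)) => z k 0
    | .inr (.inr (.inr k)) => z k 1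
  refine ⟨x, fun k m => ?_, ?_⟩
  · by_cases hi : edge T k m ∈ intEdges Ω T
    · have hD := det2_normal_tangent_ne_zero hn ht hi
      have hdec : y (edge T k m) =
          (det2 (y (edge T k m)) (t (edge T k m)) / det2 (n (edge T k m)) (t (edge T k m))) •
            n (edge T k m) +
          (det2 (n (edge T k m)) (y (edge T k m)) / det2 (n (edge T k m)) (t (edge T k m))) •
            t (edge T k m) := by
        rw [← sub_eq_zero]
        refine eq_zero_of_det2 hD ?_ ?_
        · rw [det2_sub_left, det2_add_left, det2_smul_left, det2_smul_left, det2_self,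
            det2_swap (t _) (n _), det2_swap (y _) (n _)]
          field_simp
          ring
        · rw [det2_sub_left, det2_add_left, det2_smul_left, det2_smul_left, det2_self]
          field_simp
          ring
      rw [edgeValue, dif_pos hi]
      conv_rhs => rw [hdec]
      congr 1
      split_ifs with hit
      · rfl
      · have htr : edge T k m ∈ tree := by
          by_contra hc
          exact hit ⟨hi, hc⟩
        obtain ⟨-, r, hr0, hr⟩ := det2_normal_tangent hn ht hi
        have h0 := hyt k m htr
        rw [hr, det2_smul_right] at h0
        rw [(mul_eq_zero.1 h0).resolve_left hr0, zero_div, zero_smul]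
    · rw [edgeValue_ext hi, hy k m hi]
  · funext k
    apply E2_ext <;> simp [centerValue, x]

end frame

end Mesh

/-! ### Integrals, divergence classes and the pressure space -/

/-- The unit simplex of the plane. -/
def unitSimplex : Fin 3 → E2 := ![0, EuclideanSpace.single 0 1, EuclideanSpace.single 1 1]

lemma area_unitSimplex : area unitSimplex = 1 := by
  simp [area, unitSimplex, det2]

/-- The triangle is an affine image of the unit simplex with determinant `area p`. The volume of the
simplex is left unevaluated: it is a common factor of all integrals, and only its positivity
matters. -/
lemma volume_hull (p : Fin 3 → E2) : volume (convexHull ℝ (range p)) =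
    ENNReal.ofReal |area p| * volume (convexHull ℝ (range unitSimplex)) := by
  let b := (EuclideanSpace.basisFun (Fin 2) ℝ).toBasis
  let M : Matrix (Fin 2) (Fin 2) ℝ :=
    !![(p 1 - p 0) 0, (p 2 - p 0) 0; (p 1 - p 0) 1, (p 2 - p 0) 1]
  let L : E2 →ₗ[ℝ] E2 := Matrix.toLin b b M
  have hdet : LinearMap.det L = area p := by
    rw [LinearMap.det_toLin, Matrix.det_fin_two_of, area, det2]
    ring
  have hL : ∀ j, L (EuclideanSpace.single j 1) = ∑ i, M i j • EuclideanSpace.single i 1 := by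
    intro j
    have := Matrix.toLin_self b b M j
    simpa [b] using this
  have hL0 : L (EuclideanSpace.single 0 1) = p 1 - p 0 := by
    rw [hL, Fin.sum_univ_two]
    apply E2_ext <;> simp [M]
  have hL1 : L (EuclideanSpace.single 1 1) = p 2 - p 0 := by
    rw [hL, Fin.sum_univ_two]
    apply E2_ext <;> simp [M]
  have himg : convexHull ℝ (range p) = (fun y => y + p 0) '' (L '' convexHull ℝ
      (range unitSimplex)) := by
    let A : E2 →ᵃ[ℝ] E2 := L.toAffineMap + AffineMap.const ℝ E2 (p 0)
    have hA : ⇑A = (fun y => y + p 0) ∘ L := rfl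
    rw [← image_comp, ← hA, AffineMap.image_convexHull, ← range_comp]
    congr 2
    funext i
    fin_cases i
    · simp [hA, unitSimplex]
    · simp [hA, unitSimplex, hL0]
    · simp [hA, unitSimplex, hL1]
  rw [himg, image_add_right, measure_preimage_add_right, Measure.addHaar_image_linearMap, hdet]

lemma volume_unitSimplex_pos : 0 < (volume (convexHull ℝ (range unitSimplex))).toReal := by
  have h : area unitSimplex ≠ 0 := by rw [area_unitSimplex]; exact one_ne_zero
  refine ENNReal.toReal_pos ?_ (isCompact_hull _).measure_lt_top.ne
  exact ((isOpen_interior.measure_pos volume (interior_hull_nonempty h)).trans_le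
    (measure_mono interior_subset)).ne'

section Mesh

variable {Ω : Set E2} {ι : Type*} {T : ι → Affine.Triangle ℝ E2}

lemma volume_frontier_cell (k : ι) (p : Flag) : volume (frontier (cell Ω T k p)) = 0 :=
  (convex_convexHull ℝ _).addHaar_frontier volume

lemma ae_mem_interior_of_mem_cell (k : ι) (p : Flag) :
    ∀ᵐ x ∂(μ Ω), x ∈ cell Ω T k p → x ∈ interior (cell Ω T k p) := by
  refine ae_restrict_of_ae ?_
  filter_upwards [measure_eq_zero_iff_ae_notMem.1 (volume_frontier_cell (Ω := Ω) (T := T) k p)]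
    with x hx hxc
  by_contra h
  exact hx ⟨subset_closure hxc, h⟩

variable (hT : IsConformingTriangulation Ω T) (hΩ : interior (closure Ω) = Ω)
include hT hΩ

section
variable [Finite ι]

omit hT in
lemma measurableSet_domain : MeasurableSet Ω := (isOpen_domain hΩ).measurableSet

lemma ae_exists_mem_interior_cell : ∀ᵐ x ∂(μ Ω), ∃ k p, x ∈ interior (cell Ω T k p) := by
  have h : ∀ᵐ x ∂(μ Ω), ∀ k p, x ∈ cell Ω T k p → x ∈ interior (cell Ω T k p) := by
    rw [ae_all_iff]
    intro k
    rw [ae_all_iff]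
    exact ae_mem_interior_of_mem_cell k
  filter_upwards [h, ae_restrict_mem (measurableSet_domain hΩ)] with x hx hxΩ
  obtain ⟨k, p, hxc⟩ := exists_mem_cell hT hΩ (subset_closure hxΩ)
  exact ⟨k, p, hx k p hxc⟩

omit hΩ in
lemma volume_domain_lt_top : volume Ω < ⊤ := by
  have : IsCompact (closure Ω) := by
    rw [hT.closure_eq]
    exact isCompact_iUnion fun k => isCompact_hull _
  exact (measure_mono subset_closure).trans_lt this.measure_lt_top

omit hΩ in
lemma isFiniteMeasure_domain : IsFiniteMeasure (μ Ω) :=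
  ⟨by rw [Measure.restrict_apply_univ]; exact volume_domain_lt_top hT⟩

lemma ae_imp_of_cell {P : E2 → Prop}
    (h : ∀ k p, ∀ᵐ x ∂(μ Ω), x ∈ cell Ω T k p → P x) : ∀ᵐ x ∂(μ Ω), P x := by
  have h' : ∀ᵐ x ∂(μ Ω), ∀ k p, x ∈ cell Ω T k p → P x := by
    rw [ae_all_iff]
    intro k
    rw [ae_all_iff]
    exact h k
  filter_upwards [h', ae_exists_mem_interior_cell hT hΩ] with x hx hx'
  obtain ⟨k, p, hxc⟩ := hx'
  exact hx k p (interior_subset hxc)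

end

/-- The integral of a piecewise constant function. -/
lemma integral_eq_sum [Fintype ι] {f : E2 → ℝ} {c : ι → Flag → ℝ}
    (h : ∀ k p, ∀ᵐ x ∂(μ Ω), x ∈ cell Ω T k p → f x = c k p) :
    ∫ x, f x ∂(μ Ω) = (volume (convexHull ℝ (range unitSimplex))).toReal *
      ∑ k, ∑ p, |area (cellPts Ω T k p)| * c k p := by
  let I : ι × Flag → Set E2 := fun η => interior (cell Ω T η.1 η.2)
  have hI : ∀ η, I η ⊆ Ω := fun η => interior_cell_subset hT hΩ _ _
  have hIm : ∀ η, MeasurableSet (I η) := fun η => isOpen_interior.measurableSet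
  have hU : (⋃ η, I η) =ᵐ[volume] Ω := by
    refine (iUnion_subset hI).eventuallyLE.antisymm ?_
    have := (ae_restrict_iff' (measurableSet_domain hΩ)).1 (ae_exists_mem_interior_cell hT hΩ)
    filter_upwards [this] with x hx hxΩ
    obtain ⟨k, p, hxc⟩ := hx hxΩ
    exact mem_iUnion.2 ⟨(k, p), hxc⟩
  have hc : ∀ η, f =ᵐ[volume.restrict (I η)] fun _ => c η.1 η.2 := by
    intro η
    have h1 := ae_restrict_of_ae_restrict_of_subset (hI η) (h η.1 η.2)
    filter_upwards [h1, ae_restrict_mem (hIm η)] with x hx hxI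
    exact hx (interior_subset hxI)
  have hfin : ∀ η, volume (I η) ≠ ⊤ := fun η =>
    ((measure_mono (hI η)).trans_lt (volume_domain_lt_top hT)).ne
  have hvol : ∀ η, volume.real (I η) = |area (cellPts Ω T η.1 η.2)| *
      (volume (convexHull ℝ (range unitSimplex))).toReal := by
    intro η
    have h1 : volume (I η) = volume (cell Ω T η.1 η.2) :=
      measure_congr (interior_ae_eq_of_null_frontier (volume_frontier_cell η.1 η.2))
    rw [Measure.real, h1, cell_eq, volume_hull, ENNReal.toReal_mul,
      ENNReal.toReal_ofReal (abs_nonneg _)]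
  have hdisj : Pairwise (Function.onFun Disjoint I) := fun η η' hne =>
    disjoint_interior_cell hT hΩ hne
  rw [μ, ← Measure.restrict_congr_set hU, integral_iUnion_fintype hIm hdisj fun η =>
    (integrable_congr (hc η)).2 (integrableOn_const (hfin η))]
  simp only [integral_congr_ae (hc _), setIntegral_const, hvol, smul_eq_mul]
  rw [Fintype.sum_prod_type, Finset.mul_sum]
  refine Finset.sum_congr rfl fun k _ => ?_
  rw [Finset.mul_sum]
  exact Finset.sum_congr rfl fun p _ => by ring

section
variable [Finite ι]

lemma ae_divergence_eq {v : C(closure Ω, E2)} (hv : v ∈ Xh Ω T) (k : ι) (p : Flag) :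
    ∀ᵐ x ∂(μ Ω), x ∈ cell Ω T k p → divergence v x = fieldDiv Ω T (ext0 v) k p := by
  filter_upwards [ae_mem_interior_of_mem_cell (Ω := Ω) (T := T) k p] with x hx hxc
  exact divergence_eq_fieldDiv hT hΩ hv (hx hxc)

omit hT hΩ [Finite ι] in
lemma coeFn_divClass (v : C(closure Ω, E2)) : divClass v =ᵐ[μ Ω] divergence v :=
  AEEqFun.coeFn_mk _ _

lemma ae_divClass_eq {v : C(closure Ω, E2)} (hv : v ∈ Xh Ω T) (k : ι) (p : Flag) :
    ∀ᵐ x ∂(μ Ω), x ∈ cell Ω T k p → divClass v x = fieldDiv Ω T (ext0 v) k p := by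
  filter_upwards [ae_divergence_eq hT hΩ hv k p, coeFn_divClass v] with x hx hx' hxc
  rw [hx', hx hxc]

lemma eq_divClass {v : C(closure Ω, E2)} (hv : v ∈ Xh Ω T) {q : E2 →ₘ[μ Ω] ℝ}
    (h : ∀ k p, ∀ᵐ x ∂(μ Ω), x ∈ cell Ω T k p → q x = fieldDiv Ω T (ext0 v) k p) :
    q = divClass v := by
  refine AEEqFun.ext (ae_imp_of_cell hT hΩ fun k p => ?_)
  filter_upwards [h k p, ae_divClass_eq hT hΩ hv k p] with x h1 h2 hxc
  rw [h1 hxc, h2 hxc]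

/-- The interior of a cell is open and nonempty, so it has positive measure and an almost everywhere
statement reaches it. -/
lemma fieldDiv_eq_zero_of_divClass_eq_zero {v : C(closure Ω, E2)} (hv : v ∈ Xh Ω T)
    (h : divClass v = 0) (k : ι) (p : Flag) : fieldDiv Ω T (ext0 v) k p = 0 := by
  by_contra hne
  have h1 : ∀ᵐ x ∂(μ Ω), x ∉ interior (cell Ω T k p) := by
    have h0 := AEEqFun.coeFn_zero (α := E2) (β := ℝ) (μ := μ Ω)
    rw [← h] at h0
    filter_upwards [h0, ae_divClass_eq hT hΩ hv k p] with x hx hx' hxc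
    exact hne ((hx' (interior_subset hxc)).symm.trans hx)
  have h2 := measure_eq_zero_iff_ae_notMem.2 h1
  rw [Measure.restrict_apply isOpen_interior.measurableSet,
    inter_eq_left.2 (interior_cell_subset hT hΩ k p)] at h2
  refine (isOpen_interior.measure_pos volume ?_).ne' h2
  rw [cell_eq]
  exact interior_hull_nonempty (area_cellPts_ne_zero hT hΩ k p)

/-- Additivity of the derivative requires differentiability, which piecewise affine fields have in
the interiors of the cells, that is, almost everywhere. -/
lemma divClass_add {v w : C(closure Ω, E2)} (hv : v ∈ Xh Ω T) (hw : w ∈ Xh Ω T) :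
    divClass (v + w) = divClass v + divClass w := by
  refine AEEqFun.ext ?_
  filter_upwards [coeFn_divClass (v + w), coeFn_divClass v, coeFn_divClass w,
    AEEqFun.coeFn_add (divClass v) (divClass w), ae_exists_mem_interior_cell hT hΩ]
    with x h1 h2 h3 h4 h5
  obtain ⟨k, p, hx⟩ := h5
  have hxΩ : x ∈ interior Ω := by
    rw [(isOpen_domain hΩ).interior_eq]
    exact interior_cell_subset hT hΩ k p hx
  have d1 := Xh_differentiableAt Ω hv hxΩ hx
  have d2 := Xh_differentiableAt Ω hw hxΩ hx
  rw [h4, Pi.add_apply, h1, h2, h3]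
  simp only [divergence, ext0_add, fderiv_add d1 d2, add_apply, PiLp.add_apply,
    Finset.sum_add_distrib]

lemma divClass_smul {v : C(closure Ω, E2)} (r : ℝ) (hv : v ∈ Xh Ω T) :
    divClass (r • v) = r • divClass v := by
  refine AEEqFun.ext ?_
  filter_upwards [coeFn_divClass (r • v), coeFn_divClass v,
    AEEqFun.coeFn_smul r (divClass v), ae_exists_mem_interior_cell hT hΩ] with x h1 h2 h3 h4
  obtain ⟨k, p, hx⟩ := h4
  have hxΩ : x ∈ interior Ω := by
    rw [(isOpen_domain hΩ).interior_eq]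
    exact interior_cell_subset hT hΩ k p hx
  have d1 := Xh_differentiableAt Ω hv hxΩ hx
  rw [h3, Pi.smul_apply, h1, h2]
  simp only [divergence, ext0_smul, fderiv_const_smul d1, smul_apply, PiLp.smul_apply,
    smul_eq_mul, Finset.mul_sum]

lemma divClass_sum {κ : Type*} [Fintype κ] (S : κ → C(closure Ω, E2)) (hS : ∀ i, S i ∈ Xh Ω T)
    (x : κ → ℝ) : divClass (∑ i, x i • S i) = ∑ i, x i • divClass (S i) := by
  let D : Xh Ω T →ₗ[ℝ] E2 →ₘ[μ Ω] ℝ :=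
    { toFun := fun v => divClass v.1
      map_add' := fun v w => divClass_add hT hΩ v.2 w.2
      map_smul' := fun r v => divClass_smul hT hΩ r v.2 }
  have h := map_sum D (fun i => x i • (⟨S i, hS i⟩ : Xh Ω T)) Finset.univ
  simp only [map_smul] at h
  refine Eq.trans ?_ h
  change _ = divClass ((∑ i, x i • (⟨S i, hS i⟩ : Xh Ω T) : Xh Ω T) : C(closure Ω, E2))
  rw [AddSubmonoidClass.coe_finsetSum]
  rfl

lemma mem_Vh0_iff {v : C(closure Ω, E2)} :
    v ∈ Vh0 Ω T ↔ v ∈ Xh0 Ω T ∧ ∀ k p, fieldDiv Ω T (ext0 v) k p = 0 := by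
  constructor
  · rintro ⟨h1, h2⟩
    refine ⟨h1, fun k p => ?_⟩
    obtain ⟨x, hx⟩ : (interior (cell Ω T k p)).Nonempty := by
      rw [cell_eq]
      exact interior_hull_nonempty (area_cellPts_ne_zero hT hΩ k p)
    rw [← divergence_eq_fieldDiv hT hΩ h1.1 hx]
    refine h2 k p x ?_ hx
    rw [(isOpen_domain hΩ).interior_eq]
    exact interior_cell_subset hT hΩ k p hx
  · rintro ⟨h1, h2⟩
    refine ⟨h1, fun k p x _ hx => ?_⟩
    rw [divergence_eq_fieldDiv hT hΩ h1.1 hx, h2]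

omit hT hΩ [Finite ι] in
lemma fieldDiv_sub (v w : C(closure Ω, E2)) (k : ι) (p : Flag) :
    fieldDiv Ω T (ext0 (v - w)) k p = fieldDiv Ω T (ext0 v) k p - fieldDiv Ω T (ext0 w) k p := by
  have h : ext0 (v - w) = ext0 v + (-1 : ℝ) • ext0 w := by
    rw [← ext0_smul, ← ext0_add, sub_eq_add_neg, neg_one_smul ℝ w]
  simp only [fieldDiv, nodalDiv, cellDiv, h, Pi.add_apply, Pi.smul_apply, Matrix.cons_val]
  rw [← sub_div]
  congr 1
  simp [det2]; ring

lemma ae_divergence_basisFun_eq_zero {tree : Set (Sym2 E2)} {n t : Sym2 E2 → E2}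
    (i : BasisIndex Ω T tree) : ∀ᵐ x ∂(μ Ω), x ∉ star Ω T (basisNode Ω T i) →
      divergence (basisFun Ω T n t i) x = 0 := by
  refine ae_imp_of_cell hT hΩ fun k p => ?_
  filter_upwards [ae_divergence_eq hT hΩ (basisFun_mem_Xh (n := n) (t := t) hT hΩ i) k p]
    with x hx hxc hxs
  rw [hx hxc]
  exact fieldDiv_basisFun_eq_zero hT hΩ fun h => hxs ⟨k, p, h, hxc⟩

end

section
variable [Fintype ι]

/-- The divergence of a field that vanishes on the boundary belongs to the pressure space. -/
lemma divClass_mem_Ph {v : C(closure Ω, E2)} (hv : v ∈ Xh0 Ω T) : divClass v ∈ Ph Ω T := by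
  have hfin := isFiniteMeasure_domain hT
  have hae := ae_divClass_eq hT hΩ hv.1
  have hbd : ∀ᵐ x ∂(μ Ω), ‖divClass v x‖ ≤ ∑ k, ∑ p, |fieldDiv Ω T (ext0 v) k p| := by
    refine ae_imp_of_cell hT hΩ fun k p => ?_
    filter_upwards [hae k p] with x hx hxc
    rw [hx hxc, Real.norm_eq_abs]
    refine le_trans ?_ (Finset.single_le_sum (f := fun k => ∑ p, |fieldDiv Ω T (ext0 v) k p|)
      (fun k _ => Finset.sum_nonneg fun p _ => abs_nonneg _) (Finset.mem_univ k))
    exact Finset.single_le_sum (f := fun p => |fieldDiv Ω T (ext0 v) k p|)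
      (fun p _ => abs_nonneg _) (Finset.mem_univ p)
  have hLp : MemLp (divClass v) 2 (μ Ω) :=
    MemLp.of_bound (AEEqFun.aestronglyMeasurable _) _ hbd
  have hnod : ∀ k m, edge T k m ∉ intEdges Ω T → ext0 v (singularPoint Ω T (edge T k m)) = 0 ∧
      ext0 v (src T k m) = 0 ∧ ext0 v (tgt T k m) = 0 := nodal_eq_zero_of_mem_Xh0 hT hΩ hv
  refine ⟨hLp, hLp.integrable one_le_two, ?_, _, hae, thetaVanishes_nodalDiv hT hΩ _ _ _ hnod⟩
  rw [integral_eq_sum hT hΩ hae]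
  have := sum_nodalDiv_eq_zero hT hΩ (ext0 v) (fun e => ext0 v (singularPoint Ω T e))
    (fun k => ext0 v (T k).incenter) hnod
  exact mul_eq_zero_of_right _ this

end

end Mesh

/-! ### The divergence on combinations of basis functions -/

section Mesh

variable {Ω : Set E2} {ι : Type*} [Fintype ι] {T : ι → Affine.Triangle ℝ E2} {z₀ : E2}
    {G : SimpleGraph (treeVertices Ω T z₀)} {n t : Sym2 E2 → E2}
    [Fintype (intEdges Ω T)]
    [Fintype ↥(intEdges Ω T \ (Sym2.map Subtype.val '' G.edgeSet))]
    (hΩ : interior (closure Ω) = Ω) (hsc : IsSimplyConnected Ω)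
    (hT : IsConformingTriangulation Ω T) (hz₀ : z₀ ∈ extVertices Ω T)
    (hG : G ≤ treeGraph Ω T z₀) (hGtree : G.IsTree)
    (hn : ∀ a b, s(a, b) ∈ intEdges Ω T → ‖n s(a, b)‖ = 1 ∧ inner ℝ (n s(a, b)) (b - a) = 0)
    (ht : ∀ a b, s(a, b) ∈ intEdges Ω T → ‖t s(a, b)‖ = 1 ∧ ∃ r : ℝ, b - a = r • t s(a, b))
include hΩ hsc hT hz₀ hG hGtree hn ht

/-- A divergence-free combination of the basis functions is trivial. -/
lemma eq_zero_of_fieldDiv_sum_eq_zero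
    {x : BasisIndex Ω T (Sym2.map Subtype.val '' G.edgeSet) → ℝ}
    (h : ∀ k p, fieldDiv Ω T (ext0 (∑ i, x i • basisFun Ω T n t i)) k p = 0) : x = 0 := by
  rw [fieldDiv_sum hT hΩ] at h
  obtain ⟨h1, h2⟩ := eq_zero_of_nodalDiv_eq_zero hT hΩ hz₀ hG hGtree hsc
    (fun k m hm => edgeValue_ext hm) (fun k m hm => det2_edgeValue_tree ht hm) h
  exact eq_zero_of_values hn ht h1 h2

/-- Every admissible piecewise constant is the divergence of a combination of the basis functions. -/
lemma exists_fieldDiv_sum_eq {c : ι → Flag → ℝ} (hc : ThetaVanishes Ω T c)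
    (hc0 : ∑ k, ∑ p, |area (cellPts Ω T k p)| * c k p = 0) :
    ∃ x : BasisIndex Ω T (Sym2.map Subtype.val '' G.edgeSet) → ℝ,
      fieldDiv Ω T (ext0 (∑ i, x i • basisFun Ω T n t i)) = c := by
  obtain ⟨y, z, h1, h2, h3⟩ := exists_nodalDiv_eq hT hΩ hz₀ hG hGtree hsc hc hc0
  obtain ⟨x, hx1, hx2⟩ := exists_values (z := z) hn ht h1 h2
  refine ⟨x, ?_⟩
  rw [fieldDiv_sum hT hΩ, ← h3]
  funext k p
  rw [nodalDiv, nodalDiv, hx1, hx2]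

end Mesh

end PowellSabin
end

open PowellSabin

theorem theorem2 {Ω : Set PowellSabin.E2}
    -- a simply connected polygonal domain (open, without slits) with a conforming triangulation
    (hΩ : interior (closure Ω) = Ω) (hsc : IsSimplyConnected Ω)
    {ι : Type*} [Fintype ι] (T : ι → Affine.Triangle ℝ PowellSabin.E2)
    (hT : PowellSabin.IsConformingTriangulation Ω T)
    -- one boundary vertex, and a spanning tree
    (z₀ : PowellSabin.E2) (hz₀ : z₀ ∈ PowellSabin.extVertices Ω T)
    (G : SimpleGraph (PowellSabin.treeVertices Ω T z₀))
    (hG : G ≤ PowellSabin.treeGraph Ω T z₀) (hGtree : G.IsTree)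
    -- unit normals and unit tangents of the interior edges
    (n t : Sym2 PowellSabin.E2 → PowellSabin.E2)
    (hn : ∀ a b, s(a, b) ∈ PowellSabin.intEdges Ω T →
      ‖n s(a, b)‖ = 1 ∧ inner ℝ (n s(a, b)) (b - a) = 0)
    (ht : ∀ a b, s(a, b) ∈ PowellSabin.intEdges Ω T →
      ‖t s(a, b)‖ = 1 ∧ ∃ r : ℝ, b - a = r • t s(a, b))
    (tree : Set (Sym2 PowellSabin.E2)) (htree : tree = Sym2.map Subtype.val '' G.edgeSet)
    (S : PowellSabin.BasisIndex Ω T tree → C(closure Ω, PowellSabin.E2))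
    (hS : S = PowellSabin.basisFun Ω T n t) :
    -- `S` is a basis of a complement of `V_h^0` in `X_h^0`
    (∀ i, S i ∈ PowellSabin.Xh0 Ω T ∧ S i ∉ PowellSabin.Vh0 Ω T) ∧
    LinearIndependent ℝ S ∧
    Disjoint (PowellSabin.Vh0 Ω T) (Submodule.span ℝ (range S)) ∧
    PowellSabin.Vh0 Ω T ⊔ Submodule.span ℝ (range S) = PowellSabin.Xh0 Ω T ∧
    -- the divergences form a basis of `P_h`
    LinearIndependent ℝ (fun i => PowellSabin.divClass (S i)) ∧
    Submodule.span ℝ (range fun i => PowellSabin.divClass (S i)) = PowellSabin.Ph Ω T ∧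
    -- the supports are local
    (∀ i, (∀ x : closure Ω, (x : PowellSabin.E2) ∉ PowellSabin.star Ω T (PowellSabin.basisNode Ω T i) →
        S i x = 0) ∧
      ∀ᵐ x ∂(PowellSabin.μ Ω), x ∉ PowellSabin.star Ω T (PowellSabin.basisNode Ω T i) →
        PowellSabin.divergence (S i) x = 0) := by
  classical
  subst htree hS
  have : Finite (intEdges Ω T) := finite_intEdges
  have : Fintype (intEdges Ω T) := Fintype.ofFinite _
  have : Finite ↥(intEdges Ω T \ (Sym2.map Subtype.val '' G.edgeSet)) :=
    finite_intEdges.subset sdiff_subset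
  have : Fintype ↥(intEdges Ω T \ (Sym2.map Subtype.val '' G.edgeSet)) := Fintype.ofFinite _
  set S : BasisIndex Ω T (Sym2.map Subtype.val '' G.edgeSet) → C(closure Ω, E2) :=
    basisFun Ω T n t with hS
  have hXh0 : ∀ i, S i ∈ Xh0 Ω T := basisFun_mem_Xh0 hT hΩ
  have hXh : ∀ i, S i ∈ Xh Ω T := fun i => (hXh0 i).1
  have hsumX : ∀ x : BasisIndex Ω T (Sym2.map Subtype.val '' G.edgeSet) → ℝ,
      ∑ i, x i • S i ∈ Xh0 Ω T := fun x =>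
    Submodule.sum_mem _ fun i _ => Submodule.smul_mem _ _ (hXh0 i)
  have hinj : ∀ x : BasisIndex Ω T (Sym2.map Subtype.val '' G.edgeSet) → ℝ,
      (∀ k p, fieldDiv Ω T (ext0 (∑ i, x i • S i)) k p = 0) → x = 0 := fun x h =>
    eq_zero_of_fieldDiv_sum_eq_zero hΩ hsc hT hz₀ hG hGtree hn ht h
  have hdiv : LinearIndependent ℝ fun i => divClass (S i) := by
    rw [Fintype.linearIndependent_iff]
    intro x hx
    rw [← divClass_sum hT hΩ S hXh] at hx
    exact congrFun (hinj x (fieldDiv_eq_zero_of_divClass_eq_zero hT hΩ (hsumX x).1 hx))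
  have hVh0 : ∀ x : BasisIndex Ω T (Sym2.map Subtype.val '' G.edgeSet) → ℝ,
      ∑ i, x i • S i ∈ Vh0 Ω T → x = 0 := fun x h => hinj x ((mem_Vh0_iff hT hΩ).1 h).2
  refine ⟨fun i => ⟨hXh0 i, fun hi => ?_⟩, ?_, ?_, le_antisymm ?_ ?_, hdiv, le_antisymm ?_ ?_,
    fun i => ⟨basisFun_apply_eq_zero hT hΩ i, ae_divergence_basisFun_eq_zero hT hΩ i⟩⟩
  · have hsum : ∑ j, (Pi.single i (1 : ℝ) : _ → ℝ) j • S j = S i := by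
      rw [Finset.sum_eq_single i (fun j _ hj => by rw [Pi.single_eq_of_ne hj, zero_smul ℝ (S j)])
        (fun h => absurd (Finset.mem_univ i) h), Pi.single_eq_same, one_smul]
    have h := hVh0 (Pi.single i 1) (hsum ▸ hi)
    simpa using congrFun h i
  · rw [Fintype.linearIndependent_iff]
    intro x hx
    exact congrFun (hVh0 x (hx ▸ zero_mem _))
  · rw [Submodule.disjoint_def]
    intro v hv hvS
    obtain ⟨x, rfl⟩ := (Submodule.mem_span_range_iff_exists_fun ℝ).1 hvS
    simp [hVh0 x hv]
  · refine sup_le (fun v hv => hv.1) (Submodule.span_le.2 ?_)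
    rintro _ ⟨i, rfl⟩
    exact hXh0 i
  · intro v hv
    have hnod := nodal_eq_zero_of_mem_Xh0 hT hΩ hv
    -- The divergence of `v` has mean zero and satisfies the relations at the singular points, so a
    -- combination of basis functions has the same divergence; the difference is solenoidal.
    obtain ⟨x, hx⟩ := exists_fieldDiv_sum_eq (n := n) (t := t) hΩ hsc hT hz₀ hG hGtree hn ht
      (thetaVanishes_nodalDiv hT hΩ (ext0 v) (fun e => ext0 v (singularPoint Ω T e))
        (fun k => ext0 v (T k).incenter) hnod)
      (sum_nodalDiv_eq_zero hT hΩ _ _ _ hnod)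
    rw [← sub_add_cancel v (∑ i, x i • S i)]
    refine Submodule.add_mem_sup ((mem_Vh0_iff hT hΩ).2 ⟨Submodule.sub_mem _ hv (hsumX x), ?_⟩)
      (Submodule.sum_mem _ fun i _ => Submodule.smul_mem _ _ (Submodule.subset_span ⟨i, rfl⟩))
    intro k p
    rw [fieldDiv_sub, hS, hx, sub_self]
  · refine Submodule.span_le.2 ?_
    rintro _ ⟨i, rfl⟩
    exact divClass_mem_Ph hT hΩ (hXh0 i)
  · rintro q ⟨-, -, h0, c, hc, hθ⟩
    rw [integral_eq_sum hT hΩ hc] at h0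
    -- The vanishing integral is a positive constant times the area-weighted sum of `c`, so that sum
    -- is zero and `c` is attained.
    obtain ⟨x, hx⟩ := exists_fieldDiv_sum_eq (n := n) (t := t) hΩ hsc hT hz₀ hG hGtree hn ht hθ
      ((mul_eq_zero.1 h0).resolve_left volume_unitSimplex_pos.ne')
    have hq : q = divClass (∑ i, x i • S i) :=
      eq_divClass hT hΩ (hsumX x).1 (by rw [hS, hx]; exact hc)
    rw [hq, divClass_sum hT hΩ S hXh]
    exact Submodule.sum_mem _ fun i _ => Submodule.smul_mem _ _ (Submodule.subset_span ⟨i, rfl⟩)
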